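/- Let $s\ge 1$, let $p_1,\dots,p_s$ be positive integers, $n=p_1+\cdots+p_s$, let $\mathbb{D}\subset\mathbb{C}^s$ be an open polydisc, and for $\lambda=(\lambda_1,\dots,\lambda_s)\in\mathbb{D}$ put $\Lambda=\lambda_1I_{p_1}\oplus\cdots\oplus\lambda_sI_{p_s}$. Let $A:\mathbb{D}\to \mathrm{Mat}_n(\mathbb{C})$ be holomorphic, and consider the system $$\frac{dY}{dz}=\Big(\Lambda+\frac{A(\lambda)}{z}\Big)Y .\qquad (1)$$ Let $\mathcal{R}$ be the universal covering of $\mathbb{C}\setminus\{0\}$. *Definitions.* An *isomonodromic solution* of (1) is a fundamental matrix solution $Y(z,\lambda)$, holomorphic on $\mathcal{R}\times\mathbb{D}$, such that $Y(ze^{2\pi i},\lambda)=Y(z,\lambda)M$ with a matrix $M$ independent of $\lambda$; (1) is *weakly isomonodromic* if one exists. A fundamental matrix solution $Y$ of (1) is *in Levelt form* (at $z=0$) if for every $\lambda\in\mathbb{D}$ $$Y(z,\lambda)=G^{(0)}(\lambda)\,\widehat Y^{(0)}(z,\lambda)\,z^{D^{(0)}(\lambda)}z^{L^{(0)}(\lambda)},\qquad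 J^{(0)}=D^{(0)}+S^{(0)},\quad L^{(0)}=S^{(0)}+R^{(0)},$$ where $G^{(0)}(\lambda)$ is invertible and $J^{(0)}=(G^{(0)})^{-1}AG^{(0)}$ is a Jordan matrix (ones on the upper second diagonal) with diagonal entries $\mu_1,\dots,\mu_n$; $D^{(0)}=\mathrm{diag}(d_1,\dots,d_n)$ with $d_i\in\mathbb{Z}$ and $0\le \mathrm{Re}(\mu_i-d_i)<1$; $R^{(0)}$ is nilpotent with $R^{(0)}_{ij}\ne 0$ only if $\mu_i-\mu_j\in\{1,2,3,\dots\}$; and $\widehat Y^{(0)}(z,\lambda)=I+\sum_{k\ge1}F_k(\lambda)z^k$ converges for all $z\in\mathbb{C}$. No regularity in $\lambda$ of these individual matrices is required. An *integrable Pfaffian system* for (1) is $$dY=\omega Y,\qquad \omega=\Big(\Lambda+\frac{A}{z}\Big)dz+\sum_{j=1}^s\omega_j(z,\lambda)\,d\lambda_j,\qquad d\omega=\omega\wedge\omega,\qquad (2)$$ with $\omega_j$ holomorphic on $(\mathbb{C}\setminus\{0\})\times\mathbb{D}$. *Theorem.* 1. The system (1) has an isomonodromic solution in Levelt form if and only if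 there is an integrable Pfaffian system (2) for (1) whose coefficients $\omega_j$ are holomorphic on $\mathbb{C}\times\mathbb{D}$. More precisely, for each integrable Pfaffian system (2): it has a solution $Y$ which is an isomonodromic solution of (1) in Levelt form if and only if all the $\omega_j$ extend holomorphically to $\mathbb{C}\times\mathbb{D}$. 2. Let $Y$ be any isomonodromic solution of (1) in Levelt form, with matrices $G^{(0)},D^{(0)},L^{(0)},J^{(0)},R^{(0)}$ as above. Then $D^{(0)}$ and $L^{(0)}$ (equivalently $J^{(0)}$ and $R^{(0)}$) are constant on $\mathbb{D}$. Moreover $Y$ solves an integrable Pfaffian system (2) with $\omega_j$ holomorphic on $\mathbb{C}\times\mathbb{D}$, and for any such system $G^{(0)}$ is holomorphic and invertible on $\mathbb{D}$, is a fundamental matrix solution of $$dG=\sum_{j=1}^s\omega_j(0,\lambda)\,d\lambda_j\;G ,$$ and $(G^{(0)})^{-1}AG^{(0)}=J^{(0)}$; thus $A$ is holomorphically similar to the constant matrix $J^{(0)}$. -/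

import Mathlib

namespace Isomonodromy

/-- Complex square matrices of size `n`. -/
abbrev Mat (n : ℕ) : Type := Matrix (Fin n) (Fin n) ℂ

/-- The open polydisc in `ℂ^s` with centre `c` and radii `r 0, …, r (s-1)`. -/
def polydisc {s : ℕ} (c : Fin s → ℂ) (r : Fin s → ℝ) : Set (Fin s → ℂ) :=
  {l | ∀ j, ‖l j - c j‖ < r j}

/-- A matrix-valued function is holomorphic on an (open) set if all its entries are. -/
def HolomorphicMatOn {E : Type*} [NormedAddCommGroup E] [NormedSpace ℂ E] {n : ℕ}
    (f : E → Mat n) (U : Set E) : Prop :=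
  ∀ a b, DifferentiableOn ℂ (fun q => f q a b) U

/-- `Λ = λ₁ I_{p₁} ⊕ ⋯ ⊕ λ_s I_{p_s}`: consecutive diagonal blocks of sizes `p 0, …, p (s-1)`. -/
noncomputable def Lam {s : ℕ} (p : Fin s → ℕ) (l : Fin s → ℂ) : Mat (∑ j, p j) :=
  Matrix.diagonal fun i => l (finSigmaFinEquiv.symm i).1

/-- The coefficient `Λ + A(λ)/z` of the system `dY/dz = (Λ + A(λ)/z) Y`. -/
noncomputable def coeff {s : ℕ} {p : Fin s → ℕ} (A : (Fin s → ℂ) → Mat (∑ j, p j))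
    (z : ℂ) (l : Fin s → ℂ) : Mat (∑ j, p j) :=
  Lam p l + z⁻¹ • A l

/-! The universal covering of `ℂ ∖ {0}` is `ℂ` with coordinate `w` and projection `z = exp w`;
`z ↦ z e^{2πi}` is `w ↦ w + 2πi`, and `d/dw = z d/dz`.
Functions on (covering) `× 𝔻` are functions of the pair `(w, λ)`. -/

/-- `Y` is a fundamental matrix solution of `dY/dz = (Λ + A(λ)/z) Y` for every `λ ∈ 𝔻`. -/
structure IsFundamentalSolution {s : ℕ} {p : Fin s → ℕ} (𝔻 : Set (Fin s → ℂ))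
    (A : (Fin s → ℂ) → Mat (∑ j, p j)) (Y : ℂ × (Fin s → ℂ) → Mat (∑ j, p j)) : Prop where
  ode : ∀ l ∈ 𝔻, ∀ w a b, HasDerivAt (fun w' => Y (w', l) a b)
    (Complex.exp w * (coeff A (Complex.exp w) l * Y (w, l)) a b) w
  invertible : ∀ l ∈ 𝔻, ∀ w, IsUnit (Y (w, l))

/-- `Y` is a fundamental matrix solution that is holomorphic on (covering) `× 𝔻` and
has a `λ`-independent monodromy matrix. The system is weakly isomonodromic in `𝔻` when such a
`Y` exists. -/
structure IsIsomonodromicSolution {s : ℕ} {p : Fin s → ℕ} (𝔻 : Set (Fin s → ℂ))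
    (A : (Fin s → ℂ) → Mat (∑ j, p j)) (Y : ℂ × (Fin s → ℂ) → Mat (∑ j, p j)) : Prop where
  fundamental : IsFundamentalSolution 𝔻 A Y
  holomorphic : HolomorphicMatOn Y (Set.univ ×ˢ 𝔻)
  monodromy : ∃ M : Mat (∑ j, p j), ∀ l ∈ 𝔻, ∀ w,
    Y (w + 2 * Real.pi * Complex.I, l) = Y (w, l) * M

/-- Jordan matrices: direct sums of Jordan blocks with ones on the upper second diagonal. -/
structure IsJordan {n : ℕ} (J : Mat n) : Prop where
  support : ∀ i j : Fin n, j ≠ i → (j : ℕ) ≠ i + 1 → J i j = 0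
  superdiag : ∀ i j : Fin n, (j : ℕ) = i + 1 → J i j = 0 ∨ (J i j = 1 ∧ J i i = J j j)

/-- The matrices entering a Levelt form `G Ŷ(z) z^D z^L` at `z = 0`, with
`D = diag(d)`, `L = S + R`, `J = D + S`, `Ŷ(z) = I + ∑_{k ≥ 1} F_k z^k`. -/
structure LeveltData (n : ℕ) where
  G : Mat n
  F : ℕ → Mat n
  Yhat : ℂ → Mat n
  d : Fin n → ℤ
  S : Mat n
  R : Mat n

namespace LeveltData

variable {n : ℕ}

noncomputable def D (T : LeveltData n) : Mat n := Matrix.diagonal fun i => (T.d i : ℂ)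

noncomputable def J (T : LeveltData n) : Mat n := T.D + T.S

noncomputable def L (T : LeveltData n) : Mat n := T.S + T.R

end LeveltData

/-- The function `Y` of `w = log z` has, at `z = 0`, the Levelt form
`Y = G Ŷ(z) z^D z^L` associated with the residue matrix `A`, with the data `T`.
The eigenvalues of `A` are the `μ_i = J_ii = d_i + ρ_i`, with `ρ_i = S_ii`. -/
structure IsLeveltForm {n : ℕ} (A : Mat n) (T : LeveltData n) (Y : ℂ → Mat n) : Prop where
  jordan : IsJordan T.J
  invertible : IsUnit T.G
  similar : T.G⁻¹ * A * T.G = T.J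
  re_nonneg : ∀ i, 0 ≤ (T.S i i).re
  re_lt_one : ∀ i, (T.S i i).re < 1
  nilpotent : IsNilpotent T.R
  resonant : ∀ i j, T.R i j ≠ 0 → ∃ k : ℕ, 0 < k ∧ T.J i i - T.J j j = (k : ℂ)
  F_zero : T.F 0 = 1
  convergent : ∀ z : ℂ, HasSum (fun k : ℕ => z ^ k • T.F k) (T.Yhat z)
  form : ∀ w : ℂ, Y w = T.G * T.Yhat (Complex.exp w) *
    NormedSpace.exp (w • T.D) * NormedSpace.exp (w • T.L)

/-- For every `λ ∈ 𝔻`, `Y(·, λ)` is in Levelt form with the data `T λ`. No regularity of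
`λ ↦ T λ` is required. -/
def IsLeveltFamily {s : ℕ} {p : Fin s → ℕ} (𝔻 : Set (Fin s → ℂ))
    (A : (Fin s → ℂ) → Mat (∑ j, p j)) (T : (Fin s → ℂ) → LeveltData (∑ j, p j))
    (Y : ℂ × (Fin s → ℂ) → Mat (∑ j, p j)) : Prop :=
  ∀ l ∈ 𝔻, IsLeveltForm (A l) (T l) (fun w => Y (w, l))

/-- The matrix-valued 1-form `ω = (Λ + A/z) dz + ∑ ω_j dλ_j` at the point `q = (z, λ)`,
evaluated on the tangent vector `v`. -/
noncomputable def pfaffianForm {s : ℕ} {p : Fin s → ℕ} (A : (Fin s → ℂ) → Mat (∑ j, p j))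
    (ω : Fin s → ℂ × (Fin s → ℂ) → Mat (∑ j, p j)) (q v : ℂ × (Fin s → ℂ)) :
    Mat (∑ j, p j) :=
  v.1 • coeff A q.1 q.2 + ∑ j, v.2 j • ω j q

/-- `ω = (Λ + A/z) dz + ∑ ω_j dλ_j` is holomorphic on `(ℂ ∖ {0}) × 𝔻` and satisfies
`dω = ω ∧ ω` there, i.e. `dω(u,v) = ω(u) ω(v) - ω(v) ω(u)` for all tangent vectors `u`, `v`. -/
structure IsIntegrablePfaffian {s : ℕ} {p : Fin s → ℕ} (𝔻 : Set (Fin s → ℂ))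
    (A : (Fin s → ℂ) → Mat (∑ j, p j))
    (ω : Fin s → ℂ × (Fin s → ℂ) → Mat (∑ j, p j)) : Prop where
  holomorphic : ∀ j, HolomorphicMatOn (ω j) ({z : ℂ | z ≠ 0} ×ˢ 𝔻)
  integrable : ∀ q ∈ {z : ℂ | z ≠ 0} ×ˢ 𝔻, ∀ u v : ℂ × (Fin s → ℂ), ∀ a b,
    lineDeriv ℂ (fun q' => pfaffianForm A ω q' v a b) q u
      - lineDeriv ℂ (fun q' => pfaffianForm A ω q' u a b) q v
    = (pfaffianForm A ω q u * pfaffianForm A ω q v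
      - pfaffianForm A ω q v * pfaffianForm A ω q u) a b

/-- `dY = ω Y` on (covering) `× 𝔻`; the differential of `(w, λ) ↦ (exp w, λ)` at `(w, λ)` maps
`v` to `(exp w * v.1, v.2)`. -/
def SolvesPfaffian {s : ℕ} {p : Fin s → ℕ} (𝔻 : Set (Fin s → ℂ))
    (A : (Fin s → ℂ) → Mat (∑ j, p j))
    (ω : Fin s → ℂ × (Fin s → ℂ) → Mat (∑ j, p j))
    (Y : ℂ × (Fin s → ℂ) → Mat (∑ j, p j)) : Prop :=
  ∀ w, ∀ l ∈ 𝔻, ∀ v : ℂ × (Fin s → ℂ), ∀ a b,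
    HasLineDerivAt ℂ (fun q => Y q a b)
      ((pfaffianForm A ω (Complex.exp w, l) (Complex.exp w * v.1, v.2) * Y (w, l)) a b) (w, l) v

/-- All the coefficients `ω_j` are holomorphic on `ℂ × 𝔻`. -/
def HolomorphicAtZero {s n : ℕ} (𝔻 : Set (Fin s → ℂ))
    (ω : Fin s → ℂ × (Fin s → ℂ) → Mat n) : Prop :=
  ∀ j, HolomorphicMatOn (ω j) (Set.univ ×ˢ 𝔻)

/-- `G` is a (holomorphic, invertible) fundamental matrix solution on `𝔻` of
`dG = ∑ ω_j(0, λ) dλ_j G`. -/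
structure IsFundamentalSolutionAtZero {s n : ℕ} (𝔻 : Set (Fin s → ℂ))
    (ω : Fin s → ℂ × (Fin s → ℂ) → Mat n) (G : (Fin s → ℂ) → Mat n) : Prop where
  holomorphic : HolomorphicMatOn G 𝔻
  invertible : ∀ l ∈ 𝔻, IsUnit (G l)
  pde : ∀ l ∈ 𝔻, ∀ j a b,
    HasLineDerivAt ℂ (fun l' => G l' a b) ((ω j (0, l) * G l) a b) l (Pi.single j 1)

end Isomonodromy

open Isomonodromy

/-! From a Levelt solution to a Pfaffian system: the monodromy is exp(2πi L(λ)) and is constant. The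
eigenvalues of L have real part in [0,1), so the logarithm is unique and L is constant
(`IsExponentMatrix.eq_of_exp_eq`). Column i of Y z^{-L} is z^{d_i} times an entire vector whose
value at 0 is the nonzero column i of G. Its Laurent coefficients are contour integrals, hence
continuous in λ, so d_i cannot increase near a given point. Since tr A = ∑ d_i + tr L is continuous,
the integer ∑ d_i is locally constant. Hence every d_i is locally constant, and constant on the
connected polydisc (`levelt_d_const`). With d fixed, S and R occupy disjoint entries of L, so both
are constant.

Therefore P = G Ŷ = Y z^{-L} z^{-D}, where the last two factors no longer depend on λ. Cauchy's
formula on a circle around 0 makes P jointly holomorphic, and P is invertible even at z = 0. The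
forms ω_j = (∂_j P) P⁻¹ are then holomorphic on ℂ × 𝔻, are equal to (∂_j Y) Y⁻¹ for z ≠ 0, and are
integrable because second derivatives commute. Setting z = 0 gives dG = ω(0) G.

Conversely, let ω be holomorphic at z = 0, and let U(z, λ) be the parallel transport of ∑ ω_j dλ_j
along the ray from the centre c to λ, built as a series of iterated integrals. It is holomorphic and
invertible on ℂ × 𝔻. Integrability gives the λ-equations for U together with ∂_z U = (Λ + A/z) U - U
(Λ(c) + A(c)/z) (`TransportHyp.fderiv_transport`). If Z is a Levelt solution at λ = c, obtained from
the Jordan form and Frobenius' method (`exists_leveltForm`), then Y = U Z solves the Pfaffian system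
and has the monodromy of Z. At z = 0 one finds A(λ) U(0, λ) = U(0, λ) A(c). Thus Y is in Levelt form
with G = U(0, λ) G_c and with the exponents of Z. -/

namespace Isomonodromy

open Set Filter Metric MeasureTheory
open scoped Topology Interval Matrix.Norms.Operator

/-! ### Holomorphic maps of several variables: parameter integrals, derivatives, series. -/

section SeveralVariables

theorem exists_closedBall_two_mul_subset {E : Type*} [NormedAddCommGroup E] {U : Set E}
    (hU : IsOpen U) {x : E} (hx : x ∈ U) :
    ∃ R > 0, closedBall x (2 * R) ⊆ U := by
  obtain ⟨R, hR, h⟩ := nhds_basis_closedBall.mem_iff.1 (hU.mem_nhds hx)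
  exact ⟨R / 2, by positivity, by convert h using 2; ring⟩

theorem ball_subset_closedBall_two_mul {E : Type*} [NormedAddCommGroup E] {x y : E} {R : ℝ}
    (hy : y ∈ ball x R) :
    ball y R ⊆ closedBall x (2 * R) := by
  intro z hz
  rw [mem_ball] at hy hz
  rw [mem_closedBall]
  linarith [dist_triangle z y x]

variable {E F : Type*} [NormedAddCommGroup E] [NormedSpace ℂ E]
  [NormedAddCommGroup F] [NormedSpace ℂ F]

/-- Cauchy's estimate for the derivative of a bounded holomorphic map on a ball. -/
theorem norm_fderiv_le_of_norm_le {f : E → F} {x : E} {R M : ℝ} (hR : 0 < R)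
    (hf : DifferentiableOn ℂ f (ball x R)) (hM : ∀ y ∈ ball x R, ‖f y‖ ≤ M) :
    ‖fderiv ℂ f x‖ ≤ 2 * M / R := by
  refine Complex.norm_fderiv_le_div_of_mapsTo_ball hf (fun y hy => ?_) hR
  rw [mem_closedBall, dist_eq_norm]
  have h1 := hM y hy
  have h2 := hM x (mem_ball_self hR)
  calc ‖f y - f x‖ ≤ ‖f y‖ + ‖f x‖ := norm_sub_le _ _
    _ ≤ 2 * M := by linarith

/-- An interval integral of maps depending holomorphically on a parameter is holomorphic. -/
theorem differentiableOn_intervalIntegral [ProperSpace E] [CompleteSpace F]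
    {Φ : ℝ → E → F} {a b : ℝ} {U : Set E} (hU : IsOpen U)
    (hd : ∀ t ∈ [[a, b]], DifferentiableOn ℂ (Φ t) U)
    (hc : ContinuousOn (fun p : ℝ × E => Φ p.1 p.2) ([[a, b]] ×ˢ U)) :
    DifferentiableOn ℂ (fun q => ∫ t in a..b, Φ t q) U := by
  intro q₀ hq₀
  obtain ⟨R, hR, hRU⟩ := exists_closedBall_two_mul_subset hU hq₀
  have hK : IsCompact ([[a, b]] ×ˢ closedBall q₀ (2 * R)) :=
    isCompact_uIcc.prod (isCompact_closedBall _ _)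
  have hcK := hc.mono (prod_mono (Subset.refl [[a, b]]) hRU)
  obtain ⟨M, hM⟩ := hK.exists_bound_of_continuousOn hcK
  have hIu : Ι a b ⊆ [[a, b]] := uIoc_subset_uIcc
  have hslice : ∀ x ∈ U, ContinuousOn (fun t => Φ t x) [[a, b]] := fun x hx =>
    hc.comp (by fun_prop : Continuous fun t : ℝ => (t, x)).continuousOn
      (fun t ht => ⟨ht, hx⟩)
  have hball : ball q₀ R ⊆ U := fun y hy =>
    hRU (ball_subset_closedBall_two_mul (mem_ball_self hR) (by simpa using hy))
  have hdat : ∀ t ∈ [[a, b]], ∀ x ∈ U, DifferentiableAt ℂ (Φ t) x := fun t ht x hx =>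
    (hd t ht).differentiableAt (hU.mem_nhds hx)
  -- Needed for measurability of the derivative in t: Cauchy's estimate applied to `Φ t - Φ t₀`,
  -- which is uniformly small on a compact ball.
  have hcont : ContinuousOn (fun t => fderiv ℂ (Φ t) q₀) [[a, b]] := by
    have huc := hK.uniformContinuousOn_of_continuous hcK
    rw [Metric.uniformContinuousOn_iff] at huc
    rw [Metric.continuousOn_iff]
    intro t₀ ht₀ ε hε
    obtain ⟨δ, hδ, h⟩ := huc (ε * R / 4) (by positivity)
    refine ⟨δ, hδ, fun t ht htt => ?_⟩
    rw [dist_eq_norm, ← fderiv_sub (hdat t ht q₀ hq₀) (hdat t₀ ht₀ q₀ hq₀)]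
    have := norm_fderiv_le_of_norm_le (f := Φ t - Φ t₀) (M := ε * R / 4) hR
      (((hd t ht).sub (hd t₀ ht₀)).mono hball) (fun y hy => by
        have hyK : y ∈ closedBall q₀ (2 * R) :=
          ball_subset_closedBall_two_mul (mem_ball_self hR) hy
        have := h (t, y) ⟨ht, hyK⟩ (t₀, y) ⟨ht₀, hyK⟩ (by simpa [Prod.dist_eq, hδ] using htt)
        rw [dist_eq_norm] at this
        exact this.le)
    refine this.trans_lt ?_
    rw [div_lt_iff₀ hR]
    nlinarith [mul_pos hε hR]
  -- An interval integral is the difference of the integrals over `Ioc a b` and `Ioc b a`; each is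
  -- treated separately, so the order of `a` and `b` is irrelevant.
  have key : ∀ μ : Measure ℝ, ∀ s : Set ℝ, s ⊆ [[a, b]] → MeasurableSet s →
      μ = volume.restrict s → IsFiniteMeasure μ →
      DifferentiableAt ℂ (fun q => ∫ t, Φ t q ∂μ) q₀ := by
    intro μ s hs hsm hμ hfin
    have hmem : ∀ᵐ t ∂μ, t ∈ s := by rw [hμ]; exact ae_restrict_mem hsm
    have hmeas : ∀ x ∈ U, AEStronglyMeasurable (fun t => Φ t x) μ := fun x hx => by
      rw [hμ]; exact ((hslice x hx).mono hs).aestronglyMeasurable hsm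
    refine (hasFDerivAt_integral_of_dominated_of_fderiv_le (𝕜 := ℂ) (s := ball q₀ R)
      (F := fun q t => Φ t q) (F' := fun q t => fderiv ℂ (Φ t) q)
      (bound := fun _ => 2 * M / R) (ball_mem_nhds q₀ hR) ?_ ?_ ?_ ?_ ?_ ?_).differentiableAt
    · filter_upwards [hU.mem_nhds hq₀] with x hx using hmeas x hx
    · refine Integrable.of_bound (hmeas q₀ hq₀) M ?_
      filter_upwards [hmem] with t ht
      exact hM (t, q₀) ⟨hs ht, mem_closedBall_self (by positivity)⟩
    · rw [hμ]
      exact (hcont.mono hs).aestronglyMeasurable hsm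
    · filter_upwards [hmem] with t ht x hx
      have hsub := ball_subset_closedBall_two_mul hx
      exact norm_fderiv_le_of_norm_le hR ((hd t (hs ht)).mono (hsub.trans hRU))
        (fun y hy => hM (t, y) ⟨hs ht, hsub hy⟩)
    · exact integrable_const _
    · filter_upwards [hmem] with t ht x hx
      exact (hdat t (hs ht) x (hball hx)).hasFDerivAt
  have h1 := key _ (Ioc a b) (fun t ht => hIu (Ioc_subset_uIoc ht)) measurableSet_Ioc rfl
    inferInstance
  have h2 := key _ (Ioc b a) (fun t ht => hIu (Ioc_subset_uIoc' ht)) measurableSet_Ioc rfl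
    inferInstance
  exact (h1.sub h2).differentiableWithinAt

/-- Directional derivatives of holomorphic maps are holomorphic. -/
theorem differentiableOn_fderiv_apply [ProperSpace E] [CompleteSpace F] {f : E → F} {U : Set E}
    (hU : IsOpen U) (hf : DifferentiableOn ℂ f U) (v : E) :
    DifferentiableOn ℂ (fun q => fderiv ℂ f q v) U := by
  intro q₀ hq₀
  obtain ⟨R, hR, hRU⟩ := exists_closedBall_two_mul_subset hU hq₀
  -- With this radius q + z v stays within 2R of q₀ for all q in the R-ball and |z| ≤ ρ; the `+ 1`
  -- covers v = 0.
  set ρ : ℝ := R / (‖v‖ + 1) with hρ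
  have hv : 0 < ‖v‖ + 1 := by positivity
  have hρ0 : 0 < ρ := by positivity
  have hmem : ∀ q ∈ ball q₀ R, ∀ z ∈ closedBall (0 : ℂ) ρ, q + z • v ∈ U := by
    intro q hq z hz
    apply hRU
    rw [mem_closedBall, dist_eq_norm]
    rw [mem_ball, dist_eq_norm] at hq
    rw [mem_closedBall_zero_iff] at hz
    have : ‖z • v‖ ≤ R := by
      rw [norm_smul]
      calc ‖z‖ * ‖v‖ ≤ ρ * (‖v‖ + 1) := by gcongr; linarith
        _ = R := by rw [hρ]; field_simp
    calc ‖q + z • v - q₀‖ = ‖(q - q₀) + z • v‖ := by congr 1; abel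
      _ ≤ ‖q - q₀‖ + ‖z • v‖ := norm_add_le _ _
      _ ≤ 2 * R := by linarith
  -- Cauchy's formula for the derivative at 0 of z ↦ f(q + z v): the directional derivative becomes
  -- a parameter integral of f itself.
  have hformula : ∀ q ∈ ball q₀ R, fderiv ℂ f q v =
      (2 * Real.pi * Complex.I : ℂ)⁻¹ • ∫ t in (0:ℝ)..2 * Real.pi,
        (circleMap 0 ρ t * Complex.I) • (((circleMap 0 ρ t) ^ 2)⁻¹ • f (q + circleMap 0 ρ t • v))
          := by
    intro q hq
    have hline : DifferentiableOn ℂ (fun z : ℂ => f (q + z • v)) {z | q + z • v ∈ U} :=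
      hf.comp (by fun_prop) (fun z hz => hz)
    have hopen : IsOpen {z : ℂ | q + z • v ∈ U} := hU.preimage (by fun_prop)
    have := Complex.two_pi_I_inv_smul_circleIntegral_sub_sq_inv_smul_of_differentiable hopen
      (fun z hz => hmem q hq z hz) hline (mem_ball_self hρ0)
    simp only [circleIntegral, deriv_circleMap, sub_zero] at this
    rw [this]
    have hq' : q ∈ U := by simpa using hmem q hq 0 (mem_closedBall_self hρ0.le)
    have hd := ((hf.differentiableAt (hU.mem_nhds hq')).hasFDerivAt)
    have h2 := hd.hasLineDerivAt v
    exact h2.deriv.symm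
  have hintegr := differentiableOn_intervalIntegral (a := 0) (b := 2 * Real.pi)
    (Φ := fun t q => (circleMap 0 ρ t * Complex.I) •
      (((circleMap 0 ρ t) ^ 2)⁻¹ • f (q + circleMap 0 ρ t • v))) (isOpen_ball (x := q₀) (ε := R))
    (fun t _ => by
      refine DifferentiableOn.const_smul (DifferentiableOn.const_smul ?_ _) _
      exact hf.comp (by fun_prop) (fun q hq => hmem q hq _ (by simp [abs_of_pos hρ0])))
    (by
      refine ContinuousOn.smul (by fun_prop) (ContinuousOn.smul ?_ ?_)
      · refine ContinuousOn.inv₀ (by fun_prop) (fun p _ => ?_)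
        exact pow_ne_zero _ (circleMap_ne_center hρ0.ne')
      · exact hf.continuousOn.comp (by fun_prop)
          (fun p hp => hmem p.2 hp.2 _ (by simp [abs_of_pos hρ0])))
  have hb := ball_mem_nhds q₀ hR
  have := (hintegr.const_smul ((2 * Real.pi * Complex.I : ℂ)⁻¹)).differentiableAt hb
  refine (this.congr_of_eventuallyEq ?_).differentiableWithinAt
  filter_upwards [hb] with q hq
  exact hformula q hq

/-- The derivative of a holomorphic map is holomorphic. -/
theorem differentiableOn_fderiv [FiniteDimensional ℂ E] [CompleteSpace F] {f : E → F} {U : Set E}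
    (hU : IsOpen U) (hf : DifferentiableOn ℂ f U) :
    DifferentiableOn ℂ (fderiv ℂ f) U := by
  have : ProperSpace E := FiniteDimensional.proper ℂ E
  let b := Module.finBasis ℂ E
  have h : fderiv ℂ f = fun q => ∑ i, ContinuousLinearMap.smulRightL ℂ E F
      (LinearMap.toContinuousLinearMap (b.coord i)) (fderiv ℂ f q (b i)) := by
    funext q
    ext v
    conv_lhs => rw [← b.sum_repr v, map_sum]
    simp [sum_apply]
  rw [h]
  refine DifferentiableOn.fun_sum fun i _ => ?_
  exact (ContinuousLinearMap.differentiable _).comp_differentiableOn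
    (differentiableOn_fderiv_apply hU hf (b i))

/-- A locally normally convergent series of holomorphic maps is holomorphic. -/
theorem differentiableOn_tsum [CompleteSpace F] {f : ℕ → E → F} {U : Set E} (hU : IsOpen U)
    (hf : ∀ k, DifferentiableOn ℂ (f k) U)
    (hb : ∀ x ∈ U, ∃ V ∈ 𝓝 x, ∃ u : ℕ → ℝ, Summable u ∧ ∀ k, ∀ y ∈ V, ‖f k y‖ ≤ u k) :
    DifferentiableOn ℂ (fun q => ∑' k, f k q) U := by
  intro x hx
  obtain ⟨V, hV, u, hu, hfu⟩ := hb x hx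
  obtain ⟨R, hR, hRU⟩ := nhds_basis_closedBall.mem_iff.1 (inter_mem hV (hU.mem_nhds hx))
  -- Halving the radius leaves room for a ball of radius r about each point of `ball x r`, as
  -- Cauchy's estimate requires.
  obtain ⟨r, hr, rfl⟩ : ∃ r > 0, R = 2 * r := ⟨R / 2, by positivity, by ring⟩
  let : NormedSpace ℝ E := NormedSpace.restrictScalars ℝ ℂ E
  have hsub : ball x r ⊆ closedBall x (2 * r) :=
    ball_subset_closedBall_two_mul (mem_ball_self hr)
  refine (hasFDerivAt_tsum_of_isPreconnected (𝕜 := ℂ) (f' := fun k q => fderiv ℂ (f k) q)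
    (u := fun k => 2 * u k / r) (s := ball x r) (x₀ := x)
    ((hu.mul_left 2).div_const r) isOpen_ball (convex_ball x r).isPreconnected
    (fun k y hy => ((hf k).differentiableAt (hU.mem_nhds (hRU (hsub hy)).2)).hasFDerivAt)
    (fun k y hy => ?_) (mem_ball_self hr) ?_
    (mem_ball_self hr)).differentiableAt.differentiableWithinAt
  · have hs := ball_subset_closedBall_two_mul hy
    exact norm_fderiv_le_of_norm_le hr ((hf k).mono fun z hz => (hRU (hs hz)).2)
      (fun z hz => hfu k z (hRU (hs hz)).1)
  · exact Summable.of_norm_bounded hu fun k => hfu k x (mem_of_mem_nhds hV)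

end SeveralVariables

/-! ### Matrix-valued calculus and uniqueness for linear equations. -/

section Matrices

variable {E : Type*} [NormedAddCommGroup E] [NormedSpace ℂ E] {n : ℕ}

/-- The continuous linear functional taking a matrix to one of its entries. -/
noncomputable def entryCLM (n : ℕ) (a b : Fin n) : Mat n →L[ℂ] ℂ :=
  LinearMap.toContinuousLinearMap (Matrix.entryLinearMap ℂ ℂ a b)

@[simp]
theorem entryCLM_apply (a b : Fin n) (X : Mat n) : entryCLM n a b X = X a b := rfl

theorem matrix_eq_sum_entries (X : Mat n) :
    X = ∑ a, ∑ b, X a b • Matrix.single a b (1 : ℂ) := by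
  conv_lhs => rw [Matrix.matrix_eq_sum_single X]
  simp [Matrix.smul_single]

/-- Bridge from entrywise holomorphy to differentiability in the Banach algebra of matrices, where
product and chain rules apply. -/
theorem holomorphicMatOn_iff {f : E → Mat n} {U : Set E} :
    HolomorphicMatOn f U ↔ DifferentiableOn ℂ f U := by
  constructor
  · intro h
    have : f = fun q => ∑ a, ∑ b, f q a b • Matrix.single a b (1 : ℂ) := by
      funext q; exact matrix_eq_sum_entries (f q)
    rw [this]
    exact DifferentiableOn.fun_sum fun a _ => DifferentiableOn.fun_sum fun b _ =>
      (h a b).smul_const _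
  · intro h a b
    exact (entryCLM n a b).differentiable.comp_differentiableOn h

theorem hasDerivAt_matrix_iff {𝕜 : Type*} [NontriviallyNormedField 𝕜] [NormedAlgebra 𝕜 ℂ]
    {f : 𝕜 → Mat n} {f' : Mat n} {x : 𝕜} :
    HasDerivAt f f' x ↔ ∀ a b, HasDerivAt (fun t => f t a b) (f' a b) x := by
  constructor
  · intro h a b
    exact ((entryCLM n a b).restrictScalars 𝕜).hasFDerivAt.comp_hasDerivAt x h
  · intro h
    have : f = fun q => ∑ a, ∑ b, f q a b • Matrix.single a b (1 : ℂ) := by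
      funext q; exact matrix_eq_sum_entries (f q)
    rw [this, matrix_eq_sum_entries f']
    exact HasDerivAt.fun_sum fun a _ => HasDerivAt.fun_sum fun b _ => (h a b).smul_const _

theorem differentiableAt_matrix_inv {f : E → Mat n} {x : E} (hf : DifferentiableAt ℂ f x)
    (hx : IsUnit (f x)) : DifferentiableAt ℂ (fun q => (f q)⁻¹) x := by
  simp only [Matrix.nonsing_inv_eq_ringInverse]
  exact (differentiableAt_inverse (𝕜 := ℂ) hx).comp x hf

/-- Solutions of a linear equation `X' = B X + X C` vanishing at one end vanish. -/
theorem eq_zero_of_linear_ode {𝔸 : Type*} [NormedRing 𝔸] [NormedAlgebra ℝ 𝔸]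
    {f B C : ℝ → 𝔸} (hB : ContinuousOn B (Icc 0 1))
    (hC : ContinuousOn C (Icc 0 1))
    (hf : ∀ t ∈ Icc (0 : ℝ) 1, HasDerivAt f (B t * f t + f t * C t) t) (h0 : f 0 = 0) :
    ∀ t ∈ Icc (0 : ℝ) 1, f t = 0 := by
  obtain ⟨K, hK⟩ := isCompact_Icc.exists_bound_of_continuousOn hB
  obtain ⟨K', hK'⟩ := isCompact_Icc.exists_bound_of_continuousOn hC
  refine eq_zero_of_abs_deriv_le_mul_abs_self_of_eq_zero_right (K := K + K')
    (fun t ht => (hf t ht).continuousAt.continuousWithinAt)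
    (fun t ht => (hf t (Ico_subset_Icc_self ht)).hasDerivWithinAt) h0 (fun t ht => ?_)
  have ht' := Ico_subset_Icc_self ht
  calc ‖B t * f t + f t * C t‖ ≤ ‖B t‖ * ‖f t‖ + ‖f t‖ * ‖C t‖ :=
        (norm_add_le _ _).trans (add_le_add (norm_mul_le _ _) (norm_mul_le _ _))
    _ ≤ K * ‖f t‖ + ‖f t‖ * K' := by gcongr; exacts [hK t ht', hK' t ht']
    _ = (K + K') * ‖f t‖ := by ring

end Matrices

/-! ### Matrix exponentials and uniqueness of the logarithm. -/

section Exponential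

variable {n : ℕ}

/-- Let the height of an index be its number of r-predecessors. Each nonzero factor along a path
raises the height by at least one, and heights are at most n. -/
theorem pow_eq_zero_of_strict {K : Mat n} (r : Fin n → Fin n → Prop)
    (hirr : ∀ i, ¬ r i i) (htr : ∀ i j k, r i j → r j k → r i k)
    (h : ∀ i j, K i j ≠ 0 → r i j) : K ^ (n + 1) = 0 := by
  classical
  let ht : Fin n → ℕ := fun i => (Finset.univ.filter fun k => r k i).card
  have hlt : ∀ i j, r i j → ht i < ht j := by
    intro i j hij
    apply Finset.card_lt_card
    rw [Finset.ssubset_iff_of_subset]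
    · exact ⟨i, by simpa using hij, by simpa using hirr i⟩
    · intro k hk
      simp only [Finset.mem_filter, Finset.mem_univ, true_and] at hk ⊢
      exact htr k i j hk hij
  have hpow : ∀ m i j, (K ^ m) i j ≠ 0 → ht i + m ≤ ht j := by
    intro m
    induction m with
    | zero =>
      intro i j hij
      by_cases e : i = j
      · simp [e]
      · simp [Matrix.one_apply_ne e] at hij
    | succ m ih =>
      intro i j hij
      rw [pow_succ, Matrix.mul_apply] at hij
      obtain ⟨k, -, hk⟩ := Finset.exists_ne_zero_of_sum_ne_zero hij
      have h1 := ih i k (left_ne_zero_of_mul hk)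
      have h2 := hlt k j (h k j (right_ne_zero_of_mul hk))
      omega
  ext i j
  by_contra hne
  have h1 := hpow (n + 1) i j hne
  have h2 : ht j ≤ n := (Finset.card_le_univ _).trans (by simp)
  omega

theorem exp_smul_diagonal (w : ℂ) (v : Fin n → ℂ) :
    NormedSpace.exp (w • (Matrix.diagonal v : Mat n)) =
      Matrix.diagonal fun i => Complex.exp (w * v i) := by
  rw [← Matrix.diagonal_smul, Matrix.exp_diagonal]
  congr 1
  funext i
  rw [Pi.coe_exp, Complex.exp_eq_exp_ℂ]
  rfl

theorem exp_add_smul (w w' : ℂ) (L : Mat n) :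
    NormedSpace.exp ((w + w') • L) = NormedSpace.exp (w • L) * NormedSpace.exp (w' • L) := by
  rw [add_smul]
  exact Matrix.exp_add_of_commute _ _ ((Commute.refl L).smul_left w |>.smul_right w')

theorem exp_smul_mul_exp_neg_smul (w : ℂ) (L : Mat n) :
    NormedSpace.exp (w • L) * NormedSpace.exp ((-w) • L) = 1 := by
  rw [← exp_add_smul]; simp

theorem exp_neg_smul_mul_exp_smul (w : ℂ) (L : Mat n) :
    NormedSpace.exp ((-w) • L) * NormedSpace.exp (w • L) = 1 := by
  rw [← exp_add_smul]; simp

theorem hasDerivAt_exp_smul (L : Mat n) (w : ℂ) :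
    HasDerivAt (fun u : ℂ => NormedSpace.exp (u • L)) (L * NormedSpace.exp (w • L)) w :=
  hasDerivAt_exp_smul_const' (𝕂 := ℂ) L w

theorem exists_polynomial_exp_smul {K : Mat n} (hK : IsNilpotent K) (a b : Fin n) :
    ∃ p : Polynomial ℂ, ∀ w : ℂ, NormedSpace.exp (w • K) a b = p.eval w := by
  obtain ⟨m, hm⟩ := hK
  refine ⟨∑ k ∈ Finset.range m, Polynomial.monomial k (((k.factorial : ℂ)⁻¹) * (K ^ k) a b),
    fun w => ?_⟩
  have : NormedSpace.exp (w • K) =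
      ∑ k ∈ Finset.range m, ((k.factorial : ℂ)⁻¹) • (w • K) ^ k := by
    rw [NormedSpace.exp_eq_tsum ℂ]
    refine tsum_eq_sum fun k hk => ?_
    rw [Finset.mem_range, not_lt] at hk
    rw [smul_pow, pow_eq_zero_of_le hk hm]
    simp
  rw [this, Matrix.sum_apply, Polynomial.eval_finsetSum]
  refine Finset.sum_congr rfl fun k _ => ?_
  simp [smul_pow]
  ring

/-- Comparing leading coefficients gives exp(2πi a) = 1, so a is an integer, and it vanishes because
|Re a| < 1. A periodic polynomial is constant. -/
theorem eq_const_of_periodic_exp_mul_polynomial {a : ℂ} (ha : |a.re| < 1) (p : Polynomial ℂ)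
    (h : ∀ w : ℂ, Complex.exp ((w + 2 * Real.pi * Complex.I) * a) *
      p.eval (w + 2 * Real.pi * Complex.I) = Complex.exp (w * a) * p.eval w) (w : ℂ) :
    Complex.exp (w * a) * p.eval w = p.eval 0 := by
  set τ : ℂ := 2 * Real.pi * Complex.I with hτ
  have hτ0 : τ ≠ 0 := by
    rw [hτ]; exact Complex.two_pi_I_ne_zero
  by_cases hp : p = 0
  · simp [hp]
  have h1 : ∀ w, Complex.exp (τ * a) * p.eval (w + τ) = p.eval w := by
    intro w
    have := h w
    rw [add_mul, Complex.exp_add, mul_assoc] at this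
    exact mul_left_cancel₀ (Complex.exp_ne_zero _) this
  have h2 : Polynomial.C (Complex.exp (τ * a)) * Polynomial.taylor τ p = p := by
    apply Polynomial.funext
    intro w
    simpa [Polynomial.taylor_eval, add_comm] using h1 w
  have h3 : Complex.exp (τ * a) = 1 := by
    have := congrArg Polynomial.leadingCoeff h2
    rw [Polynomial.leadingCoeff_mul, Polynomial.leadingCoeff_C,
      Polynomial.leadingCoeff_taylor] at this
    exact mul_right_cancel₀ (Polynomial.leadingCoeff_ne_zero.2 hp) (by rw [this, one_mul])
  have ha0 : a = 0 := by
    obtain ⟨k, hk⟩ := Complex.exp_eq_one_iff.1 h3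
    rw [← hτ, mul_comm] at hk
    have hk' := mul_right_cancel₀ hτ0 hk
    rw [hk'] at ha ⊢
    rw [Complex.intCast_re] at ha
    have : |k| < 1 := by exact_mod_cast ha
    rw [Int.abs_lt_one_iff.1 this]; simp
  have hper : ∀ k : ℕ, p.eval ((k : ℂ) * τ) = p.eval 0 := by
    intro k
    induction k with
    | zero => simp
    | succ k ih =>
      have := h1 ((k : ℂ) * τ)
      rw [h3, one_mul] at this
      rw [← ih, ← this]
      push_cast
      ring_nf
  have hconst : p = Polynomial.C (p.eval 0) := by
    apply Polynomial.eq_of_infinite_eval_eq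
    refine Set.Infinite.mono (s := Set.range fun k : ℕ => (k : ℂ) * τ) ?_ ?_
    · rintro _ ⟨k, rfl⟩
      simpa using hper k
    · refine Set.infinite_range_of_injective fun k l hkl => ?_
      exact_mod_cast mul_right_cancel₀ hτ0 hkl
  rw [ha0, hconst]
  simp

/-- A matrix of the form `diag(ρ) + K` with `K` nilpotent and compatible with `ρ`. -/
structure IsExponentMatrix (ρ : Fin n → ℂ) (L : Mat n) : Prop where
  nilpotent : IsNilpotent (L - Matrix.diagonal ρ)
  compatible : ∀ i j, (L - Matrix.diagonal ρ) i j ≠ 0 → ρ i = ρ j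

theorem IsExponentMatrix.commute {ρ : Fin n → ℂ} {L : Mat n} (h : IsExponentMatrix ρ L) :
    Commute (Matrix.diagonal ρ) (L - Matrix.diagonal ρ) := by
  have hc := h.compatible
  generalize L - Matrix.diagonal ρ = K at hc
  ext i j
  rw [Matrix.diagonal_mul, Matrix.mul_diagonal]
  by_cases hij : K i j = 0
  · simp [hij]
  · rw [hc i j hij, mul_comm]

theorem IsExponentMatrix.exp_smul {ρ : Fin n → ℂ} {L : Mat n} (h : IsExponentMatrix ρ L) (w : ℂ) :
    NormedSpace.exp (w • L) = Matrix.diagonal (fun i => Complex.exp (w * ρ i)) *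
      NormedSpace.exp (w • (L - Matrix.diagonal ρ)) := by
  rw [← exp_smul_diagonal, ← Matrix.exp_add_of_commute _ _
    ((h.commute.smul_left w).smul_right w), ← smul_add, add_sub_cancel]

theorem IsExponentMatrix.exp_smul' {ρ : Fin n → ℂ} {L : Mat n} (h : IsExponentMatrix ρ L) (w : ℂ) :
    NormedSpace.exp (w • L) = NormedSpace.exp (w • (L - Matrix.diagonal ρ)) *
      Matrix.diagonal (fun i => Complex.exp (w * ρ i)) := by
  rw [← exp_smul_diagonal, ← Matrix.exp_add_of_commute _ _
    ((h.commute.symm.smul_left w).smul_right w), ← smul_add, sub_add_cancel]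

/-- Uniqueness of the logarithm with exponents in a strip of width one. -/
theorem IsExponentMatrix.eq_of_exp_eq {ρ ρ' : Fin n → ℂ} {L L' : Mat n}
    (h : IsExponentMatrix ρ L) (h' : IsExponentMatrix ρ' L')
    (hρ : ∀ i j, |(ρ i - ρ' j).re| < 1)
    (hexp : NormedSpace.exp ((2 * Real.pi * Complex.I : ℂ) • L) =
      NormedSpace.exp ((2 * Real.pi * Complex.I : ℂ) • L')) : L = L' := by
  set τ : ℂ := 2 * Real.pi * Complex.I with hτ
  -- The product e^{wL} e^{-wL'} is 2πi-periodic, and its entries are exponentials e^{w(ρ_a - ρ'_b)}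
  -- times polynomials. Hence it is constantly 1, and differentiating at w = 0 gives L = L'.
  let f : ℂ → Mat n := fun w => NormedSpace.exp (w • L) * NormedSpace.exp ((-w) • L')
  have hper : ∀ w, f (w + τ) = f w := by
    intro w
    simp only [f]
    rw [exp_add_smul, neg_add_rev, exp_add_smul, hexp, mul_assoc, ← mul_assoc _ _
      (NormedSpace.exp (-w • L')), exp_smul_mul_exp_neg_smul, one_mul]
  have hentry : ∀ a b, ∃ p : Polynomial ℂ, ∀ w,
      f w a b = Complex.exp (w * (ρ a - ρ' b)) * p.eval w := by
    intro a b
    choose p hp using exists_polynomial_exp_smul h.nilpotent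
    choose p' hp' using exists_polynomial_exp_smul h'.nilpotent
    refine ⟨∑ k, p a k * (p' k b).comp (-Polynomial.X), fun w => ?_⟩
    simp only [f]
    rw [h.exp_smul, h'.exp_smul', mul_assoc, ← mul_assoc _ _ (Matrix.diagonal _),
      Matrix.diagonal_mul, Matrix.mul_diagonal, Matrix.mul_apply, Polynomial.eval_finsetSum]
    simp only [Polynomial.eval_mul, Polynomial.eval_comp, Polynomial.eval_neg, Polynomial.eval_X,
      ← hp, ← hp']
    rw [show w * (ρ a - ρ' b) = w * ρ a + -w * ρ' b by ring, Complex.exp_add]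
    ring
  have hone : ∀ w, f w = 1 := by
    intro w
    ext a b
    obtain ⟨p, hp⟩ := hentry a b
    have h0 : f 0 = 1 := by simp [f]
    rw [hp, eq_const_of_periodic_exp_mul_polynomial (hρ a b) p (fun w => ?_)]
    · have := hp 0
      rw [h0] at this
      simpa using this.symm
    · rw [← hp, ← hp, hper]
  have heq : ∀ w : ℂ, NormedSpace.exp (w • L) = NormedSpace.exp (w • L') := by
    intro w
    have := congrArg (· * NormedSpace.exp (w • L')) (hone w)
    simpa only [f, mul_assoc, exp_neg_smul_mul_exp_smul, mul_one, one_mul] using this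
  have d1 := hasDerivAt_exp_smul L 0
  have d2 := hasDerivAt_exp_smul L' 0
  have := d1.unique (d2.congr_of_eventuallyEq (Eventually.of_forall heq))
  simpa using this

end Exponential

/-! ### Algebra of the Levelt exponents. -/

section Exponents

variable {n : ℕ}

/-- The algebraic conditions on the exponents `D = diag(d)`, `S`, `R` of a Levelt form. -/
structure IsLeveltExponents (d : Fin n → ℤ) (S R : Mat n) : Prop where
  jordan : IsJordan ((Matrix.diagonal fun i => (d i : ℂ)) + S)
  re_nonneg : ∀ i, 0 ≤ (S i i).re
  re_lt_one : ∀ i, (S i i).re < 1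
  resonant : ∀ i j, R i j ≠ 0 → ∃ k : ℕ, 0 < k ∧
    ((d i : ℂ) + S i i) - ((d j : ℂ) + S j j) = (k : ℂ)

namespace IsLeveltExponents

variable {d : Fin n → ℤ} {S R : Mat n}

/-- Real parts of the S_ii lie in [0,1), so two of them differ by less than one; an integer
difference of eigenvalues is therefore carried entirely by d. -/
theorem diag_eq (h : IsLeveltExponents d S R) {i j : Fin n} {k : ℤ}
    (hk : ((d i : ℂ) + S i i) - ((d j : ℂ) + S j j) = (k : ℂ)) :
    S i i = S j j ∧ d i - d j = k := by
  have hre := congrArg Complex.re hk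
  simp only [Complex.sub_re, Complex.add_re, Complex.intCast_re] at hre
  have e : d i - d j = k := by
    have h1 := h.re_nonneg i
    have h2 := h.re_nonneg j
    have h3 := h.re_lt_one i
    have h4 := h.re_lt_one j
    have a1 : ((d i - d j - k : ℤ) : ℝ) < 1 := by push_cast; linarith
    have a2 : (-1 : ℝ) < ((d i - d j - k : ℤ) : ℝ) := by push_cast; linarith
    have a1' : d i - d j - k < 1 := by exact_mod_cast a1
    have a2' : -1 < d i - d j - k := by exact_mod_cast a2
    omega
  refine ⟨?_, e⟩
  rw [← e] at hk
  push_cast at hk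
  linear_combination hk

theorem S_offdiag (h : IsLeveltExponents d S R) {i j : Fin n} (hij : i ≠ j) (hS : S i j ≠ 0) :
    i < j ∧ S i i = S j j ∧ d i = d j := by
  have hJ : ((Matrix.diagonal fun i => (d i : ℂ)) + S) i j = S i j := by
    simp [Matrix.diagonal_apply_ne _ hij]
  by_cases hj : (j : ℕ) = i + 1
  · rcases h.jordan.superdiag i j hj with h0 | ⟨-, h1⟩
    · exact absurd (hJ ▸ h0) hS
    · refine ⟨by rw [Fin.lt_def]; omega, ?_⟩
      have := h.diag_eq (i := i) (j := j) (k := 0) (by simpa [sub_eq_zero] using h1)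
      exact ⟨this.1, by omega⟩
  · exact absurd (hJ ▸ h.jordan.support i j (Ne.symm hij) hj) hS

theorem R_ne (h : IsLeveltExponents d S R) {i j : Fin n} (hR : R i j ≠ 0) :
    d j < d i ∧ S i i = S j j := by
  obtain ⟨k, hk, e⟩ := h.resonant i j hR
  have := h.diag_eq (k := k) (by simpa using e)
  exact ⟨by omega, this.1⟩

theorem R_diag (h : IsLeveltExponents d S R) (i : Fin n) : R i i = 0 := by
  by_contra hR
  exact absurd (h.R_ne hR).1 (lt_irrefl _)

/-- R strictly lowers d from row to column, while off-diagonal entries of S keep d and raise the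
index. Both respect one lexicographic strict order, which makes the sum of R and the off-diagonal
part of S nilpotent. -/
theorem nilpotent_of_le {K : Mat n}
    (hK : ∀ i j, K i j ≠ 0 → d j < d i ∨ (d i = d j ∧ i < j)) : IsNilpotent K := by
  refine ⟨n + 1, pow_eq_zero_of_strict (fun i j => d j < d i ∨ (d i = d j ∧ i < j)) ?_ ?_ hK⟩
  · intro i hi
    simp at hi
  · intro i j k hij hjk
    rcases hij with h1 | ⟨h1, h1'⟩ <;> rcases hjk with h2 | ⟨h2, h2'⟩
    · left; omega
    · left; omega
    · left; omega
    · right; exact ⟨h1.trans h2, h1'.trans h2'⟩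

theorem nilpotent_R (h : IsLeveltExponents d S R) : IsNilpotent R :=
  nilpotent_of_le (d := d) fun _ _ hR => Or.inl (h.R_ne hR).1

theorem exponent_entry (h : IsLeveltExponents d S R) {i j : Fin n}
    (hK : (S + R - Matrix.diagonal fun i => S i i) i j ≠ 0) :
    i ≠ j ∧ (S i j ≠ 0 ∨ R i j ≠ 0) := by
  by_cases hij : i = j
  · subst hij
    simp [h.R_diag] at hK
  · refine ⟨hij, ?_⟩
    simp only [Matrix.sub_apply, Matrix.add_apply, Matrix.diagonal_apply_ne _ hij, sub_zero] at hK
    by_contra hc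
    push Not at hc
    exact hK (by rw [hc.1, hc.2, add_zero])

theorem isExponentMatrix (h : IsLeveltExponents d S R) :
    IsExponentMatrix (fun i => S i i) (S + R) where
  nilpotent := nilpotent_of_le (d := d) fun i j hK => by
    obtain ⟨hij, hS | hR⟩ := h.exponent_entry hK
    · have := h.S_offdiag hij hS
      exact Or.inr ⟨this.2.2, this.1⟩
    · exact Or.inl (h.R_ne hR).1
  compatible := fun i j hK => by
    obtain ⟨hij, hS | hR⟩ := h.exponent_entry hK
    · exact (h.S_offdiag hij hS).2.1
    · exact (h.R_ne hR).2

/-- S is supported on the entries with d_i = d_j and R on those with d_j < d_i, so the sum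
determines both. -/
theorem S_eq_of_add_eq {S' R' : Mat n} (h : IsLeveltExponents d S R)
    (h' : IsLeveltExponents d S' R') (hL : S + R = S' + R') : S = S' := by
  have hdiag : ∀ i, S i i = S' i i := fun i => by
    have := congrFun (congrFun hL i) i
    simpa [h.R_diag, h'.R_diag] using this
  ext i j
  by_cases hij : i = j
  · rw [← hij, hdiag]
  by_cases hd : d i = d j
  · have e := congrFun (congrFun hL i) j
    have hR : R i j = 0 := by
      by_contra hR; have := (h.R_ne hR).1; omega
    have hR' : R' i j = 0 := by
      by_contra hR; have := (h'.R_ne hR).1; omega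
    simpa [hR, hR'] using e
  · have hS : S i j = 0 := by
      by_contra hS; exact hd (h.S_offdiag hij hS).2.2
    have hS' : S' i j = 0 := by
      by_contra hS; exact hd (h'.S_offdiag hij hS).2.2
    rw [hS, hS']

end IsLeveltExponents

theorem IsLeveltForm.exponents {A : Mat n} {T : LeveltData n} {Y : ℂ → Mat n}
    (h : IsLeveltForm A T Y) : IsLeveltExponents T.d T.S T.R where
  jordan := h.jordan
  re_nonneg := h.re_nonneg
  re_lt_one := h.re_lt_one
  resonant := fun i j hR => by
    simpa [LeveltData.J, LeveltData.D] using h.resonant i j hR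

end Exponents

/-! ### Topology of the polydisc. -/

section Polydisc

variable {s : ℕ} (c : Fin s → ℂ) (r : Fin s → ℝ)

theorem polydisc_eq_pi : polydisc c r = Set.pi univ fun j => ball (c j) (r j) := by
  ext l
  simp [polydisc, Set.mem_pi, dist_eq_norm]

theorem isOpen_polydisc : IsOpen (polydisc c r) := by
  rw [polydisc_eq_pi]
  exact isOpen_set_pi finite_univ fun _ _ => isOpen_ball

theorem isPreconnected_polydisc : IsPreconnected (polydisc c r) := by
  rw [polydisc_eq_pi]
  exact (convex_pi fun j _ => convex_ball (c j) (r j)).isPreconnected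

end Polydisc

/-! ### Everywhere convergent matrix power series. -/

section PowerSeries

variable {n : ℕ}

theorem exists_bound_powerSeries {F : ℕ → Mat n}
    (h : ∀ z : ℂ, Summable fun k : ℕ => z ^ k • F k) (x : ℂ) :
    ∃ V ∈ 𝓝 x, ∃ u : ℕ → ℝ, Summable u ∧ ∀ k, ∀ y ∈ V, ‖y ^ k • F k‖ ≤ u k := by
  refine ⟨ball x 1, ball_mem_nhds x one_pos, fun k => ‖((‖x‖ + 1 : ℝ) : ℂ) ^ k • F k‖,
    (h _).norm, fun k y hy => ?_⟩
  beta_reduce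
  rw [norm_smul, norm_smul, norm_pow, norm_pow, Complex.norm_real, Real.norm_of_nonneg
    (by positivity)]
  have : ‖y‖ ≤ ‖x‖ + 1 := by
    have := norm_le_norm_add_norm_sub x y
    rw [mem_ball, dist_eq_norm] at hy
    rw [norm_sub_rev] at hy
    linarith
  gcongr

theorem differentiable_of_hasSum {F : ℕ → Mat n} {f : ℂ → Mat n}
    (h : ∀ z : ℂ, HasSum (fun k : ℕ => z ^ k • F k) (f z)) : Differentiable ℂ f := by
  have hf : f = fun z => ∑' k, z ^ k • F k := by
    funext z; exact (h z).tsum_eq.symm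
  rw [hf, ← differentiableOn_univ]
  exact differentiableOn_tsum isOpen_univ (fun k => by fun_prop)
    (fun x _ => exists_bound_powerSeries (fun z => (h z).summable) x)

end PowerSeries

/-! ### Consequences of the Levelt form at a fixed λ. -/

section LeveltForm

variable {n : ℕ} {A : Mat n} {T : LeveltData n} {Y : ℂ → Mat n}

theorem IsLeveltForm.differentiable_Yhat (h : IsLeveltForm A T Y) : Differentiable ℂ T.Yhat :=
  differentiable_of_hasSum h.convergent

theorem IsLeveltForm.Yhat_zero (h : IsLeveltForm A T Y) : T.Yhat 0 = 1 := by
  rw [← (h.convergent 0).tsum_eq, tsum_eq_single 0]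
  · simp [h.F_zero]
  · intro k hk
    simp [zero_pow hk]

theorem exp_int_mul_periodic (w : ℂ) (d : ℤ) :
    Complex.exp ((w + 2 * Real.pi * Complex.I) * d) = Complex.exp (w * d) := by
  rw [add_mul, Complex.exp_add, mul_comm (2 * Real.pi * Complex.I),
    Complex.exp_int_mul_two_pi_mul_I,
    mul_one]

theorem LeveltData.exp_smul_D (T : LeveltData n) (w : ℂ) :
    NormedSpace.exp (w • T.D) = Matrix.diagonal fun i => Complex.exp (w * T.d i) :=
  exp_smul_diagonal w _

theorem exp_add_two_pi_I (w : ℂ) : Complex.exp (w + 2 * Real.pi * Complex.I) = Complex.exp w := by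
  rw [Complex.exp_add, Complex.exp_two_pi_mul_I, mul_one]

theorem IsLeveltForm.monodromy (h : IsLeveltForm A T Y) (w : ℂ) :
    Y (w + 2 * Real.pi * Complex.I) =
      Y w * NormedSpace.exp ((2 * Real.pi * Complex.I : ℂ) • T.L) := by
  rw [h.form, h.form, exp_add_smul _ _ T.L, T.exp_smul_D, T.exp_smul_D, exp_add_two_pi_I]
  simp only [exp_int_mul_periodic]
  rw [← mul_assoc]

theorem IsLeveltForm.mul_exp_neg (h : IsLeveltForm A T Y) (w : ℂ) :
    Y w * NormedSpace.exp ((-w) • T.L) * NormedSpace.exp ((-w) • T.D) =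
      T.G * T.Yhat (Complex.exp w) := by
  rw [h.form, mul_assoc _ (NormedSpace.exp (w • T.L)), exp_smul_mul_exp_neg_smul, mul_one,
    mul_assoc, exp_smul_mul_exp_neg_smul, mul_one]

theorem IsLeveltForm.column (h : IsLeveltForm A T Y) (w : ℂ) (a i : Fin n) :
    (Y w * NormedSpace.exp ((-w) • T.L)) a i =
      (T.G * T.Yhat (Complex.exp w)) a i * Complex.exp (w * T.d i) := by
  rw [h.form, mul_assoc _ (NormedSpace.exp (w • T.L)), exp_smul_mul_exp_neg_smul, mul_one,
    T.exp_smul_D, Matrix.mul_diagonal]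

theorem IsLeveltForm.L_eq_of_monodromy {A' : Mat n} {T' : LeveltData n} {Y' : ℂ → Mat n}
    {M : Mat n} (h : IsLeveltForm A T Y) (h' : IsLeveltForm A' T' Y')
    (hY : IsUnit (Y 0)) (hY' : IsUnit (Y' 0))
    (hM : Y (0 + 2 * Real.pi * Complex.I) = Y 0 * M)
    (hM' : Y' (0 + 2 * Real.pi * Complex.I) = Y' 0 * M) : T.L = T'.L := by
  have e := hY.mul_left_cancel ((h.monodromy 0).symm.trans hM)
  have e' := hY'.mul_left_cancel ((h'.monodromy 0).symm.trans hM')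
  refine h.exponents.isExponentMatrix.eq_of_exp_eq h'.exponents.isExponentMatrix (fun i j => ?_)
    (e.trans e'.symm)
  rw [Complex.sub_re, abs_lt]
  have h1 := h.re_nonneg i
  have h2 := h.re_lt_one i
  have h3 := h'.re_nonneg j
  have h4 := h'.re_lt_one j
  constructor <;> linarith

theorem IsLeveltForm.L_diag (h : IsLeveltForm A T Y) (i : Fin n) : T.L i i = T.S i i := by
  simp [LeveltData.L, h.exponents.R_diag]

/-- R has zero diagonal, so tr L = ∑ S_ii. This identity turns continuity of tr A into local
constancy of ∑ d_i. -/
theorem IsLeveltForm.trace_eq (h : IsLeveltForm A T Y) :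
    A.trace = ((∑ i, T.d i : ℤ) : ℂ) + T.L.trace := by
  have hG : IsUnit T.G.det := (Matrix.isUnit_iff_isUnit_det _).1 h.invertible
  have h1 : T.J.trace = A.trace := by
    rw [← h.similar, Matrix.trace_mul_comm, ← mul_assoc, Matrix.mul_nonsing_inv _ hG, one_mul]
  rw [← h1]
  simp only [Matrix.trace, Matrix.diag, h.L_diag]
  push_cast
  rw [← Finset.sum_add_distrib]
  simp [LeveltData.J, LeveltData.D]

/-- The Laurent coefficients of the columns of `Y z^{-L}` detect the exponents `d`. -/
theorem IsLeveltForm.laurent_coeff (h : IsLeveltForm A T Y) (a i : Fin n) (m : ℕ) :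
    ∫ θ in (0 : ℝ)..2 * Real.pi, Complex.exp (-(θ * Complex.I * ((T.d i : ℂ) - m))) *
      (Y (θ * Complex.I) * NormedSpace.exp ((-(θ * Complex.I : ℂ)) • T.L)) a i =
    2 * Real.pi * ((0 : ℂ) ^ m * T.G a i) := by
  have hd : Differentiable ℂ fun z : ℂ => z ^ m * (T.G * T.Yhat z) a i := by
    refine (differentiable_pow m).mul ?_
    exact (entryCLM n a i).differentiable.comp (h.differentiable_Yhat.const_mul T.G)
  -- Mean value property on the unit circle for z^m (GŶ)_{ai}; its value at 0 is G_{ai} for m = 0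
  -- and zero otherwise, whence the factor `0 ^ m`.
  have h1 := DiffContOnCl.circleAverage (R := 1) (c := 0) (hd.diffContOnCl (s := ball 0 |1|))
  rw [Real.circleAverage_def] at h1
  simp only [h.Yhat_zero, mul_one] at h1
  rw [← h1, Complex.real_smul]
  push_cast
  rw [mul_inv_cancel_left₀ (by simp)]
  refine intervalIntegral.integral_congr fun θ _ => ?_
  rw [h.column, circleMap_zero, Complex.ofReal_one, one_mul, ← Complex.exp_nat_mul]
  rw [show (T.G * T.Yhat (Complex.exp (θ * Complex.I))) a i *
    Complex.exp (θ * Complex.I * T.d i) = Complex.exp (θ * Complex.I * T.d i) *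
    (T.G * T.Yhat (Complex.exp (θ * Complex.I))) a i by ring, ← mul_assoc, ← Complex.exp_add]
  congr 2
  ring

end LeveltForm

/-! ### Constancy of the exponents in λ. -/

section Constancy

variable {s : ℕ} {p : Fin s → ℕ} {𝔻 : Set (Fin s → ℂ)} {A : (Fin s → ℂ) → Mat (∑ j, p j)}
  {Y : ℂ × (Fin s → ℂ) → Mat (∑ j, p j)} {T : (Fin s → ℂ) → LeveltData (∑ j, p j)}

theorem levelt_L_const (hY : IsIsomonodromicSolution 𝔻 A Y) (hT : IsLeveltFamily 𝔻 A T Y)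
    {l l' : Fin s → ℂ} (hl : l ∈ 𝔻) (hl' : l' ∈ 𝔻) : (T l).L = (T l').L := by
  obtain ⟨M, hM⟩ := hY.monodromy
  exact (hT l hl).L_eq_of_monodromy (hT l' hl') (hY.fundamental.invertible l hl 0)
    (hY.fundamental.invertible l' hl' 0) (hM l hl 0) (hM l' hl' 0)

/-- The coefficient of z^{d_i(λ₀)} in column i of Y z^{-L} depends continuously on λ, and some entry
of it is nonzero at λ₀. If d_i(λ) were larger, this coefficient would lie below the leading order
and vanish. -/
theorem levelt_d_le (hO : IsOpen 𝔻) (hY : IsIsomonodromicSolution 𝔻 A Y)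
    (hT : IsLeveltFamily 𝔻 A T Y) {l₀ : Fin s → ℂ} (hl₀ : l₀ ∈ 𝔻) (i : Fin (∑ j, p j)) :
    ∀ᶠ l in 𝓝 l₀, (T l).d i ≤ (T l₀).d i := by
  have hG : ∃ a, (T l₀).G a i ≠ 0 := by
    by_contra! hc
    have hdet := (Matrix.isUnit_iff_isUnit_det _).1 (hT l₀ hl₀).invertible
    rw [Matrix.det_eq_zero_of_column_eq_zero i hc] at hdet
    exact not_isUnit_zero hdet
  obtain ⟨a, ha⟩ := hG
  let f : ℝ → (Fin s → ℂ) → ℂ := fun θ l => Complex.exp (-(θ * Complex.I * ((T l₀).d i : ℂ))) *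
    (Y (θ * Complex.I, l) * NormedSpace.exp ((-(θ * Complex.I : ℂ)) • (T l₀).L)) a i
  have hYd := holomorphicMatOn_iff.1 hY.holomorphic
  have hintegr : DifferentiableOn ℂ (fun l => ∫ θ in (0 : ℝ)..2 * Real.pi, f θ l) 𝔻 := by
    refine differentiableOn_intervalIntegral hO (fun θ _ => ?_) ?_
    · refine (differentiableOn_const _).mul ?_
      refine (entryCLM _ a i).differentiable.comp_differentiableOn (DifferentiableOn.mul_const ?_ _)
      exact hYd.comp (by fun_prop) (fun l hl => ⟨mem_univ _, hl⟩)
    · refine ContinuousOn.mul (by fun_prop) ?_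
      refine (entryCLM _ a i).continuous.comp_continuousOn (ContinuousOn.mul ?_ ?_)
      · exact hYd.continuousOn.comp (by fun_prop) (fun q hq => ⟨mem_univ _, hq.2⟩)
      · have : Continuous fun u : ℂ => NormedSpace.exp (u • (T l₀).L) :=
          continuous_iff_continuousAt.2 fun u => (hasDerivAt_exp_smul _ u).continuousAt
        exact (this.comp (by fun_prop :
          Continuous fun q : ℝ × (Fin s → ℂ) => -(q.1 * Complex.I : ℂ))).continuousOn
  have h0 : ∫ θ in (0 : ℝ)..2 * Real.pi, f θ l₀ ≠ 0 := by
    have := (hT l₀ hl₀).laurent_coeff a i 0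
    simp only [Nat.cast_zero, sub_zero, pow_zero, one_mul] at this
    simp only [f]
    rw [this]
    exact mul_ne_zero (by simp) ha
  filter_upwards [(hintegr.continuousOn.continuousAt (hO.mem_nhds hl₀)).eventually_ne h0,
    hO.mem_nhds hl₀] with l hne hl
  by_contra! hlt
  apply hne
  -- The gap is written as m + 1 > 0 so that the factor `0 ^ (m + 1)` in `laurent_coeff` kills the
  -- integral.
  obtain ⟨m, hm⟩ : ∃ m : ℕ, (T l).d i = (T l₀).d i + (m + 1 : ℕ) :=
    ⟨((T l).d i - (T l₀).d i - 1).toNat, by omega⟩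
  have := (hT l hl).laurent_coeff a i (m + 1)
  rw [hm, levelt_L_const hY hT hl hl₀] at this
  simp only [f]
  rw [pow_succ, mul_zero, zero_mul, mul_zero] at this
  rw [← this]
  refine intervalIntegral.integral_congr fun θ _ => ?_
  simp

/-- Locally d_i(λ) ≤ d_i(λ₀) for all i, while ∑ d_i is continuous by the trace formula and integral.
Equal sums under termwise inequalities force termwise equality. -/
theorem levelt_d_const (hO : IsOpen 𝔻) (hC : IsPreconnected 𝔻) (hA : HolomorphicMatOn A 𝔻)
    (hY : IsIsomonodromicSolution 𝔻 A Y) (hT : IsLeveltFamily 𝔻 A T Y)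
    {l l' : Fin s → ℂ} (hl : l ∈ 𝔻) (hl' : l' ∈ 𝔻) : (T l).d = (T l').d := by
  have htr : ContinuousOn (fun l => (A l).trace) 𝔻 :=
    continuousOn_finsetSum _ fun i _ => (hA i i).continuousOn
  funext i
  refine hC.constant (f := fun l => (T l).d i) (fun l₀ hl₀ => ?_) hl hl'
  have hev : ∀ᶠ l in 𝓝 l₀, (T l).d i = (T l₀).d i := by
    have hclose := (htr.continuousAt (hO.mem_nhds hl₀)).eventually (ball_mem_nhds _ one_pos)
    filter_upwards [hclose, hO.mem_nhds hl₀,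
      eventually_all.2 fun k => levelt_d_le hO hY hT hl₀ k] with l h1 hl hle
    rw [dist_eq_norm, (hT l hl).trace_eq, (hT l₀ hl₀).trace_eq,
      levelt_L_const hY hT hl hl₀, add_sub_add_right_eq_sub, ← Int.cast_sub, Complex.norm_intCast]
      at h1
    have h2 : |∑ k, (T l).d k - ∑ k, (T l₀).d k| < 1 := by exact_mod_cast h1
    have h3 := sub_eq_zero.1 (Int.abs_lt_one_iff.1 h2)
    exact (Finset.sum_eq_sum_iff_of_le fun k _ => hle k).1 h3 i (Finset.mem_univ i)
  exact (continuousAt_const.congr (hev.mono fun _ h => h.symm)).continuousWithinAt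

theorem levelt_S_const (hO : IsOpen 𝔻) (hC : IsPreconnected 𝔻) (hA : HolomorphicMatOn A 𝔻)
    (hY : IsIsomonodromicSolution 𝔻 A Y) (hT : IsLeveltFamily 𝔻 A T Y)
    {l l' : Fin s → ℂ} (hl : l ∈ 𝔻) (hl' : l' ∈ 𝔻) : (T l).S = (T l').S := by
  have h := (hT l hl).exponents
  rw [levelt_d_const hO hC hA hY hT hl hl'] at h
  exact h.S_eq_of_add_eq (hT l' hl').exponents (levelt_L_const hY hT hl hl')

theorem levelt_const (hO : IsOpen 𝔻) (hC : IsPreconnected 𝔻) (hA : HolomorphicMatOn A 𝔻)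
    (hY : IsIsomonodromicSolution 𝔻 A Y) (hT : IsLeveltFamily 𝔻 A T Y)
    {l l' : Fin s → ℂ} (hl : l ∈ 𝔻) (hl' : l' ∈ 𝔻) :
    (T l).D = (T l').D ∧ (T l).L = (T l').L ∧ (T l).J = (T l').J ∧ (T l).R = (T l').R := by
  have hd := levelt_d_const hO hC hA hY hT hl hl'
  have hS := levelt_S_const hO hC hA hY hT hl hl'
  have hL := levelt_L_const hY hT hl hl'
  have hD : (T l).D = (T l').D := by simp only [LeveltData.D, hd]
  refine ⟨hD, hL, by simp only [LeveltData.J, hD, hS], ?_⟩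
  simp only [LeveltData.L, hS] at hL
  exact add_left_cancel hL

end Constancy

/-! ### Joint holomorphy from the covering. -/

section Descent

variable {s n : ℕ} {𝔻 : Set (Fin s → ℂ)}

/-- If `P(·, λ)` is entire and `P(e^w, λ) = Y(w, λ) Q(w)`, then `P` is jointly holomorphic. -/
theorem differentiableOn_of_covering (hO : IsOpen 𝔻) {Y P : ℂ × (Fin s → ℂ) → Mat n}
    {Q : ℂ → Mat n} (hY : DifferentiableOn ℂ Y (univ ×ˢ 𝔻)) (hQ : Continuous Q)
    (hP : ∀ l ∈ 𝔻, Differentiable ℂ fun z => P (z, l))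
    (h : ∀ l ∈ 𝔻, ∀ w, P (Complex.exp w, l) = Y (w, l) * Q w) :
    DifferentiableOn ℂ P (univ ×ˢ 𝔻) := by
  rintro ⟨z₀, l₀⟩ ⟨-, hl₀⟩
  change l₀ ∈ 𝔻 at hl₀
  set R : ℝ := ‖z₀‖ + 1 with hR
  have hR0 : 0 < R := by positivity
  -- Lift to the covering of the circle |z| = R. Cauchy's formula on it expresses P near z₀,
  -- including z₀ = 0, through Y alone.
  let W : ℝ → ℂ := fun θ => Real.log R + θ * Complex.I
  have hW : ∀ θ, Complex.exp (W θ) = circleMap 0 R θ := by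
    intro θ
    simp only [W]
    rw [Complex.exp_add, ← Complex.ofReal_exp, Real.exp_log hR0, circleMap_zero]
  have hWc : Continuous W := by fun_prop
  have hUo : IsOpen (ball (0 : ℂ) R ×ˢ 𝔻) := isOpen_ball.prod hO
  have hne : ∀ θ, ∀ z ∈ ball (0 : ℂ) R, circleMap 0 R θ - z ≠ 0 := by
    intro θ z hz h0
    rw [sub_eq_zero] at h0
    rw [← h0, mem_ball_zero_iff, norm_circleMap_zero, abs_of_pos hR0] at hz
    exact lt_irrefl _ hz
  have hintegr := differentiableOn_intervalIntegral (a := 0) (b := 2 * Real.pi) hUo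
    (Φ := fun θ q => (circleMap 0 R θ * Complex.I) •
      ((circleMap 0 R θ - q.1)⁻¹ • (Y (W θ, q.2) * Q (W θ))))
    (fun θ _ => by
      refine DifferentiableOn.fun_const_smul (DifferentiableOn.fun_smul ?_ ?_) _
      · exact DifferentiableOn.inv (by fun_prop) fun q hq => hne θ q.1 hq.1
      · refine DifferentiableOn.mul_const ?_ _
        exact hY.comp (by fun_prop) (fun q hq => ⟨mem_univ _, hq.2⟩))
    (by
      refine ContinuousOn.fun_smul (by fun_prop)
        (ContinuousOn.fun_smul ?_ (ContinuousOn.fun_mul ?_ ?_))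
      · exact ContinuousOn.inv₀ (by fun_prop) fun q hq => hne q.1 q.2.1 hq.2.1
      · exact hY.continuousOn.comp (by fun_prop) (fun q hq => ⟨mem_univ _, hq.2.2⟩)
      · exact (hQ.comp (hWc.comp continuous_fst)).continuousOn)
  have hmem : (z₀, l₀) ∈ ball (0 : ℂ) R ×ˢ 𝔻 := ⟨by simp [hR], hl₀⟩
  refine (((hintegr.const_smul ((2 * Real.pi * Complex.I : ℂ)⁻¹)).differentiableAt
    (hUo.mem_nhds hmem)).congr_of_eventuallyEq ?_).differentiableWithinAt
  filter_upwards [hUo.mem_nhds hmem] with q hq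
  have := Complex.two_pi_I_inv_smul_circleIntegral_sub_inv_smul_of_differentiable_on_off_countable
    countable_empty hq.1 (hP q.2 hq.2).continuous.continuousOn
    (fun x _ => (hP q.2 hq.2).differentiableAt)
  refine this.symm.trans ?_
  simp only [circleIntegral, deriv_circleMap, Pi.smul_apply]
  congr 1
  refine intervalIntegral.integral_congr fun θ _ => ?_
  simp only [← hW, h q.2 hq.2]

end Descent

/-! ### Integrability from an invertible solution. -/

section Integrability

/-- A linear differential form with an invertible solution is integrable. -/
theorem integrable_of_solution {E : Type*} [NormedAddCommGroup E] [NormedSpace ℂ E]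
    [FiniteDimensional ℂ E] {𝔸 : Type*} [NormedRing 𝔸]
    [NormedAlgebra ℂ 𝔸] [CompleteSpace 𝔸] {U : Set E} (hU : IsOpen U) {Z : E → 𝔸} {Ω : E → E → 𝔸}
    (hZ : DifferentiableOn ℂ Z U) (hΩ : ∀ v, DifferentiableOn ℂ (fun q => Ω q v) U)
    (hsol : ∀ q ∈ U, ∀ v, fderiv ℂ Z q v = Ω q v * Z q) (hinv : ∀ q ∈ U, IsUnit (Z q))
    {q : E} (hq : q ∈ U) (u v : E) :
    fderiv ℂ (fun q' => Ω q' v) q u - fderiv ℂ (fun q' => Ω q' u) q v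
      = Ω q u * Ω q v - Ω q v * Ω q u := by
  have hUq := hU.mem_nhds hq
  have h2 : DifferentiableAt ℂ (fderiv ℂ Z) q :=
    (differentiableOn_fderiv hU hZ).differentiableAt hUq
  have hsymm := second_derivative_symmetric_of_eventually (𝕜 := ℂ) (f := Z) (f' := fderiv ℂ Z)
    (x := q) (by
      filter_upwards [hUq] with y hy
      exact (hZ.differentiableAt (hU.mem_nhds hy)).hasFDerivAt) h2.hasFDerivAt u v
  -- Differentiating dZ = ΩZ once more; symmetry of the second derivative then yields the
  -- integrability relation multiplied by Z on the right, and Z is cancelled.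
  have hcalc : ∀ u v, fderiv ℂ (fderiv ℂ Z) q u v =
      fderiv ℂ (fun q' => Ω q' v) q u * Z q + Ω q v * (Ω q u * Z q) := by
    intro u v
    have e1 : fderiv ℂ (fun q' => fderiv ℂ Z q' v) q u = fderiv ℂ (fderiv ℂ Z) q u v := by
      rw [fderiv_clm_apply h2 (differentiableAt_const v)]
      simp
    have e2 : (fun q' => fderiv ℂ Z q' v) =ᶠ[𝓝 q] fun q' => Ω q' v * Z q' := by
      filter_upwards [hUq] with y hy using hsol y hy v
    rw [← e1, e2.fderiv_eq, fderiv_fun_mul' ((hΩ v).differentiableAt hUq)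
      (hZ.differentiableAt hUq)]
    simp [hsol q hq, add_comm]
  rw [hcalc, hcalc] at hsymm
  refine (hinv q hq).mul_right_cancel ?_
  rw [sub_mul, sub_mul, mul_assoc, mul_assoc]
  rw [← sub_eq_zero] at hsymm ⊢
  rw [← hsymm]
  abel

end Integrability

/-! ### Pfaffian systems in matrix form. -/

section Pfaffian

variable {s : ℕ} {p : Fin s → ℕ} {𝔻 : Set (Fin s → ℂ)} {A : (Fin s → ℂ) → Mat (∑ j, p j)}
  {Y : ℂ × (Fin s → ℂ) → Mat (∑ j, p j)} {ω : Fin s → ℂ × (Fin s → ℂ) → Mat (∑ j, p j)}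

theorem differentiable_Lam (p : Fin s → ℕ) : Differentiable ℂ (Lam p) := by
  rw [← differentiableOn_univ, ← holomorphicMatOn_iff]
  intro a b
  by_cases hab : a = b
  · subst hab
    simp only [Lam, Matrix.diagonal_apply_eq]
    fun_prop
  · simp only [Lam, Matrix.diagonal_apply_ne _ hab]
    fun_prop

theorem differentiableOn_coeff (hA : HolomorphicMatOn A 𝔻) :
    DifferentiableOn ℂ (fun q : ℂ × (Fin s → ℂ) => coeff A q.1 q.2) ({z : ℂ | z ≠ 0} ×ˢ 𝔻) := by
  refine DifferentiableOn.fun_add ?_ (DifferentiableOn.fun_smul ?_ ?_)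
  · exact ((differentiable_Lam p).comp differentiable_snd).differentiableOn
  · exact differentiableOn_fst.inv fun q hq => hq.1
  · exact (holomorphicMatOn_iff.1 hA).comp differentiableOn_snd fun q hq => hq.2

theorem differentiableOn_pfaffianForm (hA : HolomorphicMatOn A 𝔻)
    (hω : ∀ j, HolomorphicMatOn (ω j) ({z : ℂ | z ≠ 0} ×ˢ 𝔻)) (v : ℂ × (Fin s → ℂ)) :
    DifferentiableOn ℂ (fun q => pfaffianForm A ω q v) ({z : ℂ | z ≠ 0} ×ˢ 𝔻) := by
  refine DifferentiableOn.fun_add ((differentiableOn_coeff hA).fun_const_smul _) ?_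
  exact DifferentiableOn.fun_sum fun j _ => (holomorphicMatOn_iff.1 (hω j)).fun_const_smul _

theorem isOpen_ne_zero_prod (hO : IsOpen 𝔻) : IsOpen ({z : ℂ | z ≠ 0} ×ˢ 𝔻) :=
  isOpen_ne.prod hO

theorem lineDeriv_entry {n : ℕ} {X : ℂ × (Fin s → ℂ) → Mat n} {q : ℂ × (Fin s → ℂ)}
    (hX : DifferentiableAt ℂ X q) (a b : Fin n) (u : ℂ × (Fin s → ℂ)) :
    lineDeriv ℂ (fun q' => X q' a b) q u = fderiv ℂ X q u a b := by
  have := ((entryCLM n a b).hasFDerivAt.comp q hX.hasFDerivAt).hasLineDerivAt u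
  exact this.lineDeriv

/-- The matrix form of the integrability condition `dω = ω ∧ ω`. -/
theorem integrable_iff (hO : IsOpen 𝔻) (hA : HolomorphicMatOn A 𝔻)
    (hω : ∀ j, HolomorphicMatOn (ω j) ({z : ℂ | z ≠ 0} ×ˢ 𝔻)) :
    IsIntegrablePfaffian 𝔻 A ω ↔ ∀ q ∈ {z : ℂ | z ≠ 0} ×ˢ 𝔻, ∀ u v : ℂ × (Fin s → ℂ),
      fderiv ℂ (fun q' => pfaffianForm A ω q' v) q u
        - fderiv ℂ (fun q' => pfaffianForm A ω q' u) q v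
      = pfaffianForm A ω q u * pfaffianForm A ω q v
        - pfaffianForm A ω q v * pfaffianForm A ω q u := by
  have hd : ∀ v, ∀ q ∈ {z : ℂ | z ≠ 0} ×ˢ 𝔻,
      DifferentiableAt ℂ (fun q => pfaffianForm A ω q v) q := fun v q hq =>
    (differentiableOn_pfaffianForm hA hω v).differentiableAt
      ((isOpen_ne_zero_prod hO).mem_nhds hq)
  constructor
  · intro h q hq u v
    ext a b
    rw [← h.integrable q hq u v a b, lineDeriv_entry (hd v q hq), lineDeriv_entry (hd u q hq)]
    rfl
  · intro h
    refine ⟨hω, fun q hq u v a b => ?_⟩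
    rw [← h q hq u v, lineDeriv_entry (hd v q hq), lineDeriv_entry (hd u q hq)]
    rfl

theorem differentiableAt_solution (hO : IsOpen 𝔻) (hY : HolomorphicMatOn Y (univ ×ˢ 𝔻)) {w : ℂ}
    {l : Fin s → ℂ} (hl : l ∈ 𝔻) : DifferentiableAt ℂ Y (w, l) :=
  (holomorphicMatOn_iff.1 hY).differentiableAt ((isOpen_univ.prod hO).mem_nhds ⟨mem_univ _, hl⟩)

theorem solvesPfaffian_iff (hO : IsOpen 𝔻) (hY : HolomorphicMatOn Y (univ ×ˢ 𝔻)) :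
    SolvesPfaffian 𝔻 A ω Y ↔ ∀ w, ∀ l ∈ 𝔻, ∀ v : ℂ × (Fin s → ℂ), fderiv ℂ Y (w, l) v =
      pfaffianForm A ω (Complex.exp w, l) (Complex.exp w * v.1, v.2) * Y (w, l) := by
  constructor
  · intro h w l hl v
    ext a b
    rw [← lineDeriv_entry (differentiableAt_solution hO hY hl)]
    exact (h w l hl v a b).lineDeriv
  · intro h w l hl v a b
    rw [← h w l hl v]
    exact ((entryCLM _ a b).hasFDerivAt.comp (w, l)
      (differentiableAt_solution hO hY hl).hasFDerivAt).hasLineDerivAt v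

/-- Integrability is local in z, so Y is pulled back from the covering along a branch of the
logarithm. -/
theorem isIntegrablePfaffian_of_solution (hO : IsOpen 𝔻) (hA : HolomorphicMatOn A 𝔻)
    (hω : ∀ j, HolomorphicMatOn (ω j) ({z : ℂ | z ≠ 0} ×ˢ 𝔻))
    (hY : HolomorphicMatOn Y (univ ×ˢ 𝔻)) (hinv : ∀ l ∈ 𝔻, ∀ w, IsUnit (Y (w, l)))
    (hsol : SolvesPfaffian 𝔻 A ω Y) : IsIntegrablePfaffian 𝔻 A ω := by
  rw [integrable_iff hO hA hω]
  rintro ⟨z₀, l₀⟩ ⟨hz₀, hl₀⟩ u v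
  change z₀ ≠ 0 at hz₀
  change l₀ ∈ 𝔻 at hl₀
  -- The slit plane rotated so that z₀ lies on its central ray; β is a branch of log on it.
  let S : Set ℂ := {z | z / z₀ ∈ Complex.slitPlane}
  have hS : IsOpen S := Complex.isOpen_slitPlane.preimage (by fun_prop)
  have hS0 : ∀ z ∈ S, z ≠ 0 := fun z hz h0 => by
    simp only [S, mem_ofPred_eq, h0, zero_div] at hz
    exact Complex.slitPlane_ne_zero hz rfl
  let β : ℂ → ℂ := fun z => Complex.log z₀ + Complex.log (z / z₀)
  have hβ : ∀ z ∈ S, Complex.exp (β z) = z := by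
    intro z hz
    simp only [β]
    rw [Complex.exp_add, Complex.exp_log hz₀, Complex.exp_log (div_ne_zero (hS0 z hz) hz₀),
      mul_div_cancel₀ _ hz₀]
  have hβd : ∀ z ∈ S, HasDerivAt β z⁻¹ z := by
    intro z hz
    have h1 := ((hasDerivAt_id z).div_const z₀).clog hz
    refine (h1.const_add (Complex.log z₀)).congr_deriv ?_
    have := hS0 z hz
    simp only [id_eq]
    field_simp
  have hfd : ∀ q ∈ S ×ˢ 𝔻, HasFDerivAt (fun q : ℂ × (Fin s → ℂ) => Y (β q.1, q.2))
      ((fderiv ℂ Y (β q.1, q.2)).comp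
        ((((1 : ℂ →L[ℂ] ℂ).smulRight q.1⁻¹).comp (ContinuousLinearMap.fst ℂ ℂ (Fin s → ℂ))).prod
          (ContinuousLinearMap.snd ℂ ℂ (Fin s → ℂ)))) q := by
    intro q hq
    have h1 : HasFDerivAt (fun q : ℂ × (Fin s → ℂ) => (β q.1, q.2))
        ((((1 : ℂ →L[ℂ] ℂ).smulRight q.1⁻¹).comp (ContinuousLinearMap.fst ℂ ℂ (Fin s → ℂ))).prod
          (ContinuousLinearMap.snd ℂ ℂ (Fin s → ℂ))) q :=
      ((hβd q.1 hq.1).hasFDerivAt.comp q hasFDerivAt_fst).prodMk hasFDerivAt_snd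
    exact HasFDerivAt.comp (g := Y) (f := fun q : ℂ × (Fin s → ℂ) => (β q.1, q.2)) q
      (differentiableAt_solution hO hY hq.2).hasFDerivAt h1
  have hsub : S ×ˢ 𝔻 ⊆ {z : ℂ | z ≠ 0} ×ˢ 𝔻 := prod_mono hS0 Subset.rfl
  refine integrable_of_solution (hS.prod hO) (Z := fun q => Y (β q.1, q.2))
    (Ω := pfaffianForm A ω) (fun q hq => (hfd q hq).differentiableAt.differentiableWithinAt)
    (fun v => (differentiableOn_pfaffianForm hA hω v).mono hsub) ?_
    (fun q hq => hinv q.2 hq.2 _) ⟨?_, hl₀⟩ u v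
  · intro q hq v
    refine (congrArg (fun L => L v) (hfd q hq).fderiv).trans ?_
    have := (solvesPfaffian_iff hO hY).1 hsol (β q.1) q.2 hq.2 (v.1 * q.1⁻¹, v.2)
    have h0 := hS0 q.1 hq.1
    rw [hβ q.1 hq.1] at this
    simpa [mul_comm v.1, mul_inv_cancel_left₀ h0] using this
  · simp [S, div_self hz₀]

/-- A Pfaffian system is determined by an invertible solution. -/
theorem pfaffian_unique (hO : IsOpen 𝔻) (hY : HolomorphicMatOn Y (univ ×ˢ 𝔻))
    (hinv : ∀ l ∈ 𝔻, ∀ w, IsUnit (Y (w, l))) {ω' : Fin s → ℂ × (Fin s → ℂ) → Mat (∑ j, p j)}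
    (hsol : SolvesPfaffian 𝔻 A ω Y) (hsol' : SolvesPfaffian 𝔻 A ω' Y) (j : Fin s) {z : ℂ}
    (hz : z ≠ 0) {l : Fin s → ℂ} (hl : l ∈ 𝔻) : ω j (z, l) = ω' j (z, l) := by
  have h1 := (solvesPfaffian_iff hO hY).1 hsol (Complex.log z) l hl (0, Pi.single j 1)
  have h2 := (solvesPfaffian_iff hO hY).1 hsol' (Complex.log z) l hl (0, Pi.single j 1)
  rw [Complex.exp_log hz] at h1 h2
  have := (hinv l hl _).mul_right_cancel (h1.symm.trans h2)
  simpa [pfaffianForm, Pi.single_apply] using this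

/-- Pfaffian coefficients are determined only for z ≠ 0; continuity carries identities to z = 0. -/
theorem eq_at_zero_of_eq {n : ℕ} (hO : IsOpen 𝔻) {f g : ℂ × (Fin s → ℂ) → Mat n}
    (hf : DifferentiableOn ℂ f (univ ×ˢ 𝔻)) (hg : DifferentiableOn ℂ g (univ ×ˢ 𝔻))
    {l : Fin s → ℂ} (hl : l ∈ 𝔻) (h : ∀ z : ℂ, z ≠ 0 → f (z, l) = g (z, l)) :
    f (0, l) = g (0, l) := by
  have hc : ∀ {f : ℂ × (Fin s → ℂ) → Mat n}, DifferentiableOn ℂ f (univ ×ˢ 𝔻) →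
      Continuous fun z => f (z, l) := fun hf =>
    continuous_iff_continuousAt.2 fun z => ContinuousAt.comp (f := fun z : ℂ => (z, l)) (g := _)
      (hf.differentiableAt ((isOpen_univ.prod hO).mem_nhds ⟨mem_univ _, hl⟩)).continuousAt
      (by fun_prop)
  have := Continuous.ext_on (dense_compl_singleton (0 : ℂ)) (hc hf) (hc hg) (fun z hz => h z hz)
  exact congrFun this 0

end Pfaffian

/-! ### The Pfaffian system of a Levelt family. -/

section LeveltPfaffian

variable {s : ℕ} {p : Fin s → ℕ} {𝔻 : Set (Fin s → ℂ)} {A : (Fin s → ℂ) → Mat (∑ j, p j)}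
  {Y : ℂ × (Fin s → ℂ) → Mat (∑ j, p j)} {T : (Fin s → ℂ) → LeveltData (∑ j, p j)}

/-- The holomorphic factor `G(λ) Ŷ(z, λ)` of a Levelt family. -/
def leveltFactor {n : ℕ} (T : (Fin s → ℂ) → LeveltData n) (q : ℂ × (Fin s → ℂ)) : Mat n :=
  (T q.2).G * (T q.2).Yhat q.1

/-- By constancy of D and L the factor Q = z^{-L} z^{-D} can be taken at one base point, so it is
independent of λ and the descent lemma applies. -/
theorem differentiableOn_leveltFactor (hO : IsOpen 𝔻) (hC : IsPreconnected 𝔻)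
    (hA : HolomorphicMatOn A 𝔻) (hY : IsIsomonodromicSolution 𝔻 A Y)
    (hT : IsLeveltFamily 𝔻 A T Y) : DifferentiableOn ℂ (leveltFactor T) (univ ×ˢ 𝔻) := by
  rcases 𝔻.eq_empty_or_nonempty with rfl | ⟨l₀, hl₀⟩
  · rw [prod_empty]
    exact differentiableOn_empty
  have hcont : ∀ X : Mat (∑ j, p j), Continuous fun w : ℂ => NormedSpace.exp ((-w) • X) :=
    fun X => continuous_iff_continuousAt.2 fun u => ContinuousAt.comp (f := fun w : ℂ => -w)
      (g := fun w : ℂ => NormedSpace.exp (w • X)) (hasDerivAt_exp_smul X (-u)).continuousAt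
      (by fun_prop)
  refine differentiableOn_of_covering hO (holomorphicMatOn_iff.1 hY.holomorphic)
    (Q := fun w => NormedSpace.exp ((-w) • (T l₀).L) * NormedSpace.exp ((-w) • (T l₀).D))
    ((hcont _).mul (hcont _)) (fun l hl => (hT l hl).differentiable_Yhat.const_mul (T l).G) ?_
  intro l hl w
  obtain ⟨hD, hL, -, -⟩ := levelt_const hO hC hA hY hT hl₀ hl
  rw [hD, hL, ← mul_assoc]
  exact ((hT l hl).mul_exp_neg w).symm

theorem leveltFactor_zero (hT : IsLeveltFamily 𝔻 A T Y) {l : Fin s → ℂ} (hl : l ∈ 𝔻) :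
    leveltFactor T (0, l) = (T l).G := by
  simp [leveltFactor, (hT l hl).Yhat_zero]

theorem isUnit_leveltFactor (hY : IsIsomonodromicSolution 𝔻 A Y) (hT : IsLeveltFamily 𝔻 A T Y)
    {q : ℂ × (Fin s → ℂ)} (hq : q ∈ (univ : Set ℂ) ×ˢ 𝔻) : IsUnit (leveltFactor T q) := by
  obtain ⟨z, l⟩ := q
  have hl : l ∈ 𝔻 := hq.2
  by_cases hz : z = 0
  · rw [hz, leveltFactor_zero hT hl]
    exact (hT l hl).invertible
  · have := (hT l hl).mul_exp_neg (Complex.log z)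
    rw [Complex.exp_log hz] at this
    change IsUnit ((T l).G * (T l).Yhat z)
    rw [← this]
    exact ((hY.fundamental.invertible l hl _).mul (Matrix.isUnit_exp _)).mul (Matrix.isUnit_exp _)

/-- The coefficients `∂_j P P⁻¹` of the Pfaffian system attached to a Levelt family. -/
noncomputable def leveltPfaffian {n : ℕ} (T : (Fin s → ℂ) → LeveltData n) (j : Fin s)
    (q : ℂ × (Fin s → ℂ)) : Mat n :=
  fderiv ℂ (leveltFactor T) q (0, Pi.single j 1) * (leveltFactor T q)⁻¹

theorem holomorphicAtZero_leveltPfaffian (hO : IsOpen 𝔻) (hC : IsPreconnected 𝔻)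
    (hA : HolomorphicMatOn A 𝔻) (hY : IsIsomonodromicSolution 𝔻 A Y)
    (hT : IsLeveltFamily 𝔻 A T Y) : HolomorphicAtZero 𝔻 (leveltPfaffian T) := by
  intro j
  rw [holomorphicMatOn_iff]
  have hP := differentiableOn_leveltFactor hO hC hA hY hT
  have hU : IsOpen ((univ : Set ℂ) ×ˢ 𝔻) := isOpen_univ.prod hO
  refine (differentiableOn_fderiv_apply hU hP _).mul fun q hq => ?_
  exact (differentiableAt_matrix_inv (hP.differentiableAt (hU.mem_nhds hq))
    (isUnit_leveltFactor hY hT hq)).differentiableWithinAt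

theorem fderiv_leveltFactor (hY : IsIsomonodromicSolution 𝔻 A Y)
    (hT : IsLeveltFamily 𝔻 A T Y) {q : ℂ × (Fin s → ℂ)} (hq : q ∈ (univ : Set ℂ) ×ˢ 𝔻)
    (j : Fin s) : fderiv ℂ (leveltFactor T) q (0, Pi.single j 1) =
      leveltPfaffian T j q * leveltFactor T q := by
  rw [leveltPfaffian, mul_assoc, Matrix.nonsing_inv_mul _
    ((Matrix.isUnit_iff_isUnit_det _).1 (isUnit_leveltFactor hY hT hq)), mul_one]

theorem sum_smul_single_eq (v : ℂ × (Fin s → ℂ)) :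
    v = v.1 • ((1, 0) : ℂ × (Fin s → ℂ)) + ∑ j, v.2 j • ((0, Pi.single j 1) : ℂ × (Fin s → ℂ)) := by
  refine Prod.ext ?_ ?_
  · simp [Prod.fst_sum]
  · funext k
    simp [Prod.snd_sum, Finset.sum_apply, Pi.single_apply]

/-- In Y = P z^D z^L only P depends on λ, so ∂_j Y = (∂_j P) P⁻¹ Y; the z-direction is the given
equation. -/
theorem solvesPfaffian_leveltPfaffian (hO : IsOpen 𝔻) (hC : IsPreconnected 𝔻)
    (hA : HolomorphicMatOn A 𝔻) (hY : IsIsomonodromicSolution 𝔻 A Y)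
    (hT : IsLeveltFamily 𝔻 A T Y) : SolvesPfaffian 𝔻 A (leveltPfaffian T) Y := by
  rw [solvesPfaffian_iff hO hY.holomorphic]
  intro w l hl v
  have hP := differentiableOn_leveltFactor hO hC hA hY hT
  have hd := differentiableAt_solution hO hY.holomorphic (w := w) hl
  have hz : fderiv ℂ Y (w, l) (1, 0) =
      Complex.exp w • (coeff A (Complex.exp w) l * Y (w, l)) := by
    have h1 := (hd.hasFDerivAt.comp_hasDerivAt w
      ((hasDerivAt_id w).prodMk (hasDerivAt_const w l)))
    refine h1.unique (hasDerivAt_matrix_iff.2 fun a b => ?_)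
    exact hY.fundamental.ode l hl w a b
  have hj : ∀ j, fderiv ℂ Y (w, l) (0, Pi.single j 1) =
      leveltPfaffian T j (Complex.exp w, l) * Y (w, l) := by
    intro j
    have hq : (Complex.exp w, l) ∈ (univ : Set ℂ) ×ˢ 𝔻 := ⟨mem_univ _, hl⟩
    have hline := hd.hasFDerivAt.hasLineDerivAt (0, Pi.single j 1)
    have hPd := (hP.differentiableAt ((isOpen_univ.prod hO).mem_nhds hq)).hasFDerivAt.hasLineDerivAt
      (0, Pi.single j 1)
    let E : Mat (∑ j, p j) := NormedSpace.exp (w • (T l).D) * NormedSpace.exp (w • (T l).L)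
    have hform : ∀ l' ∈ 𝔻, Y (w, l') = leveltFactor T (Complex.exp w, l') * E := by
      intro l' hl'
      obtain ⟨hD, hL, -, -⟩ := levelt_const hO hC hA hY hT hl hl'
      rw [(hT l' hl').form w, ← hD, ← hL, mul_assoc]
      rfl
    have h2 := HasDerivAt.congr_deriv (HasDerivAt.mul_const hPd E)
      (g' := leveltPfaffian T j (Complex.exp w, l) * Y (w, l))
      ((congrArg (· * E) (fderiv_leveltFactor hY hT hq j)).trans (by
        rw [hform l hl]; exact mul_assoc _ _ _))
    refine HasDerivAt.unique hline (h2.congr_of_eventuallyEq ?_)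
    have hcont : ContinuousAt (fun t : ℂ => l + t • (Pi.single j 1 : Fin s → ℂ)) 0 := by fun_prop
    filter_upwards [hcont.preimage_mem_nhds (hO.mem_nhds (by simpa using hl))] with t ht
    simpa using hform _ ht
  conv_lhs => rw [sum_smul_single_eq v, map_add, map_sum]
  simp only [map_smul, hz, hj, pfaffianForm, add_mul, Finset.sum_mul, smul_mul_assoc, smul_smul]
  rw [mul_comm v.1]

/-- G is P at z = 0. A form solved by Y agrees with (∂_j P) P⁻¹ off z = 0, hence also at z = 0. -/
theorem isFundamentalSolutionAtZero_G (hO : IsOpen 𝔻) (hC : IsPreconnected 𝔻)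
    (hA : HolomorphicMatOn A 𝔻) (hY : IsIsomonodromicSolution 𝔻 A Y)
    (hT : IsLeveltFamily 𝔻 A T Y) {ω : Fin s → ℂ × (Fin s → ℂ) → Mat (∑ j, p j)}
    (hω : HolomorphicAtZero 𝔻 ω) (hsol : SolvesPfaffian 𝔻 A ω Y) :
    IsFundamentalSolutionAtZero 𝔻 ω (fun l => (T l).G) := by
  have hP := differentiableOn_leveltFactor hO hC hA hY hT
  have hU : IsOpen ((univ : Set ℂ) ×ˢ 𝔻) := isOpen_univ.prod hO
  refine ⟨?_, fun l hl => (hT l hl).invertible, ?_⟩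
  · rw [holomorphicMatOn_iff]
    have : DifferentiableOn ℂ (fun l => leveltFactor T (0, l)) 𝔻 :=
      hP.comp (by fun_prop) fun l hl => ⟨mem_univ _, hl⟩
    exact this.congr fun l hl => (leveltFactor_zero hT hl).symm
  · intro l hl j a b
    have hq : ((0 : ℂ), l) ∈ (univ : Set ℂ) ×ˢ 𝔻 := ⟨mem_univ _, hl⟩
    have hω0 : ω j (0, l) = leveltPfaffian T j (0, l) :=
      eq_at_zero_of_eq hO (holomorphicMatOn_iff.1 (hω j)) (holomorphicMatOn_iff.1
        (holomorphicAtZero_leveltPfaffian hO hC hA hY hT j)) hl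
        (fun z hz => pfaffian_unique hO hY.holomorphic hY.fundamental.invertible hsol
          (solvesPfaffian_leveltPfaffian hO hC hA hY hT) j hz hl)
    have hPd := ((entryCLM _ a b).hasFDerivAt.comp ((0 : ℂ), l) (hP.differentiableAt
      (hU.mem_nhds hq)).hasFDerivAt).hasLineDerivAt (0, Pi.single j 1)
    have hval : fderiv ℂ (leveltFactor T) (0, l) (0, Pi.single j 1) = ω j (0, l) * (T l).G :=
      (fderiv_leveltFactor hY hT hq j).trans (by rw [leveltFactor_zero hT hl, hω0])
    refine HasDerivAt.congr_of_eventuallyEq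
      (HasDerivAt.congr_deriv hPd (congrArg (fun X : Mat (∑ j, p j) => X a b) hval)) ?_
    have hcont : ContinuousAt (fun t : ℂ => l + t • (Pi.single j 1 : Fin s → ℂ)) 0 := by fun_prop
    filter_upwards [hcont.preimage_mem_nhds (hO.mem_nhds (by simpa using hl))] with t ht
    simp [leveltFactor_zero hT ht]

end LeveltPfaffian

/-! ### Existence of the Jordan form. -/

section JordanForm

open Polynomial DirectSum

theorem exists_X_sub_C_associated {p : ℂ[X]} (hp : Irreducible p) :
    ∃ μ : ℂ, Associated p (X - C μ) := by
  obtain ⟨μ, hμ⟩ := IsAlgClosed.exists_root p (IsAlgClosed.degree_eq_one_of_irreducible ℂ hp ▸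
    one_ne_zero)
  exact ⟨μ, ((irreducible_X_sub_C μ).associated_of_dvd hp (dvd_iff_isRoot.2 hμ)).symm⟩

/-- After the shift X ↦ X + μ, a relation says that X^e divides a polynomial of degree below e, so
its coefficients vanish. Exponents decrease in k so that X - μ sends the k-th vector to the
(k-1)-st, matching ones above the diagonal. -/
theorem linearIndependent_quotient_pow (μ : ℂ) (e : ℕ) :
    LinearIndependent ℂ fun k : Fin e =>
      (Submodule.Quotient.mk ((X - C μ) ^ (e - 1 - (k : ℕ))) :
        ℂ[X] ⧸ (ℂ[X] ∙ (X - C μ) ^ e)) := by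
  rw [Fintype.linearIndependent_iff]
  intro g hg i
  have h1 : (Submodule.Quotient.mk (∑ k : Fin e, g k • (X - C μ) ^ (e - 1 - (k : ℕ))) :
      ℂ[X] ⧸ (ℂ[X] ∙ (X - C μ) ^ e)) = 0 := by
    rw [← hg]
    exact map_sum ((Submodule.mkQ (ℂ[X] ∙ (X - C μ) ^ e)).restrictScalars ℂ) _ _
  rw [Submodule.Quotient.mk_eq_zero, Submodule.mem_span_singleton] at h1
  obtain ⟨q, hq⟩ := h1
  have hq' := congrArg (fun P : ℂ[X] => P.comp (X + C μ)) hq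
  simp only [smul_eq_mul, mul_comp, pow_comp, sub_comp, X_comp, C_comp, Polynomial.sum_comp,
    smul_comp,
    add_sub_cancel_right] at hq'
  have hi := congrArg (fun P : ℂ[X] => P.coeff (e - 1 - (i : ℕ))) hq'
  simp only [coeff_mul_X_pow', finsetSum_coeff, coeff_smul, coeff_X_pow] at hi
  rw [if_neg (by have := i.2; omega), Finset.sum_eq_single i] at hi
  · simpa using hi.symm
  · intro k _ hk
    have h1 := i.2
    have h2 := k.2
    have h3 : (k : ℕ) ≠ i := fun h => hk (Fin.ext h)
    rw [if_neg (by omega), smul_zero]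
  · simp

theorem exists_jordan_basis_cyclic {p : ℂ[X]} (hp : Irreducible p) (e : ℕ) :
    ∃ (μ : ℂ) (b : Module.Basis (Fin e) ℂ (ℂ[X] ⧸ (ℂ[X] ∙ p ^ e))), ∀ k : Fin e,
      (X : ℂ[X]) • b k = μ • b k +
        if (k : ℕ) = 0 then 0 else b ⟨(k : ℕ) - 1, (Nat.sub_le _ _).trans_lt k.2⟩ := by
  obtain ⟨μ, hμ⟩ := exists_X_sub_C_associated hp
  have hspan : (ℂ[X] ∙ p ^ e) = (ℂ[X] ∙ (X - C μ) ^ e) :=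
    Ideal.span_singleton_eq_span_singleton.2 (hμ.pow_pow)
  rw [hspan]
  refine ⟨μ, ?_⟩
  have hfin : Module.finrank ℂ (ℂ[X] ⧸ (ℂ[X] ∙ (X - C μ) ^ e)) = e := by
    have := finrank_quotient_span_eq_natDegree (f := (X - C μ) ^ e)
    rw [natDegree_pow, natDegree_X_sub_C, mul_one] at this
    exact this
  -- The structure theorem may produce exponent 0; the quotient is then zero and the block empty.
  rcases Nat.eq_zero_or_pos e with rfl | he
  · have hs : Subsingleton (ℂ[X] ⧸ (ℂ[X] ∙ (X - C μ) ^ 0)) := by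
      rw [Submodule.Quotient.subsingleton_iff]
      exact (Ideal.eq_top_iff_one _).2 (by
        have := Submodule.mem_span_singleton_self (R := ℂ[X]) ((X - C μ) ^ 0)
        rwa [pow_zero] at this ⊢)
    exact ⟨Module.Basis.empty _, fun k => k.elim0⟩
  have : Nonempty (Fin e) := ⟨⟨0, he⟩⟩
  refine ⟨basisOfLinearIndependentOfCardEqFinrank (linearIndependent_quotient_pow μ e)
    (by rw [hfin, Fintype.card_fin]), fun k => ?_⟩
  simp only [coe_basisOfLinearIndependentOfCardEqFinrank]
  have hX : ∀ v : ℂ[X] ⧸ (ℂ[X] ∙ (X - C μ) ^ e), (X : ℂ[X]) • v = μ • v + (X - C μ) • v := by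
    intro v
    rw [sub_smul]
    have : (C μ : ℂ[X]) • v = μ • v := by
      rw [← algebraMap_smul ℂ[X] μ v]; rfl
    rw [this]; abel
  rw [hX]
  congr 1
  rw [← Submodule.Quotient.mk_smul, smul_eq_mul, ← pow_succ']
  split_ifs with h0
  · rw [Submodule.Quotient.mk_eq_zero, h0]
    rw [show e - 1 - 0 + 1 = e by omega]
    exact Submodule.mem_span_singleton_self _
  · congr 2
    have := k.2
    omega

/-- Structure theorem for torsion modules over ℂ[X], with X acting on V as f: each cyclic summand
contributes one Jordan block. -/
theorem exists_jordan_basis_sigma {V : Type} [AddCommGroup V] [Module ℂ V]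
    [FiniteDimensional ℂ V] (f : V →ₗ[ℂ] V) :
    ∃ (m : ℕ) (e : Fin m → ℕ) (μ : Fin m → ℂ) (b : Module.Basis (Σ i, Fin (e i)) ℂ V),
      ∀ i, ∀ k : Fin (e i), f (b ⟨i, k⟩) = μ i • b ⟨i, k⟩ +
        if (k : ℕ) = 0 then 0 else b ⟨i, ⟨(k : ℕ) - 1, (Nat.sub_le _ _).trans_lt k.2⟩⟩ := by
  classical
  obtain ⟨ι, _, p, hp, e, ⟨Ψ⟩⟩ := Module.equiv_directSum_of_isTorsion
    (Module.AEval.isTorsion_of_finiteDimensional ℂ V f)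
  choose μ b hb using fun i => exists_jordan_basis_cyclic (hp i) (e i)
  let σ := Fintype.equivFin ι
  let B₀ : Module.Basis (Σ i, Fin (e i)) ℂ (⨁ i : ι, ℂ[X] ⧸ (ℂ[X] ∙ p i ^ e i)) :=
    DFinsupp.basis b
  let B₁ : Module.Basis (Σ i, Fin (e i)) ℂ V :=
    B₀.map ((Ψ.symm.restrictScalars ℂ).trans (Module.AEval'.of f).symm)
  have hB₁ : ∀ i, ∀ k : Fin (e i), f (B₁ ⟨i, k⟩) = μ i • B₁ ⟨i, k⟩ +
      if (k : ℕ) = 0 then 0 else B₁ ⟨i, ⟨(k : ℕ) - 1, (Nat.sub_le _ _).trans_lt k.2⟩⟩ := by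
    intro i k
    have hB₀ : ∀ k : Fin (e i), B₀ ⟨i, k⟩ =
        DirectSum.lof ℂ[X] ι (fun i => ℂ[X] ⧸ (ℂ[X] ∙ p i ^ e i)) i (b i k) := by
      intro k
      apply B₀.repr.injective
      rw [Module.Basis.repr_self]
      ext ⟨i', k'⟩
      change Finsupp.single _ _ _ = (b i').repr
        (DirectSum.lof ℂ[X] ι (fun i => ℂ[X] ⧸ (ℂ[X] ∙ p i ^ e i)) i (b i k) i') k'
      by_cases hi : i = i'
      · subst hi
        rw [DirectSum.lof_apply, Module.Basis.repr_self]
        simp [Finsupp.single_apply]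
      · rw [DirectSum.lof_eq_of, DirectSum.of_eq_of_ne _ _ _ (Ne.symm hi), map_zero,
          Finsupp.single_apply, if_neg (by rintro ⟨⟩; exact hi rfl)]
        rfl
    have h1 : (X : ℂ[X]) • B₀ ⟨i, k⟩ = μ i • B₀ ⟨i, k⟩ +
        if (k : ℕ) = 0 then 0 else B₀ ⟨i, ⟨(k : ℕ) - 1, (Nat.sub_le _ _).trans_lt k.2⟩⟩ := by
      rw [hB₀, ← map_smul, hb, map_add, hB₀]
      congr 1
      · rw [← algebraMap_smul ℂ[X] (μ i) (b i k), map_smul, algebraMap_smul]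
      · split_ifs <;> simp
    have h2 := congrArg (fun v => (Module.AEval'.of f).symm (Ψ.symm v)) h1
    have h3 : ∀ v, (Module.AEval'.of f).symm (Ψ.symm ((X : ℂ[X]) • v)) =
        f ((Module.AEval'.of f).symm (Ψ.symm v)) := by
      intro v
      rw [map_smul, Module.AEval'.of_symm_X_smul]
    have h4 : ∀ x, B₁ x = (Module.AEval'.of f).symm (Ψ.symm (B₀ x)) := fun x => rfl
    simp only [h3, map_add] at h2
    rw [h4, h2]
    congr 1
    · exact map_smul ((Ψ.symm.restrictScalars ℂ).trans (Module.AEval'.of f).symm) _ _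
    · split_ifs <;> simp [h4]
  refine ⟨Fintype.card ι, fun j => e (σ.symm j), fun j => μ (σ.symm j),
    B₁.reindex (Equiv.sigmaCongrLeft' (β := fun i => Fin (e i)) σ), fun i k => ?_⟩
  have hre : ∀ (i : Fin (Fintype.card ι)) (k : Fin (e (σ.symm i))),
      (B₁.reindex (Equiv.sigmaCongrLeft' (β := fun i => Fin (e i)) σ)) ⟨i, k⟩ =
        B₁ ⟨σ.symm i, k⟩ := fun i k => by
    rw [Module.Basis.reindex_apply]
    rfl
  simp only [hre]
  exact hB₁ _ k

/-- Every complex matrix is similar to a Jordan matrix. -/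
theorem exists_isJordan {n : ℕ} (A : Mat n) : ∃ G : Mat n, IsUnit G ∧ IsJordan (G⁻¹ * A * G) := by
  obtain ⟨m, e, μ, b, hb⟩ := exists_jordan_basis_sigma (Matrix.toLin' A)
  have hcard : ∑ i, e i = n := by
    have h1 := Module.finrank_eq_card_basis b
    rw [Module.finrank_fin_fun, Fintype.card_sigma] at h1
    simpa using h1.symm
  -- Lexicographic enumeration of the blocks: consecutive positions inside a block become
  -- consecutive indices, so the shift within a block lands on the superdiagonal.
  let φ : (Σ i, Fin (e i)) ≃ Fin n := finSigmaFinEquiv.trans (finCongr hcard)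
  have hφ : ∀ i, ∀ k : Fin (e i), (φ ⟨i, k⟩ : ℕ) =
      ∑ j : Fin i, e (Fin.castLE i.2.le j) + k := fun i k => finSigmaFinEquiv_apply ⟨i, k⟩
  let B := b.reindex φ
  let G : Mat n := (Pi.basisFun ℂ (Fin n)).toMatrix B
  let J : Mat n := LinearMap.toMatrix B B (Matrix.toLin' A)
  have hG : IsUnit G := by
    have := (Pi.basisFun ℂ (Fin n)).invertibleToMatrix B
    exact isUnit_of_invertible _
  have hAG : A * G = G * J := by
    have h1 := linearMap_toMatrix_mul_basis_toMatrix B (Pi.basisFun ℂ (Fin n))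
      (Pi.basisFun ℂ (Fin n)) (Matrix.toLin' A)
    have h2 := basis_toMatrix_mul_linearMap_toMatrix B (Pi.basisFun ℂ (Fin n)) B
      (Matrix.toLin' A)
    have h3 : LinearMap.toMatrix (Pi.basisFun ℂ (Fin n)) (Pi.basisFun ℂ (Fin n))
        (Matrix.toLin' A) = A := by
      rw [← Matrix.toLin_eq_toLin', LinearMap.toMatrix_toLin]
    rw [h3] at h1
    exact h1.trans h2.symm
  have hJ : ∀ a i, ∀ k : Fin (e i), J a (φ ⟨i, k⟩) = (if a = φ ⟨i, k⟩ then μ i else 0) +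
      if (k : ℕ) = 0 then 0 else
        if a = φ ⟨i, ⟨(k : ℕ) - 1, (Nat.sub_le _ _).trans_lt k.2⟩⟩ then 1 else 0 := by
    intro a i k
    have hBφ : ∀ x, B (φ x) = b x := fun x => by simp [B]
    simp only [J]
    rw [LinearMap.toMatrix_apply, hBφ, hb, map_add, Finsupp.add_apply, map_smul,
      Finsupp.smul_apply, ← hBφ, Module.Basis.repr_self, Finsupp.single_apply]
    congr 1
    · simp [eq_comm]
    · split_ifs with _ h2
      · simp
      · rw [h2, ← hBφ, Module.Basis.repr_self, Finsupp.single_eq_same]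
      · rw [← hBφ, Module.Basis.repr_self, Finsupp.single_eq_of_ne h2]
  refine ⟨G, hG, ?_⟩
  have hsim : G⁻¹ * A * G = J := by
    rw [mul_assoc, hAG, ← mul_assoc, Matrix.nonsing_inv_mul _
      ((Matrix.isUnit_iff_isUnit_det _).1 hG), one_mul]
  rw [hsim]
  constructor
  · intro a c hca hca1
    obtain ⟨⟨i, k⟩, rfl⟩ := φ.surjective c
    rw [hJ, if_neg (Ne.symm hca), zero_add]
    split_ifs with h1 h2
    · rfl
    · exfalso
      apply hca1
      rw [h2, hφ, hφ]
      simp only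
      omega
    · rfl
  · intro a c hca
    obtain ⟨⟨i, k⟩, rfl⟩ := φ.surjective c
    have hne : a ≠ φ ⟨i, k⟩ := fun h => by
      rw [h] at hca; omega
    by_cases h0 : (k : ℕ) = 0
    · left
      rw [hJ, if_neg hne, if_pos h0, add_zero]
    · right
      have ha : a = φ ⟨i, ⟨(k : ℕ) - 1, (Nat.sub_le _ _).trans_lt k.2⟩⟩ := by
        apply Fin.ext
        rw [hφ] at hca ⊢
        simp only
        omega
      refine ⟨by rw [hJ, if_neg hne, if_neg h0, if_pos ha, zero_add], ?_⟩
      have hdiag : ∀ k : Fin (e i), J (φ ⟨i, k⟩) (φ ⟨i, k⟩) = μ i := by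
        intro k
        rw [hJ, if_pos rfl]
        split_ifs with h1 h2
        · simp
        · have := φ.injective h2
          simp only [Sigma.mk.injEq, heq_eq_eq, true_and] at this
          have := congrArg Fin.val this
          simp only at this
          omega
        · simp
      rw [ha, hdiag, hdiag]

end JordanForm

/-! ### Invertibility propagates along linear equations. -/

section LinearODE

variable {n : ℕ}

/-- If X(0) v = 0, then X v is a solution vanishing at 0, hence at 1, contradicting invertibility of
X(1). -/
theorem isUnit_of_linear_ode {X B : ℝ → Mat n} (hB : ContinuousOn B (Icc 0 1))
    (hX : ∀ t ∈ Icc (0 : ℝ) 1, HasDerivAt X (B t * X t) t) (h1 : IsUnit (X 1)) :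
    IsUnit (X 0) := by
  by_contra h0
  rw [Matrix.isUnit_iff_isUnit_det, isUnit_iff_ne_zero, not_not,
    ← Matrix.exists_mulVec_eq_zero_iff] at h0
  obtain ⟨v, hv, hv0⟩ := h0
  -- The vector is repeated in every column so that uniqueness for matrix-valued equations applies.
  let V : Mat n := Matrix.of fun i _ => v i
  have hV : ∀ M : Mat n, ∀ i j, (M * V) i j = (M.mulVec v) i := fun M i j => rfl
  have key := eq_zero_of_linear_ode (f := fun t => X t * V) (B := B) (C := fun _ => 0) hB
    continuousOn_const (fun t ht => HasDerivAt.congr_deriv ((hX t ht).mul_const V) (by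
      rw [mul_zero, add_zero]; exact mul_assoc _ _ _))
    (by ext i j; rw [hV, hv0]; rfl) 1 (by simp)
  have hVz : V = 0 := h1.mul_left_cancel (by simpa using key)
  apply hv
  funext i
  exact congrFun (congrFun hVz i) i

theorem isUnit_of_complex_linear_ode {Y B : ℂ → Mat n} (hB : Continuous B)
    (hY : ∀ w, HasDerivAt Y (B w * Y w) w) {w₁ : ℂ} (h1 : IsUnit (Y w₁)) (w₀ : ℂ) :
    IsUnit (Y w₀) := by
  let γ : ℝ → ℂ := fun t => w₀ + t * (w₁ - w₀)
  have hγ : ∀ t, HasDerivAt γ (w₁ - w₀) t := fun t =>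
    (((Complex.ofRealCLM.hasDerivAt (x := t)).mul_const (w₁ - w₀)).const_add w₀).congr_deriv
      (by simp)
  have := isUnit_of_linear_ode (X := fun t => Y (γ t)) (B := fun t => (w₁ - w₀) • B (γ t))
    (by
      have : Continuous γ := by fun_prop
      exact ((hB.comp this).const_smul (w₁ - w₀)).continuousOn)
    (fun t _ => HasDerivAt.congr_deriv (HasDerivAt.scomp t (hY (γ t)) (hγ t))
      (smul_mul_assoc _ _ _).symm) (by simpa [γ] using h1)
  simpa [γ] using this

end LinearODE

/-! ### Termwise differentiation of power series. -/

section PowerSeriesDerivative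

variable {n : ℕ}

theorem hasDerivAt_powerSeries {F : ℕ → Mat n} (h : ∀ z : ℂ, Summable fun k : ℕ => z ^ k • F k)
    (z : ℂ) : Summable (fun k : ℕ => ((k : ℂ) * z ^ (k - 1)) • F k) ∧
      HasDerivAt (fun z => ∑' k, z ^ k • F k) (∑' k : ℕ, ((k : ℂ) * z ^ (k - 1)) • F k) z := by
  set ρ : ℝ := ‖z‖ + 1 with hρ
  have hρ1 : 1 ≤ ρ := by simp [hρ]
  -- Evaluating at 2ρ absorbs the factor k of the derivative, since k ≤ 2^k.
  let u : ℕ → ℝ := fun k => ‖((2 * ρ : ℝ) : ℂ) ^ k • F k‖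
  have hu : Summable u := (h _).norm
  have hbound : ∀ k : ℕ, ∀ y ∈ ball (0 : ℂ) ρ, ‖((k : ℂ) * y ^ (k - 1)) • F k‖ ≤ u k := by
    intro k y hy
    simp only [u]
    rw [norm_smul, norm_smul, norm_mul, norm_pow, norm_pow, Complex.norm_natCast,
      Complex.norm_real, Real.norm_of_nonneg (by positivity), mul_pow]
    rw [mem_ball_zero_iff] at hy
    have h1 : (k : ℝ) ≤ 2 ^ k := by exact_mod_cast Nat.lt_two_pow_self.le
    have h2 : ‖y‖ ^ (k - 1) ≤ ρ ^ k :=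
      (pow_le_pow_left₀ (norm_nonneg _) hy.le _).trans (pow_le_pow_right₀ hρ1 (by omega))
    gcongr
  have hz : z ∈ ball (0 : ℂ) ρ := by simp [hρ]
  refine ⟨Summable.of_norm_bounded hu fun k => hbound k z hz, ?_⟩
  exact hasDerivAt_tsum_of_isPreconnected (𝕜 := ℂ) (g := fun k z => z ^ k • F k)
    (g' := fun k y => ((k : ℂ) * y ^ (k - 1)) • F k) hu isOpen_ball
    (convex_ball (0 : ℂ) ρ).isPreconnected
    (fun k y _ => (hasDerivAt_pow k y).smul_const (F k)) hbound hz (h z) hz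

end PowerSeriesDerivative

/-! ### Frobenius' method: homological equation, recursion, convergence. -/

section Frobenius

variable {n : ℕ}

/-- `X ↦ k X + X J - J X` is onto modulo resonant matrices. -/
theorem exists_resonant_solution {J : Mat n} (hJ : IsJordan J) (k : ℂ) (H : Mat n) :
    ∃ F R : Mat n, k • F + F * J - J * F + R = H ∧ ∀ i j, R i j ≠ 0 → J i i - J j j = k := by
  let N : Mat n := J - Matrix.diagonal fun i => J i i
  have hN : ∀ i j, N i j ≠ 0 → i < j ∧ J i i = J j j := by
    intro i j hij
    have hne : i ≠ j := by
      rintro rfl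
      simp [N] at hij
    simp only [N, Matrix.sub_apply, Matrix.diagonal_apply_ne _ hne, sub_zero] at hij
    by_cases hj : (j : ℕ) = i + 1
    · rcases hJ.superdiag i j hj with h0 | ⟨-, h1⟩
      · exact absurd h0 hij
      · exact ⟨by rw [Fin.lt_def]; omega, h1⟩
    · exact absurd (hJ.support i j (Ne.symm hne) hj) hij
  have hNil : IsNilpotent N := ⟨n + 1, pow_eq_zero_of_strict (fun i j => i < j)
    (fun i => lt_irrefl i) (fun _ _ _ => lt_trans) (fun i j h => (hN i j h).1)⟩
  let ad : Mat n →ₗ[ℂ] Mat n := LinearMap.mulRight ℂ N - LinearMap.mulLeft ℂ N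
  have had : ∀ X, ad X = X * N - N * X := fun X => rfl
  have hadNil : IsNilpotent ad :=
    (LinearMap.commute_mulLeft_right (R := ℂ) N N).symm.isNilpotent_sub
      ((LinearMap.isNilpotent_mulRight_iff ℂ N).2 hNil)
      ((LinearMap.isNilpotent_mulLeft_iff ℂ N).2 hNil)
  -- The operator is entrywise multiplication by κ plus the nilpotent `ad`. They commute because N
  -- joins only equal eigenvalues. The map ψ inverts the first off resonance, and returns 0 where κ
  -- = 0 since 0⁻¹ = 0.
  let κ : Fin n → Fin n → ℂ := fun i j => k - J i i + J j j
  let ψ : Mat n → Mat n := fun X => Matrix.of fun i j => (κ i j)⁻¹ * X i j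
  have hψad : ∀ X, ad (ψ X) = ψ (ad X) := by
    intro X
    ext i j
    simp only [had, ψ, Matrix.sub_apply, Matrix.mul_apply, Matrix.of_apply, mul_sub,
      Finset.mul_sum]
    congr 1
    · refine Finset.sum_congr rfl fun l _ => ?_
      by_cases h0 : N l j = 0
      · simp [h0]
      · simp only [κ, (hN l j h0).2, mul_assoc]
    · refine Finset.sum_congr rfl fun l _ => ?_
      by_cases h0 : N i l = 0
      · simp [h0]
      · simp only [κ, (hN i l h0).2]
        ring
  have hψadpow : ∀ m X, (ad ^ m) (ψ X) = ψ ((ad ^ m) X) := by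
    intro m
    induction m with
    | zero => intro X; rfl
    | succ m ih => intro X; rw [pow_succ, Module.End.mul_apply, hψad, ih]; rfl
  have hT : ∀ F, k • F + F * J - J * F = (Matrix.of fun i j => κ i j * F i j) + ad F := by
    intro F
    have hJN : J = (Matrix.diagonal fun i => J i i) + N := by simp [N]
    rw [had]
    conv_lhs => rw [hJN]
    ext i j
    simp only [mul_add, add_mul, Matrix.add_apply, Matrix.sub_apply, Matrix.smul_apply,
      Matrix.mul_diagonal, Matrix.diagonal_mul, Matrix.of_apply, smul_eq_mul, κ]
    ring
  obtain ⟨m, hm⟩ := hadNil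
  -- Terminating Neumann iteration: ψ H solves the equation up to the resonant entries of H and the
  -- error ad(ψ H), which is annihilated by one power of `ad` fewer.
  have key : ∀ m H, (ad ^ m) H = 0 → ∃ F R : Mat n,
      k • F + F * J - J * F + R = H ∧ ∀ i j, R i j ≠ 0 → J i i - J j j = k := by
    intro m
    induction m with
    | zero =>
      intro H h0
      refine ⟨0, 0, ?_, by simp⟩
      simpa using h0.symm
    | succ m ih =>
      intro H h0
      obtain ⟨F₁, R₁, h1, hR₁⟩ := ih (-(ad (ψ H))) (by
        rw [map_neg, hψad, hψadpow, ← Module.End.mul_apply, ← pow_succ, h0]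
        ext i j
        simp [ψ])
      refine ⟨ψ H + F₁, (Matrix.of fun i j => if κ i j = 0 then H i j else 0) + R₁, ?_, ?_⟩
      · have e1 := hT (ψ H)
        have e2 : (Matrix.of fun i j => κ i j * ψ H i j) +
            (Matrix.of fun i j => if κ i j = 0 then H i j else 0) = H := by
          ext i j
          by_cases hκ : κ i j = 0
          · simp [hκ]
          · simp [ψ, hκ]
        calc k • (ψ H + F₁) + (ψ H + F₁) * J - J * (ψ H + F₁) +
              ((Matrix.of fun i j => if κ i j = 0 then H i j else 0) + R₁)
            = (k • ψ H + ψ H * J - J * ψ H) + (k • F₁ + F₁ * J - J * F₁ + R₁) +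
              (Matrix.of fun i j => if κ i j = 0 then H i j else 0) := by
                rw [smul_add, add_mul, mul_add]; abel
          _ = (Matrix.of fun i j => κ i j * ψ H i j) +
              (Matrix.of fun i j => if κ i j = 0 then H i j else 0) := by
                rw [e1, h1]; abel
          _ = H := e2
      · intro i j hij
        by_cases hκ : κ i j = 0
        · simp only [κ] at hκ
          linear_combination -hκ
        · refine hR₁ i j ?_
          simpa [hκ] using hij
  exact key m H (by rw [hm]; rfl)

/-- The recursion of the Frobenius method, with `σ` solving the homological equations. -/
noncomputable def frobeniusSeq (σ : ℕ → Mat n → Mat n × Mat n) (Λ : Mat n) : ℕ → Mat n × Mat n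
  | 0 => (1, 0)
  | k + 1 => σ (k + 1) (Λ * (frobeniusSeq σ Λ k).1 -
      ∑ m : Fin k, (frobeniusSeq σ Λ (m + 1)).1 * (frobeniusSeq σ Λ (k - m)).2)
  decreasing_by all_goals omega

/-- The recursion is the coefficient of z^{k+1} in zF' + FJ + F R(z) = (J + zΛ) F. The unknowns of
order k + 1 enter only through the homological operator and the term m = 0, which is R_{k+1}; the
rest is known. -/
theorem exists_formal_solution {J : Mat n} (hJ : IsJordan J) (Λ : Mat n) :
    ∃ F R : ℕ → Mat n, F 0 = 1 ∧ R 0 = 0 ∧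
      (∀ k : ℕ, ∀ i j, R k i j ≠ 0 → 0 < k ∧ J i i - J j j = (k : ℂ)) ∧
      ∀ k : ℕ, ((k + 1 : ℕ) : ℂ) • F (k + 1) + F (k + 1) * J - J * F (k + 1) +
        ∑ m ∈ Finset.range (k + 2), F m * R (k + 1 - m) = Λ * F k := by
  choose f r hfr hres using fun k : ℕ => exists_resonant_solution hJ (k : ℂ)
  let σ : ℕ → Mat n → Mat n × Mat n := fun k H => (f k H, r k H)
  let F : ℕ → Mat n := fun k => (frobeniusSeq σ Λ k).1
  let R : ℕ → Mat n := fun k => (frobeniusSeq σ Λ k).2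
  have hF0 : F 0 = 1 := by simp [F, frobeniusSeq]
  have hR0 : R 0 = 0 := by simp [R, frobeniusSeq]
  let H : ℕ → Mat n := fun k => Λ * F k - ∑ m : Fin k, F (m + 1) * R (k - m)
  have hF : ∀ k, F (k + 1) = f (k + 1) (H k) := fun k => by
    simp only [F]; rw [frobeniusSeq]
  have hR : ∀ k, R (k + 1) = r (k + 1) (H k) := fun k => by
    simp only [R]; rw [frobeniusSeq]
  refine ⟨F, R, hF0, hR0, ?_, ?_⟩
  · intro k i j hk
    cases k with
    | zero => simp [hR0] at hk
    | succ k =>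
      rw [hR] at hk
      exact ⟨Nat.succ_pos k, hres _ _ i j hk⟩
  · intro k
    have h1 := hfr (k + 1) (H k)
    rw [← hF, ← hR] at h1
    rw [Finset.sum_range_succ, Nat.sub_self, hR0, mul_zero, add_zero, Finset.sum_range_succ', hF0,
      one_mul, Nat.sub_zero, Finset.sum_range]
    have h2 : ∑ m : Fin k, F (m + 1) * R (k + 1 - (m + 1)) = Λ * F k - H k := by
      simp only [H, Nat.add_sub_add_right, sub_sub_cancel]
    rw [h2]
    rw [show ((k + 1 : ℕ) : ℂ) • F (k + 1) + F (k + 1) * J - J * F (k + 1) +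
      (Λ * F k - H k + R (k + 1)) = (((k + 1 : ℕ) : ℂ) • F (k + 1) + F (k + 1) * J -
        J * F (k + 1) + R (k + 1)) + (Λ * F k - H k) by abel, h1]
    abel

/-- Once k + 1 - a exceeds bρ + Q, where Q = ∑ g_j ρ^j is a finite sum, the recursion reproduces any
bound M valid for the earlier terms. The finitely many initial terms supply M. -/
theorem exists_bound_of_recursion {f g : ℕ → ℝ} {a b ρ : ℝ} {K : ℕ} (hf : ∀ k, 0 ≤ f k)
    (hg : ∀ k, 0 ≤ g k) (hK : ∀ k, K ≤ k → g k = 0) (hg0 : g 0 = 0) (hb : 0 ≤ b)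
    (hrec : ∀ k : ℕ, ((k + 1 : ℕ) : ℝ) * f (k + 1) ≤ b * f k +
      ∑ m ∈ Finset.range (k + 1), f m * g (k + 1 - m) + a * f (k + 1)) (hρ : 0 < ρ) :
    ∃ M, ∀ k, f k * ρ ^ k ≤ M := by
  set Q : ℝ := ∑ j ∈ Finset.range K, g j * ρ ^ j with hQ
  have hterm : ∀ j, 0 ≤ g j * ρ ^ j := fun j => mul_nonneg (hg j) (by positivity)
  have hfterm : ∀ j, 0 ≤ f j * ρ ^ j := fun j => mul_nonneg (hf j) (by positivity)
  have hQ0 : 0 ≤ Q := Finset.sum_nonneg fun j _ => hterm j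
  obtain ⟨k₀, hk₀⟩ := exists_nat_ge (a + b * ρ + Q)
  set M : ℝ := ∑ k ∈ Finset.range (k₀ + 1), f k * ρ ^ k with hM
  have hM0 : 0 ≤ M := Finset.sum_nonneg fun j _ => hfterm j
  refine ⟨M, fun k => ?_⟩
  induction k using Nat.strong_induction_on with
  | _ k ih =>
    by_cases hk : k ≤ k₀
    · exact Finset.single_le_sum (f := fun k => f k * ρ ^ k) (fun j _ => hfterm j)
        (Finset.mem_range.2 (by omega))
    obtain ⟨k, rfl⟩ : ∃ k', k = k' + 1 := ⟨k - 1, by omega⟩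
    have e3 : ∑ m ∈ Finset.range (k + 1), f m * g (k + 1 - m) * ρ ^ (k + 1) ≤ M * Q := by
      calc ∑ m ∈ Finset.range (k + 1), f m * g (k + 1 - m) * ρ ^ (k + 1)
          ≤ ∑ m ∈ Finset.range (k + 1), M * (g (k + 1 - m) * ρ ^ (k + 1 - m)) := by
            refine Finset.sum_le_sum fun m hm => ?_
            rw [Finset.mem_range] at hm
            have hp : ρ ^ (k + 1) = ρ ^ m * ρ ^ (k + 1 - m) := by
              rw [← pow_add]; congr 1; omega
            rw [hp, show f m * g (k + 1 - m) * (ρ ^ m * ρ ^ (k + 1 - m)) =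
              (f m * ρ ^ m) * (g (k + 1 - m) * ρ ^ (k + 1 - m)) by ring]
            exact mul_le_mul_of_nonneg_right (ih m hm) (hterm _)
        _ = M * ∑ m ∈ Finset.range (k + 1), g (m + 1) * ρ ^ (m + 1) := by
            rw [← Finset.mul_sum, ← Finset.sum_range_reflect]
            congr 1
            refine Finset.sum_congr rfl fun m hm => ?_
            rw [Finset.mem_range] at hm
            rw [show k + 1 - (k + 1 - 1 - m) = m + 1 by omega]
        _ ≤ M * Q := by
            refine mul_le_mul_of_nonneg_left ?_ hM0
            have h1 : ∑ m ∈ Finset.range (k + 1), g (m + 1) * ρ ^ (m + 1) =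
                ∑ m ∈ Finset.range (k + 2), g m * ρ ^ m := by
              rw [Finset.sum_range_succ' _ (k + 1), hg0]; simp
            rw [h1, hQ, ← Finset.sum_filter_ne_zero]
            refine Finset.sum_le_sum_of_subset_of_nonneg (fun m hm => ?_) fun m _ _ => hterm m
            rw [Finset.mem_range]
            by_contra hlt
            refine (Finset.mem_filter.1 hm).2 ?_
            rw [hK m (not_lt.1 hlt), zero_mul]
    have e4 : b * f k * ρ ^ (k + 1) ≤ b * ρ * M := by
      rw [show b * f k * ρ ^ (k + 1) = b * ρ * (f k * ρ ^ k) by rw [pow_succ]; ring]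
      exact mul_le_mul_of_nonneg_left (ih k (by omega)) (by positivity)
    have e5 := mul_le_mul_of_nonneg_right (hrec k) (pow_nonneg hρ.le (k + 1))
    rw [← Finset.sum_mul] at e3
    have hk' : (k₀ : ℝ) + 1 ≤ ((k + 1 : ℕ) : ℝ) := by
      have : k₀ + 1 ≤ k + 1 := by omega
      exact_mod_cast this
    have e6 : (((k + 1 : ℕ) : ℝ) - a) * (f (k + 1) * ρ ^ (k + 1)) ≤ (b * ρ + Q) * M := by
      linarith
    have hpos : b * ρ + Q < ((k + 1 : ℕ) : ℝ) - a := by linarith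
    have hnn : 0 ≤ b * ρ + Q := by positivity
    exact le_of_mul_le_mul_left (e6.trans (mul_le_mul_of_nonneg_right hpos.le hM0))
      (hnn.trans_lt hpos)

theorem exists_bound_formal_solution {J Λ : Mat n} {F R : ℕ → Mat n} {K : ℕ}
    (hK : ∀ k, K ≤ k → R k = 0) (hR0 : R 0 = 0)
    (hrec : ∀ k : ℕ, ((k + 1 : ℕ) : ℂ) • F (k + 1) + F (k + 1) * J - J * F (k + 1) +
        ∑ m ∈ Finset.range (k + 2), F m * R (k + 1 - m) = Λ * F k) {ρ : ℝ} (hρ : 0 < ρ) :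
    ∃ M, ∀ k, ‖F k‖ * ρ ^ k ≤ M := by
  refine exists_bound_of_recursion (f := fun k => ‖F k‖) (g := fun k => ‖R k‖) (a := 2 * ‖J‖)
    (b := ‖Λ‖) (fun k => norm_nonneg _) (fun k => norm_nonneg _)
    (fun k hk => by rw [hK k hk, norm_zero]) (by rw [hR0, norm_zero])
    (norm_nonneg _) (fun k => ?_) hρ
  have hr := hrec k
  rw [Finset.sum_range_succ, Nat.sub_self, hR0, mul_zero, add_zero] at hr
  have e1 : ((k + 1 : ℕ) : ℂ) • F (k + 1) = Λ * F k - ∑ m ∈ Finset.range (k + 1),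
      F m * R (k + 1 - m) - F (k + 1) * J + J * F (k + 1) := by
    rw [← hr]; abel
  have e2 : ‖((k + 1 : ℕ) : ℂ) • F (k + 1)‖ = ((k + 1 : ℕ) : ℝ) * ‖F (k + 1)‖ := by
    rw [norm_smul, Complex.norm_natCast]
  have e3 : ‖∑ m ∈ Finset.range (k + 1), F m * R (k + 1 - m)‖ ≤
      ∑ m ∈ Finset.range (k + 1), ‖F m‖ * ‖R (k + 1 - m)‖ :=
    (norm_sum_le _ _).trans (Finset.sum_le_sum fun m _ => norm_mul_le _ _)
  have e4 := norm_add_le (Λ * F k - ∑ m ∈ Finset.range (k + 1), F m * R (k + 1 - m) -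
    F (k + 1) * J) (J * F (k + 1))
  have e5 := norm_sub_le (Λ * F k - ∑ m ∈ Finset.range (k + 1), F m * R (k + 1 - m))
    (F (k + 1) * J)
  have e6 := norm_sub_le (Λ * F k) (∑ m ∈ Finset.range (k + 1), F m * R (k + 1 - m))
  rw [← e1, e2] at e4
  linarith [norm_mul_le J (F (k + 1)), norm_mul_le (F (k + 1)) J, norm_mul_le Λ (F k)]

theorem summable_of_bounds {F : ℕ → Mat n} (h : ∀ ρ : ℝ, 0 < ρ → ∃ M, ∀ k, ‖F k‖ * ρ ^ k ≤ M)
    (z : ℂ) : Summable fun k : ℕ => z ^ k • F k := by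
  obtain ⟨M, hM⟩ := h (2 * (‖z‖ + 1)) (by positivity)
  refine Summable.of_norm_bounded (g := fun k => M * (1 / 2) ^ k)
    ((summable_geometric_of_lt_one (by norm_num) (by norm_num)).mul_left M) fun k => ?_
  rw [norm_smul, norm_pow]
  have h1 : ‖z‖ ^ k ≤ (2 * (‖z‖ + 1)) ^ k * (1 / 2) ^ k := by
    rw [← mul_pow]
    refine pow_le_pow_left₀ (norm_nonneg _) ?_ k
    linarith
  calc ‖z‖ ^ k * ‖F k‖ ≤ (2 * (‖z‖ + 1)) ^ k * (1 / 2) ^ k * ‖F k‖ := by gcongr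
    _ = ‖F k‖ * (2 * (‖z‖ + 1)) ^ k * (1 / 2) ^ k := by ring
    _ ≤ M * (1 / 2) ^ k := by gcongr; exact hM k

end Frobenius

/-! ### The Levelt solution at a fixed λ. -/

section FrobeniusSolution

variable {n : ℕ}

theorem hasSum_cauchyProduct {f g : ℕ → Mat n} (hf : Summable f) (hg : Summable g) :
    HasSum (fun k => ∑ m ∈ Finset.range (k + 1), f m * g (k - m))
      ((∑' k, f k) * ∑' k, g k) :=
  hasSum_sum_range_mul_of_summable_norm hf.norm hg.norm

theorem powerSeries_ode {J Λ : Mat n} {F R : ℕ → Mat n} {K : ℕ} (hF0 : F 0 = 1) (hR0 : R 0 = 0)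
    (hK : ∀ k, K ≤ k → R k = 0)
    (hrec : ∀ k : ℕ, ((k + 1 : ℕ) : ℂ) • F (k + 1) + F (k + 1) * J - J * F (k + 1) +
        ∑ m ∈ Finset.range (k + 2), F m * R (k + 1 - m) = Λ * F k)
    (hsum : ∀ z : ℂ, Summable fun k : ℕ => z ^ k • F k) (z : ℂ) :
    z • (∑' k : ℕ, ((k : ℂ) * z ^ (k - 1)) • F k) + (∑' k, z ^ k • F k) * J +
      (∑' k, z ^ k • F k) * ∑ k ∈ Finset.range K, z ^ k • R k =
      (J + z • Λ) * ∑' k, z ^ k • F k := by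
  have hR : HasSum (fun k => z ^ k • R k) (∑ k ∈ Finset.range K, z ^ k • R k) := by
    refine hasSum_sum_of_ne_finset_zero fun k hk => ?_
    rw [hK k (by simpa using hk), smul_zero]
  have ha : HasSum (fun k : ℕ => z • ((k : ℂ) * z ^ (k - 1)) • F k)
      (z • ∑' k : ℕ, ((k : ℂ) * z ^ (k - 1)) • F k) :=
    (hasDerivAt_powerSeries hsum z).1.hasSum.const_smul z
  have hb : HasSum (fun k => (z ^ k • F k) * J) ((∑' k, z ^ k • F k) * J) :=
    (hsum z).hasSum.mul_right J
  have hd : HasSum (fun k => J * (z ^ k • F k)) (J * ∑' k, z ^ k • F k) :=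
    (hsum z).hasSum.mul_left J
  have hc : HasSum (fun k => ∑ m ∈ Finset.range (k + 1), (z ^ m • F m) * (z ^ (k - m) • R (k - m)))
      ((∑' k, z ^ k • F k) * ∑ k ∈ Finset.range K, z ^ k • R k) := by
    rw [← hR.tsum_eq]
    exact hasSum_cauchyProduct (f := fun k => z ^ k • F k) (g := fun k => z ^ k • R k) (hsum z)
      hR.summable
  have he : HasSum (fun k => z • (Λ * (z ^ k • F k))) (z • (Λ * ∑' k, z ^ k • F k)) :=
    ((hsum z).hasSum.mul_left Λ).const_smul z
  have hall := ((ha.add hb).add hc).sub hd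
  -- The term k = 0 is J - J = 0, so the sum can be shifted to match the recursion for index k + 1.
  rw [← hasSum_nat_add_iff' 1] at hall
  simp only [Finset.sum_range_one, Nat.cast_zero, zero_mul, zero_smul, smul_zero, pow_zero,
    one_smul, hF0, one_mul, mul_one, zero_add, Nat.sub_self, hR0, sub_self, sub_zero,
    add_zero] at hall
  have heq : (fun k : ℕ => z • (((k + 1 : ℕ) : ℂ) * z ^ (k + 1 - 1)) • F (k + 1) +
      z ^ (k + 1) • F (k + 1) * J +
      ∑ m ∈ Finset.range (k + 1 + 1), z ^ m • F m * z ^ (k + 1 - m) • R (k + 1 - m) -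
      J * z ^ (k + 1) • F (k + 1)) = fun k => z • (Λ * (z ^ k • F k)) := by
    funext k
    have h1 : ∑ m ∈ Finset.range (k + 1 + 1), z ^ m • F m * z ^ (k + 1 - m) • R (k + 1 - m) =
        z ^ (k + 1) • ∑ m ∈ Finset.range (k + 2), F m * R (k + 1 - m) := by
      rw [Finset.smul_sum]
      refine Finset.sum_congr rfl fun m hm => ?_
      rw [Finset.mem_range] at hm
      rw [smul_mul_smul_comm, ← pow_add, show m + (k + 1 - m) = k + 1 by omega]
    have h2 : z • (((k + 1 : ℕ) : ℂ) * z ^ (k + 1 - 1)) • F (k + 1) =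
        z ^ (k + 1) • ((k + 1 : ℕ) : ℂ) • F (k + 1) := by
      rw [smul_smul, smul_smul, Nat.add_sub_cancel]
      congr 1
      ring
    have h3 : z • (Λ * (z ^ k • F k)) = z ^ (k + 1) • (Λ * F k) := by
      rw [mul_smul_comm, smul_smul, pow_succ']
    rw [h1, h2, h3, ← hrec k, smul_mul_assoc, mul_smul_comm, ← smul_add, ← smul_add, ← smul_sub]
    congr 1
    abel
  rw [heq] at hall
  have := hall.unique he
  rw [add_mul, smul_mul_assoc, ← this]
  abel

/-- Only finitely many orders are resonant, so ∑ R_k z^k is a polynomial. -/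
theorem exists_bound_differences (μ : Fin n → ℂ) :
    ∃ K : ℕ, ∀ k : ℕ, K ≤ k → ∀ i j, μ i - μ j ≠ (k : ℂ) := by
  obtain ⟨K, hK⟩ := exists_nat_gt (∑ i, ∑ j, ‖μ i - μ j‖)
  refine ⟨K, fun k hk i j h => ?_⟩
  have h1 : ‖μ i - μ j‖ ≤ ∑ i, ∑ j, ‖μ i - μ j‖ :=
    (Finset.single_le_sum (f := fun j => ‖μ i - μ j‖) (fun j _ => norm_nonneg _)
      (Finset.mem_univ j)).trans (Finset.single_le_sum (f := fun i => ∑ j, ‖μ i - μ j‖)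
      (fun i _ => Finset.sum_nonneg fun j _ => norm_nonneg _) (Finset.mem_univ i))
  rw [h, Complex.norm_natCast] at h1
  have : (K : ℝ) ≤ k := by exact_mod_cast hk
  linarith

theorem isLeveltExponents_floor {J : Mat n} (hJ : IsJordan J) {R : Mat n}
    (hR : ∀ i j, R i j ≠ 0 → ∃ k : ℕ, 0 < k ∧ J i i - J j j = (k : ℂ)) :
    IsLeveltExponents (fun i => ⌊(J i i).re⌋)
      (J - Matrix.diagonal fun i => ((⌊(J i i).re⌋ : ℤ) : ℂ)) R where
  jordan := by rwa [add_sub_cancel]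
  re_nonneg := fun i => by
    simp
  re_lt_one := fun i => by
    have := Int.lt_floor_add_one (J i i).re
    simp only [Matrix.sub_apply, Matrix.diagonal_apply_eq, Complex.sub_re, Complex.intCast_re]
    linarith
  resonant := fun i j h => by simpa using hR i j h

/-- Conjugation of `L` by `z^D` is polynomial in `z = e^w`. -/
theorem exp_smul_diagonal_mul_exponent {d : Fin n → ℤ} {S : Mat n} {R : ℕ → Mat n} {K : ℕ}
    (h : IsLeveltExponents d S (∑ k ∈ Finset.range K, R k))
    (hR : ∀ k : ℕ, ∀ i j, R k i j ≠ 0 → d i - d j = k) (w : ℂ) :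
    NormedSpace.exp (w • (Matrix.diagonal fun i => (d i : ℂ) : Mat n)) *
        (S + ∑ k ∈ Finset.range K, R k) =
      (S + ∑ k ∈ Finset.range K, Complex.exp w ^ k • R k) *
        NormedSpace.exp (w • (Matrix.diagonal fun i => (d i : ℂ) : Mat n)) := by
  rw [exp_smul_diagonal]
  ext i j
  rw [Matrix.diagonal_mul, Matrix.mul_diagonal, Matrix.add_apply, Matrix.add_apply,
    Matrix.sum_apply, Matrix.sum_apply, mul_add, add_mul, Finset.mul_sum, Finset.sum_mul]
  congr 1
  · by_cases hS : S i j = 0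
    · simp [hS]
    · by_cases hij : i = j
      · rw [hij, mul_comm]
      · rw [(h.S_offdiag hij hS).2.2, mul_comm]
  · refine Finset.sum_congr rfl fun k _ => ?_
    by_cases hRk : R k i j = 0
    · simp [hRk]
    · have hd : (d i : ℂ) = d j + k := by
        have := hR k i j hRk
        have h2 : d i = d j + k := by omega
        rw [h2]; push_cast; ring
      rw [hd, Matrix.smul_apply, smul_eq_mul, ← Complex.exp_nat_mul, mul_add, Complex.exp_add,
        mul_comm w (k : ℂ)]
      ring

/-- Existence of a fundamental solution in Levelt form of `dY/dz = (Λ + A/z) Y`. -/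
theorem exists_leveltForm (A Λ : Mat n) : ∃ (T : LeveltData n) (Y : ℂ → Mat n),
    IsLeveltForm A T Y ∧ (∀ w, HasDerivAt Y ((Complex.exp w • Λ + A) * Y w) w) ∧
      ∀ w, IsUnit (Y w) := by
  obtain ⟨G, hG, hJ⟩ := exists_isJordan A
  have hGdet := (Matrix.isUnit_iff_isUnit_det _).1 hG
  set J : Mat n := G⁻¹ * A * G with hJdef
  have hGJ : G * J = A * G := by
    rw [hJdef, mul_assoc, ← mul_assoc G, Matrix.mul_nonsing_inv _ hGdet, one_mul]
  set Λ' : Mat n := G⁻¹ * Λ * G with hΛ'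
  have hGΛ : G * Λ' = Λ * G := by
    rw [hΛ', mul_assoc, ← mul_assoc G, Matrix.mul_nonsing_inv _ hGdet, one_mul]
  obtain ⟨F, R, hF0, hR0, hres, hrec⟩ := exists_formal_solution hJ Λ'
  obtain ⟨K, hK⟩ := exists_bound_differences fun i => J i i
  have hRK : ∀ k, K ≤ k → R k = 0 := by
    intro k hk
    ext i j
    by_contra hne
    exact hK k hk i j (hres k i j hne).2
  have hsum : ∀ z : ℂ, Summable fun k : ℕ => z ^ k • F k :=
    summable_of_bounds fun ρ hρ => exists_bound_formal_solution hRK hR0 hrec hρ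
  have hRres : ∀ i j, (∑ k ∈ Finset.range K, R k) i j ≠ 0 →
      ∃ k : ℕ, 0 < k ∧ J i i - J j j = (k : ℂ) := by
    intro i j hne
    rw [Matrix.sum_apply] at hne
    obtain ⟨k, -, hk⟩ := Finset.exists_ne_zero_of_sum_ne_zero hne
    exact ⟨k, hres k i j hk⟩
  have hexp := isLeveltExponents_floor hJ hRres
  let T : LeveltData n :=
    { G := G
      F := F
      Yhat := fun z => ∑' k, z ^ k • F k
      d := fun i => ⌊(J i i).re⌋
      S := J - Matrix.diagonal fun i => ((⌊(J i i).re⌋ : ℤ) : ℂ)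
      R := ∑ k ∈ Finset.range K, R k }
  have hTJ : T.J = J := by simp [T, LeveltData.J, LeveltData.D]
  let Y : ℂ → Mat n := fun w => T.G * T.Yhat (Complex.exp w) *
    NormedSpace.exp (w • T.D) * NormedSpace.exp (w • T.L)
  have hT : IsLeveltForm A T Y :=
    { jordan := by rw [hTJ]; exact hJ
      invertible := hG
      similar := by rw [hTJ]
      re_nonneg := hexp.re_nonneg
      re_lt_one := hexp.re_lt_one
      nilpotent := hexp.nilpotent_R
      resonant := by rw [hTJ]; exact hRres
      F_zero := hF0
      convergent := fun z => (hsum z).hasSum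
      form := fun w => rfl }
  have hdiff : ∀ k : ℕ, ∀ i j, R k i j ≠ 0 → T.d i - T.d j = k := fun k i j hne =>
    (hexp.diag_eq (k := k) (by simpa using (hres k i j hne).2)).2
  have hode : ∀ w, HasDerivAt Y ((Complex.exp w • Λ + A) * Y w) w := by
    intro w
    set z := Complex.exp w with hz
    set Y' : Mat n := ∑' k : ℕ, ((k : ℂ) * z ^ (k - 1)) • F k with hY'
    have h1 : HasDerivAt (fun w => T.Yhat (Complex.exp w)) (z • Y') w :=
      (hasDerivAt_powerSeries hsum z).2.scomp w (Complex.hasDerivAt_exp w)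
    have h2 := ((h1.const_mul T.G).mul (hasDerivAt_exp_smul T.D w)).mul (hasDerivAt_exp_smul T.L w)
    refine HasDerivAt.congr_deriv h2 ?_
    -- Moving L to the left through z^D gives S + ∑ R_k z^k. The product rule then reduces the claim
    -- to the power series identity, with J = D + S.
    have hconj : NormedSpace.exp (w • T.D) * T.L =
        (T.S + ∑ k ∈ Finset.range K, z ^ k • R k) * NormedSpace.exp (w • T.D) :=
      exp_smul_diagonal_mul_exponent hexp hdiff w
    have hps : z • Y' + T.Yhat z * J + T.Yhat z * ∑ k ∈ Finset.range K, z ^ k • R k =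
        (J + z • Λ') * T.Yhat z := powerSeries_ode hF0 hR0 hRK hrec hsum z
    have hJDS : J = T.D + T.S := hTJ.symm
    change (T.G * z • Y' * NormedSpace.exp (w • T.D) + T.G * T.Yhat z *
      (T.D * NormedSpace.exp (w • T.D))) * NormedSpace.exp (w • T.L) +
      T.G * T.Yhat z * NormedSpace.exp (w • T.D) * (T.L * NormedSpace.exp (w • T.L)) =
      (z • Λ + A) * (T.G * T.Yhat z * NormedSpace.exp (w • T.D) * NormedSpace.exp (w • T.L))
    generalize NormedSpace.exp (w • T.D) = ED at hconj ⊢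
    generalize NormedSpace.exp (w • T.L) = EL
    generalize T.Yhat z = P at hps ⊢
    generalize ∑ k ∈ Finset.range K, z ^ k • R k = Rz at hps hconj
    have e1 : T.G * P * ED * (T.L * EL) = T.G * P * (T.S + Rz) * ED * EL := by
      rw [← mul_assoc, mul_assoc (T.G * P) ED, hconj]
      simp only [mul_assoc]
    have e2 : (z • Λ + A) * (T.G * P * ED * EL) = T.G * ((J + z • Λ') * P) * ED * EL := by
      have : (z • Λ + A) * T.G = T.G * (J + z • Λ') := by
        change (z • Λ + A) * G = G * (J + z • Λ')
        rw [add_mul, mul_add, smul_mul_assoc, mul_smul_comm, hGJ, hGΛ, add_comm]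
      simp only [← mul_assoc, this]
    rw [e1, e2, ← hps, hJDS]
    simp only [mul_add, add_mul, mul_assoc]
    abel
  refine ⟨T, Y, hT, hode, ?_⟩
  have hcont : Continuous T.Yhat := hT.differentiable_Yhat.continuous
  -- Since Ŷ(0) = 1, Y is invertible over some small z ≠ 0, and the linear equation carries this to
  -- every w.
  have hev : ∀ᶠ z in 𝓝 (0 : ℂ), IsUnit (T.Yhat z) := by
    refine hcont.continuousAt.eventually (p := fun M : Mat n => IsUnit M) ?_
    rw [hT.Yhat_zero]
    exact Units.isOpen.mem_nhds isUnit_one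
  obtain ⟨z, hz, hz0⟩ := ((hev.filter_mono nhdsWithin_le_nhds).and
    (self_mem_nhdsWithin (a := (0 : ℂ)) (s := {0}ᶜ))).exists
  refine fun w => isUnit_of_complex_linear_ode (B := fun w => Complex.exp w • Λ + A)
    (by fun_prop) hode (w₁ := Complex.log z) ?_ w
  have hY : Y (Complex.log z) = T.G * T.Yhat z * NormedSpace.exp (Complex.log z • T.D) *
      NormedSpace.exp (Complex.log z • T.L) := by
    simp only [Y, Complex.exp_log hz0]
  rw [hY]
  exact ((hG.mul hz).mul (Matrix.isUnit_exp _)).mul (Matrix.isUnit_exp _)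

end FrobeniusSolution

/-! ### Parallel transport along rays by iterated integrals. -/

section Transport

variable {s : ℕ} {𝔸 : Type*} [NormedRing 𝔸] [NormedAlgebra ℂ 𝔸]
  (ω : Fin s → ℂ × (Fin s → ℂ) → 𝔸) (c : Fin s → ℂ)

/-- The point `(z, c + τ (λ - c))` on the ray from `(z, c)` to `(z, λ)`. -/
def rayPoint (τ : ℝ) (q : ℂ × (Fin s → ℂ)) : ℂ × (Fin s → ℂ) := (q.1, c + (τ : ℂ) • (q.2 - c))

/-- The value of `∑ ω_j dλ_j` at `q` on the vector `h`. -/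
def lamForm (q : ℂ × (Fin s → ℂ)) (h : Fin s → ℂ) : 𝔸 := ∑ j, h j • ω j q

/-- The terms of the series for the parallel transport along rays from `c`. -/
noncomputable def transportTerm : ℕ → ℂ × (Fin s → ℂ) → 𝔸
  | 0 => fun _ => 1
  | k + 1 => fun q => ∫ τ in (0 : ℝ)..1,
      lamForm ω (rayPoint c τ q) (q.2 - c) * transportTerm k (rayPoint c τ q)

/-- The parallel transport of `∑ ω_j dλ_j` along rays from `c`. -/
noncomputable def transport (q : ℂ × (Fin s → ℂ)) : 𝔸 := ∑' k, transportTerm ω c k q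

theorem continuous_rayPoint :
    Continuous fun x : ℝ × (ℂ × (Fin s → ℂ)) => rayPoint c x.1 x.2 := by
  unfold rayPoint
  fun_prop

theorem differentiable_rayPoint (τ : ℝ) : Differentiable ℂ (rayPoint c τ) := by
  unfold rayPoint
  fun_prop

theorem rayPoint_rayPoint (τ t : ℝ) (q : ℂ × (Fin s → ℂ)) :
    rayPoint c τ (rayPoint c t q) = rayPoint c (t * τ) q := by
  simp only [rayPoint, add_sub_cancel_left, smul_smul, Complex.ofReal_mul]
  rw [mul_comm]

theorem rayPoint_one (q : ℂ × (Fin s → ℂ)) : rayPoint c 1 q = q := by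
  simp [rayPoint]

theorem rayPoint_zero (q : ℂ × (Fin s → ℂ)) : rayPoint c 0 q = (q.1, c) := by
  simp [rayPoint]

theorem rayPoint_snd_sub (τ : ℝ) (q : ℂ × (Fin s → ℂ)) :
    (rayPoint c τ q).2 - c = (τ : ℂ) • (q.2 - c) := by
  simp [rayPoint]

theorem lamForm_smul (q : ℂ × (Fin s → ℂ)) (a : ℂ) (h : Fin s → ℂ) :
    lamForm ω q (a • h) = a • lamForm ω q h := by
  simp [lamForm, Finset.smul_sum, smul_smul]

theorem norm_lamForm_le (q : ℂ × (Fin s → ℂ)) (h : Fin s → ℂ) :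
    ‖lamForm ω q h‖ ≤ ‖h‖ * ∑ j, ‖ω j q‖ := by
  rw [Finset.mul_sum]
  refine (norm_sum_le _ _).trans (Finset.sum_le_sum fun j _ => ?_)
  rw [norm_smul]
  gcongr
  exact norm_le_pi_norm h j

variable {ω c} {𝔻 : Set (Fin s → ℂ)}

theorem rayPoint_mem (hstar : ∀ l ∈ 𝔻, ∀ t ∈ Icc (0 : ℝ) 1, c + (t : ℂ) • (l - c) ∈ 𝔻)
    {q : ℂ × (Fin s → ℂ)} (hq : q ∈ (univ : Set ℂ) ×ˢ 𝔻) {t : ℝ} (ht : t ∈ Icc (0 : ℝ) 1) :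
    rayPoint c t q ∈ (univ : Set ℂ) ×ˢ 𝔻 := ⟨mem_univ _, hstar q.2 hq.2 t ht⟩

theorem continuousOn_lamForm_rayPoint
    (hstar : ∀ l ∈ 𝔻, ∀ t ∈ Icc (0 : ℝ) 1, c + (t : ℂ) • (l - c) ∈ 𝔻)
    (hω : ∀ j, DifferentiableOn ℂ (ω j) (univ ×ˢ 𝔻)) :
    ContinuousOn (fun x : ℝ × (ℂ × (Fin s → ℂ)) => lamForm ω (rayPoint c x.1 x.2) (x.2.2 - c))
      (Icc 0 1 ×ˢ (univ ×ˢ 𝔻)) := by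
  refine continuousOn_finsetSum _ fun j _ => ContinuousOn.fun_smul (by fun_prop) ?_
  exact (hω j).continuousOn.comp (continuous_rayPoint c).continuousOn
    fun x hx => rayPoint_mem hstar hx.2 hx.1

theorem differentiableOn_transportTerm [CompleteSpace 𝔸] (hO : IsOpen 𝔻)
    (hstar : ∀ l ∈ 𝔻, ∀ t ∈ Icc (0 : ℝ) 1, c + (t : ℂ) • (l - c) ∈ 𝔻)
    (hω : ∀ j, DifferentiableOn ℂ (ω j) (univ ×ˢ 𝔻)) (k : ℕ) :
    DifferentiableOn ℂ (transportTerm ω c k) (univ ×ˢ 𝔻) := by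
  induction k with
  | zero => exact differentiableOn_const 1
  | succ k ih =>
    refine differentiableOn_intervalIntegral (isOpen_univ.prod hO) (fun τ hτ => ?_) ?_
    · rw [uIcc_of_le zero_le_one] at hτ
      have hmaps : MapsTo (rayPoint c τ) (univ ×ˢ 𝔻) (univ ×ˢ 𝔻) :=
        fun q hq => rayPoint_mem hstar hq hτ
      refine DifferentiableOn.fun_mul ?_
        (ih.comp (differentiable_rayPoint c τ).differentiableOn hmaps)
      refine DifferentiableOn.fun_sum fun j _ => DifferentiableOn.fun_smul (by fun_prop) ?_
      exact (hω j).comp (differentiable_rayPoint c τ).differentiableOn hmaps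
    · rw [uIcc_of_le zero_le_one]
      exact (continuousOn_lamForm_rayPoint hstar hω).mul (ih.continuousOn.comp
        (continuous_rayPoint c).continuousOn fun x hx => rayPoint_mem hstar hx.2 hx.1)

theorem continuousOn_transport_integrand {f : ℂ × (Fin s → ℂ) → 𝔸}
    (hf : ContinuousOn f (univ ×ˢ 𝔻))
    (hstar : ∀ l ∈ 𝔻, ∀ t ∈ Icc (0 : ℝ) 1, c + (t : ℂ) • (l - c) ∈ 𝔻)
    (hω : ∀ j, DifferentiableOn ℂ (ω j) (univ ×ˢ 𝔻)) {q : ℂ × (Fin s → ℂ)}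
    (hq : q ∈ (univ : Set ℂ) ×ˢ 𝔻) :
    ContinuousOn (fun τ : ℝ => lamForm ω (rayPoint c τ q) (q.2 - c) * f (rayPoint c τ q))
      (Icc 0 1) := by
  have hcr : Continuous fun τ : ℝ => rayPoint c τ q :=
    (continuous_rayPoint c).comp (by fun_prop : Continuous fun τ : ℝ => (τ, q))
  have hm : MapsTo (fun τ : ℝ => rayPoint c τ q) (Icc 0 1) (univ ×ˢ 𝔻) :=
    fun τ hτ => rayPoint_mem hstar hq hτ
  refine ContinuousOn.fun_mul (continuousOn_finsetSum _ fun j _ => ?_) ?_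
  · exact continuousOn_const.fun_smul ((hω j).continuousOn.comp hcr.continuousOn hm)
  · exact hf.comp hcr.continuousOn hm

/-- At parameter τ the distance to c has shrunk by τ, so the bound for term k gains τ^k, whose
integral supplies the factor 1/(k+1) of the factorial. -/
theorem norm_transportTerm_le
    (hstar : ∀ l ∈ 𝔻, ∀ t ∈ Icc (0 : ℝ) 1, c + (t : ℂ) • (l - c) ∈ 𝔻) {B : ℝ} (hB : 0 ≤ B)
    (k : ℕ) (q : ℂ × (Fin s → ℂ)) (hq : q ∈ (univ : Set ℂ) ×ˢ 𝔻)
    (hqB : ∀ τ ∈ Icc (0 : ℝ) 1, ∑ j, ‖ω j (rayPoint c τ q)‖ ≤ B) :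
    ‖transportTerm ω c k q‖ ≤ ‖(1 : 𝔸)‖ * ((B * ‖q.2 - c‖) ^ k / k.factorial) := by
  induction k generalizing q with
  | zero => simp [transportTerm]
  | succ k ih =>
    have hbound : ∀ τ ∈ Ioc (0 : ℝ) 1,
        ‖lamForm ω (rayPoint c τ q) (q.2 - c) * transportTerm ω c k (rayPoint c τ q)‖ ≤
          (‖(1 : 𝔸)‖ * ((B * ‖q.2 - c‖) ^ (k + 1) / k.factorial)) * τ ^ k := by
      intro τ hτ
      have hτ' : τ ∈ Icc (0 : ℝ) 1 := Ioc_subset_Icc_self hτ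
      have h1 := ih (rayPoint c τ q) (rayPoint_mem hstar hq hτ') (fun t ht => by
        rw [rayPoint_rayPoint]
        exact hqB _ ⟨mul_nonneg hτ'.1 ht.1, mul_le_one₀ hτ'.2 ht.1 ht.2⟩)
      rw [rayPoint_snd_sub, norm_smul, Complex.norm_real, Real.norm_of_nonneg hτ'.1] at h1
      have h2 : ‖lamForm ω (rayPoint c τ q) (q.2 - c)‖ ≤ ‖q.2 - c‖ * B :=
        (norm_lamForm_le ω _ _).trans (mul_le_mul_of_nonneg_left (hqB τ hτ') (norm_nonneg _))
      refine (norm_mul_le _ _).trans ((mul_le_mul h2 h1 (norm_nonneg _) (by positivity)).trans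
        (le_of_eq ?_))
      rw [show B * (τ * ‖q.2 - c‖) = (B * ‖q.2 - c‖) * τ by ring, mul_pow _ τ, pow_succ]
      ring
    have h := intervalIntegral.norm_integral_le_of_norm_le (μ := volume) zero_le_one
      (Eventually.of_forall hbound)
      ((continuous_const.mul (continuous_id.pow k)).intervalIntegrable _ _)
    refine h.trans (le_of_eq ?_)
    rw [intervalIntegral.integral_const_mul, integral_pow, Nat.factorial_succ]
    push_cast
    have : (k.factorial : ℝ) ≠ 0 := by positivity
    field_simp
    simp

theorem exists_nhds_bound (hO : IsOpen 𝔻)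
    (hstar : ∀ l ∈ 𝔻, ∀ t ∈ Icc (0 : ℝ) 1, c + (t : ℂ) • (l - c) ∈ 𝔻)
    (hω : ∀ j, DifferentiableOn ℂ (ω j) (univ ×ˢ 𝔻)) {q₀ : ℂ × (Fin s → ℂ)}
    (hq₀ : q₀ ∈ (univ : Set ℂ) ×ˢ 𝔻) :
    ∃ V ∈ 𝓝 q₀, V ⊆ univ ×ˢ 𝔻 ∧ ∃ B ρ : ℝ, 0 ≤ B ∧ 0 ≤ ρ ∧ ∀ q ∈ V, ‖q.2 - c‖ ≤ ρ ∧
      ∀ τ ∈ Icc (0 : ℝ) 1, ∑ j, ‖ω j (rayPoint c τ q)‖ ≤ B := by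
  obtain ⟨R, hR, hRU⟩ := nhds_basis_closedBall.mem_iff.1 ((isOpen_univ.prod hO).mem_nhds hq₀)
  have hK : IsCompact (closedBall q₀ R) := isCompact_closedBall _ _
  have hc1 : ContinuousOn (fun x : ℝ × (ℂ × (Fin s → ℂ)) => ∑ j, ‖ω j (rayPoint c x.1 x.2)‖)
      (Icc 0 1 ×ˢ closedBall q₀ R) :=
    continuousOn_finsetSum _ fun j _ => ((hω j).continuousOn.comp
      (continuous_rayPoint c).continuousOn fun x hx => rayPoint_mem hstar (hRU hx.2) hx.1).norm
  obtain ⟨B, hB⟩ := (isCompact_Icc.prod hK).exists_bound_of_continuousOn hc1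
  have hc2 : Continuous fun q : ℂ × (Fin s → ℂ) => q.2 - c := by fun_prop
  obtain ⟨ρ, hρ⟩ := hK.exists_bound_of_continuousOn hc2.continuousOn
  have hmem : q₀ ∈ closedBall q₀ R := mem_closedBall_self hR.le
  refine ⟨closedBall q₀ R, closedBall_mem_nhds q₀ hR, hRU, B, ρ,
    (norm_nonneg _).trans (hB (0, q₀) ⟨by simp, hmem⟩), (norm_nonneg _).trans (hρ q₀ hmem),
    fun q hq => ⟨hρ q hq, fun τ hτ => (le_abs_self _).trans (hB (τ, q) ⟨hτ, hq⟩)⟩⟩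

theorem summable_bound (N B ρ : ℝ) :
    Summable fun k : ℕ => N * ((B * ρ) ^ k / (k.factorial : ℝ)) :=
  (Real.summable_pow_div_factorial (B * ρ)).mul_left N

theorem differentiableOn_transport [CompleteSpace 𝔸] (hO : IsOpen 𝔻)
    (hstar : ∀ l ∈ 𝔻, ∀ t ∈ Icc (0 : ℝ) 1, c + (t : ℂ) • (l - c) ∈ 𝔻)
    (hω : ∀ j, DifferentiableOn ℂ (ω j) (univ ×ˢ 𝔻)) :
    DifferentiableOn ℂ (transport ω c) (univ ×ˢ 𝔻) := by
  refine differentiableOn_tsum (isOpen_univ.prod hO)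
    (differentiableOn_transportTerm hO hstar hω) fun q hq => ?_
  obtain ⟨V, hV, hVU, B, ρ, hB, hρ, h⟩ := exists_nhds_bound hO hstar hω hq
  refine ⟨V, hV, _, summable_bound ‖(1 : 𝔸)‖ B ρ, fun k y hy => ?_⟩
  refine (norm_transportTerm_le hstar hB k y (hVU hy) (h y hy).2).trans ?_
  have := (h y hy).1
  gcongr

/-- The recursion for the terms summed under the integral sign; the factorial bounds dominate. -/
theorem transport_eq_integral [CompleteSpace 𝔸] (hO : IsOpen 𝔻)
    (hstar : ∀ l ∈ 𝔻, ∀ t ∈ Icc (0 : ℝ) 1, c + (t : ℂ) • (l - c) ∈ 𝔻)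
    (hω : ∀ j, DifferentiableOn ℂ (ω j) (univ ×ˢ 𝔻)) {q : ℂ × (Fin s → ℂ)}
    (hq : q ∈ (univ : Set ℂ) ×ˢ 𝔻) :
    transport ω c q = 1 + ∫ τ in (0 : ℝ)..1,
      lamForm ω (rayPoint c τ q) (q.2 - c) * transport ω c (rayPoint c τ q) := by
  obtain ⟨V, hV, hVU, B, ρ, hB, hρ, h⟩ := exists_nhds_bound hO hstar hω hq
  have hqV := mem_of_mem_nhds hV
  have hle : ∀ k, ∀ τ ∈ Icc (0 : ℝ) 1, ‖transportTerm ω c k (rayPoint c τ q)‖ ≤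
      ‖(1 : 𝔸)‖ * ((B * ρ) ^ k / k.factorial) := by
    intro k τ hτ
    refine (norm_transportTerm_le hstar hB k _ (rayPoint_mem hstar hq hτ) fun t ht => ?_).trans ?_
    · rw [rayPoint_rayPoint]
      exact (h q hqV).2 _ ⟨mul_nonneg hτ.1 ht.1, mul_le_one₀ hτ.2 ht.1 ht.2⟩
    · have h1 : ‖(rayPoint c τ q).2 - c‖ ≤ ρ := by
        rw [rayPoint_snd_sub, norm_smul, Complex.norm_real, Real.norm_of_nonneg hτ.1]
        exact (mul_le_of_le_one_left (norm_nonneg _) hτ.2).trans (h q hqV).1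
      gcongr
  have hsummable : ∀ τ ∈ Icc (0 : ℝ) 1,
      Summable fun k => transportTerm ω c k (rayPoint c τ q) := fun τ hτ =>
    Summable.of_norm_bounded (summable_bound _ B ρ) fun k => hle k τ hτ
  have hIoc : Ι (0 : ℝ) 1 ⊆ Icc 0 1 := by
    rw [uIoc_of_le zero_le_one]; exact Ioc_subset_Icc_self
  have hintegr := intervalIntegral.hasSum_integral_of_dominated_convergence (μ := volume)
    (a := (0 : ℝ)) (b := 1)
    (F := fun k τ => lamForm ω (rayPoint c τ q) (q.2 - c) * transportTerm ω c k (rayPoint c τ q))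
    (f := fun τ => lamForm ω (rayPoint c τ q) (q.2 - c) * transport ω c (rayPoint c τ q))
    (fun k _ => ρ * B * (‖(1 : 𝔸)‖ * ((B * ρ) ^ k / (k.factorial : ℝ))))
    (fun k => by
      rw [uIoc_of_le zero_le_one]
      exact ((continuousOn_transport_integrand
        (differentiableOn_transportTerm hO hstar hω k).continuousOn hstar hω hq).mono
          Ioc_subset_Icc_self).aestronglyMeasurable measurableSet_Ioc)
    (fun k => Eventually.of_forall fun τ hτ => by
      refine (norm_mul_le _ _).trans (mul_le_mul ?_ (hle k τ (hIoc hτ)) (norm_nonneg _)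
        (by positivity))
      exact (norm_lamForm_le ω _ _).trans (mul_le_mul (h q hqV).1 ((h q hqV).2 τ (hIoc hτ))
        (Finset.sum_nonneg fun j _ => norm_nonneg _) hρ))
    (Eventually.of_forall fun τ _ => (summable_bound _ B ρ).mul_left _)
    intervalIntegrable_const
    (Eventually.of_forall fun τ hτ => (hsummable τ (hIoc hτ)).hasSum.mul_left _)
  have hs : Summable fun k => transportTerm ω c k q := by
    have := hsummable 1 (by simp)
    rwa [rayPoint_one] at this
  rw [transport, hs.tsum_eq_zero_add, ← hintegr.tsum_eq]
  rfl

theorem transport_center (z : ℂ) : transport ω c (z, c) = 1 := by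
  rw [transport, tsum_eq_single 0]
  · rfl
  · intro k hk
    obtain ⟨k, rfl⟩ := Nat.exists_eq_succ_of_ne_zero hk
    simp [transportTerm, lamForm]

/-- The transport solves the equation along rays. -/
theorem hasDerivAt_transport_ray [CompleteSpace 𝔸] (hO : IsOpen 𝔻)
    (hstar : ∀ l ∈ 𝔻, ∀ t ∈ Icc (0 : ℝ) 1, c + (t : ℂ) • (l - c) ∈ 𝔻)
    (hω : ∀ j, DifferentiableOn ℂ (ω j) (univ ×ˢ 𝔻)) {q : ℂ × (Fin s → ℂ)}
    (hq : q ∈ (univ : Set ℂ) ×ˢ 𝔻) {t : ℝ} (ht : t ∈ Icc (0 : ℝ) 1) :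
    HasDerivAt (fun t => transport ω c (rayPoint c t q))
      (lamForm ω (rayPoint c t q) (q.2 - c) * transport ω c (rayPoint c t q)) t := by
  set g : ℝ → 𝔸 := fun τ => lamForm ω (rayPoint c τ q) (q.2 - c) *
    transport ω c (rayPoint c τ q) with hg
  have hcr : Continuous fun τ : ℝ => rayPoint c τ q :=
    (continuous_rayPoint c).comp (by fun_prop : Continuous fun τ : ℝ => (τ, q))
  -- An open set of parameters containing [0,1], so that the derivative is two-sided at the end
  -- points.
  let W : Set ℝ := {t | rayPoint c t q ∈ (univ : Set ℂ) ×ˢ 𝔻}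
  have hW : IsOpen W := (isOpen_univ.prod hO).preimage hcr
  have hgc : ContinuousOn g W := by
    refine ContinuousOn.fun_mul (continuousOn_finsetSum _ fun j _ => ?_) ?_
    · exact continuousOn_const.fun_smul ((hω j).continuousOn.comp hcr.continuousOn fun τ hτ => hτ)
    · exact (differentiableOn_transport hO hstar hω).continuousOn.comp hcr.continuousOn
        fun τ hτ => hτ
  have htW : t ∈ W := rayPoint_mem hstar hq ht
  -- Substituting τ ↦ tτ turns the integral equation at the ray point of parameter t into an
  -- integral over [0, t] of a fixed function.
  have hformula : ∀ t ∈ W, transport ω c (rayPoint c t q) = 1 + ∫ τ in (0 : ℝ)..t, g τ := by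
    intro t ht
    rw [transport_eq_integral hO hstar hω ht]
    congr 1
    have h1 := intervalIntegral.smul_integral_comp_mul_left (a := 0) (b := 1) g t
    rw [mul_zero, mul_one] at h1
    rw [← h1, ← intervalIntegral.integral_smul]
    refine intervalIntegral.integral_congr fun τ _ => ?_
    simp only [hg, rayPoint_rayPoint, rayPoint_snd_sub, lamForm_smul]
    rw [smul_mul_assoc]
    exact Complex.coe_smul t _
  have hder : HasDerivAt (fun t => 1 + ∫ τ in (0 : ℝ)..t, g τ) (g t) t := by
    refine (intervalIntegral.integral_hasDerivAt_right ?_ ?_ ?_).const_add 1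
    · refine (hgc.mono ?_).intervalIntegrable
      rw [uIcc_of_le ht.1]
      exact fun τ hτ => rayPoint_mem hstar hq ⟨hτ.1, hτ.2.trans ht.2⟩
    · exact hgc.stronglyMeasurableAtFilter hW t htW
    · exact hgc.continuousAt (hW.mem_nhds htW)
  refine hder.congr_of_eventuallyEq ?_
  filter_upwards [hW.mem_nhds htW] with t ht using hformula t ht

end Transport

/-! ### The defect dX - ΩX of a partial solution. -/

section Defect

variable {E : Type*} [NormedAddCommGroup E] [NormedSpace ℂ E] [FiniteDimensional ℂ E]
  {𝔸 : Type*} [NormedRing 𝔸] [NormedAlgebra ℂ 𝔸] [CompleteSpace 𝔸]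

/-- If `dX = Ω X` holds along a vector field `ξ` with constant derivative `P` and `Ω` is
integrable, then the defect `dX - Ω X` satisfies a linear equation along `ξ`. -/
theorem fderiv_defect {V : Set E} (hV : IsOpen V) {X : E → 𝔸} {Ω : E → E →L[ℂ] 𝔸}
    (hX : DifferentiableOn ℂ X V) (hΩ : DifferentiableOn ℂ Ω V)
    (hintegr : ∀ q ∈ V, ∀ u v, fderiv ℂ Ω q u v - fderiv ℂ Ω q v u = Ω q u * Ω q v - Ω q v * Ω q u)
    {ξ : E → E} {P : E →L[ℂ] E} (hξ : ∀ q, HasFDerivAt ξ P q)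
    (hrad : ∀ q ∈ V, fderiv ℂ X q (ξ q) = Ω q (ξ q) * X q) {q : E} (hq : q ∈ V) (u : E) :
    fderiv ℂ (fun q => fderiv ℂ X q u - Ω q u * X q) q (ξ q) =
      Ω q (ξ q) * (fderiv ℂ X q u - Ω q u * X q)
        - (fderiv ℂ X q (P u) - Ω q (P u) * X q) := by
  have hVq := hV.mem_nhds hq
  have h2 : HasFDerivAt (fderiv ℂ X) (fderiv ℂ (fderiv ℂ X) q) q :=
    ((differentiableOn_fderiv hV hX).differentiableAt hVq).hasFDerivAt
  have hX' := (hX.differentiableAt hVq).hasFDerivAt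
  have hΩ' := (hΩ.differentiableAt hVq).hasFDerivAt
  have hsymm := second_derivative_symmetric_of_eventually (𝕜 := ℂ) (f := X) (f' := fderiv ℂ X)
    (x := q) (by
      filter_upwards [hVq] with y hy
      exact (hX.differentiableAt (hV.mem_nhds hy)).hasFDerivAt) h2 u (ξ q)
  have hrad' : (fun q => fderiv ℂ X q (ξ q)) =ᶠ[𝓝 q] fun q => Ω q (ξ q) * X q := by
    filter_upwards [hVq] with y hy using hrad y hy
  -- Three ingredients: e1 differentiates the equation along ξ in the direction u, e2 differentiates
  -- the defect along ξ, and e3 is integrability. Symmetry of the second derivative joins them.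
  have e1 := congrArg (fun L => L u) ((h2.clm_apply (hξ q)).congr_of_eventuallyEq
    hrad'.symm |>.unique ((hΩ'.clm_apply (hξ q)).mul' hX'))
  have e2 := congrArg (fun L => L (ξ q)) ((h2.clm_apply (hasFDerivAt_const u q)).sub
    ((hΩ'.clm_apply (hasFDerivAt_const u q)).mul' hX')).fderiv
  have e3 := hintegr q hq u (ξ q)
  simp only [_root_.add_apply, ContinuousLinearMap.comp_apply,
    ContinuousLinearMap.flip_apply, _root_.smul_apply, _root_.sub_apply,
    _root_.zero_apply, map_zero, smul_eq_mul, op_smul_eq_mul, zero_add] at e1 e2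
  refine e2.trans ?_
  rw [hrad q hq, ← hsymm]
  have e4 : fderiv ℂ (fderiv ℂ X) q u (ξ q) = Ω q (ξ q) * fderiv ℂ X q u +
      (Ω q (P u) + fderiv ℂ Ω q u (ξ q)) * X q - fderiv ℂ X q (P u) := by
    rw [← e1]; abel
  have e5 : fderiv ℂ Ω q u (ξ q) = Ω q u * Ω q (ξ q) - Ω q (ξ q) * Ω q u
      + fderiv ℂ Ω q (ξ q) u := by
    rw [← e3]; abel
  rw [e4, e5]
  noncomm_ring

end Defect

/-! ### The full differential of the transport. -/

section TransportForm

variable {s : ℕ} {𝔸 : Type*} [NormedRing 𝔸] [NormedAlgebra ℂ 𝔸]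

/-- The form `a dz + ∑ b_j dλ_j`. -/
noncomputable def formCLM (a : 𝔸) (b : Fin s → 𝔸) : (ℂ × (Fin s → ℂ)) →L[ℂ] 𝔸 :=
  (ContinuousLinearMap.fst ℂ ℂ (Fin s → ℂ)).smulRight a +
    ∑ j, ((ContinuousLinearMap.proj (R := ℂ) (φ := fun _ : Fin s => ℂ) j).comp
      (ContinuousLinearMap.snd ℂ ℂ (Fin s → ℂ))).smulRight (b j)

theorem formCLM_apply (a : 𝔸) (b : Fin s → 𝔸) (v : ℂ × (Fin s → ℂ)) :
    formCLM a b v = v.1 • a + ∑ j, v.2 j • b j := by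
  simp [formCLM]

theorem differentiableOn_formCLM {a : ℂ × (Fin s → ℂ) → 𝔸} {ω : Fin s → ℂ × (Fin s → ℂ) → 𝔸}
    {V : Set (ℂ × (Fin s → ℂ))} (ha : DifferentiableOn ℂ a V)
    (hω : ∀ j, DifferentiableOn ℂ (ω j) V) :
    DifferentiableOn ℂ (fun q => formCLM (a q) fun j => ω j q) V := by
  refine DifferentiableOn.fun_add ?_ (DifferentiableOn.fun_sum fun j _ => ?_)
  · exact (ContinuousLinearMap.smulRightL ℂ (ℂ × (Fin s → ℂ)) 𝔸
      (ContinuousLinearMap.fst ℂ ℂ (Fin s → ℂ))).differentiable.comp_differentiableOn ha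
  · exact (ContinuousLinearMap.smulRightL ℂ (ℂ × (Fin s → ℂ)) 𝔸
      ((ContinuousLinearMap.proj (R := ℂ) (φ := fun _ : Fin s => ℂ) j).comp
      (ContinuousLinearMap.snd ℂ ℂ (Fin s → ℂ)))).differentiable.comp_differentiableOn (hω j)

theorem formCLM_snd (a : 𝔸) (ω : Fin s → ℂ × (Fin s → ℂ) → 𝔸) (q : ℂ × (Fin s → ℂ))
    (h : Fin s → ℂ) : formCLM a (fun j => ω j q) (0, h) = lamForm ω q h := by
  simp [formCLM_apply, lamForm]

theorem hasDerivAt_rayPoint (c : Fin s → ℂ) (q : ℂ × (Fin s → ℂ)) (t : ℝ) :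
    HasDerivAt (fun t : ℝ => rayPoint c t q) (0, q.2 - c) t := by
  refine (hasDerivAt_const t q.1).prodMk ?_
  have := ((Complex.ofRealCLM.hasDerivAt (x := t)).smul_const (q.2 - c)).const_add c
  simpa using this

variable {a : ℂ × (Fin s → ℂ) → 𝔸} {ω : Fin s → ℂ × (Fin s → ℂ) → 𝔸}
  {c : Fin s → ℂ} {𝔻 : Set (Fin s → ℂ)}

theorem hasDerivAt_comp_rayPoint {f : ℂ × (Fin s → ℂ) → 𝔸} {q : ℂ × (Fin s → ℂ)} {t : ℝ}
    (hf : DifferentiableAt ℂ f (rayPoint c t q)) :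
    HasDerivAt (fun t : ℝ => f (rayPoint c t q)) (fderiv ℂ f (rayPoint c t q) (0, q.2 - c)) t :=
  HasFDerivAt.comp_hasDerivAt (l := f) (f := fun t : ℝ => rayPoint c t q) t
    (hf.hasFDerivAt.restrictScalars ℝ) (hasDerivAt_rayPoint c q t)

theorem fderiv_transport_radial [CompleteSpace 𝔸] (hO : IsOpen 𝔻)
    (hstar : ∀ l ∈ 𝔻, ∀ t ∈ Icc (0 : ℝ) 1, c + (t : ℂ) • (l - c) ∈ 𝔻)
    (hω : ∀ j, DifferentiableOn ℂ (ω j) (univ ×ˢ 𝔻)) {q : ℂ × (Fin s → ℂ)}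
    (hq : q ∈ (univ : Set ℂ) ×ˢ 𝔻) :
    fderiv ℂ (transport ω c) q (0, q.2 - c) = lamForm ω q (q.2 - c) * transport ω c q := by
  have h1 := hasDerivAt_transport_ray hO hstar hω hq (t := 1) (by simp)
  have hd : DifferentiableAt ℂ (transport ω c) (rayPoint c 1 q) := by
    rw [rayPoint_one]
    exact (differentiableOn_transport hO hstar hω).differentiableAt
      ((isOpen_univ.prod hO).mem_nhds hq)
  have h2 := (hasDerivAt_comp_rayPoint hd).unique h1
  rwa [rayPoint_one] at h2

theorem continuousOn_lamForm_ray
    (hstar : ∀ l ∈ 𝔻, ∀ t ∈ Icc (0 : ℝ) 1, c + (t : ℂ) • (l - c) ∈ 𝔻)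
    (hω : ∀ j, DifferentiableOn ℂ (ω j) (univ ×ˢ 𝔻)) {q : ℂ × (Fin s → ℂ)}
    (hq : q ∈ (univ : Set ℂ) ×ˢ 𝔻) (h : Fin s → ℂ) :
    ContinuousOn (fun t : ℝ => lamForm ω (rayPoint c t q) h) (Icc 0 1) := by
  have hcr : Continuous fun τ : ℝ => rayPoint c τ q :=
    (continuous_rayPoint c).comp (by fun_prop : Continuous fun τ : ℝ => (τ, q))
  exact continuousOn_finsetSum _ fun j _ => continuousOn_const.fun_smul
    ((hω j).continuousOn.comp hcr.continuousOn fun τ hτ => rayPoint_mem hstar hq hτ)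

/-- The hypotheses of the transport theorem: `a dz + ∑ ω_j dλ_j` is integrable for `z ≠ 0`,
and the `ω_j` are holomorphic on `ℂ × 𝔻`, with `𝔻` star-shaped about `c`. -/
structure TransportHyp (𝔻 : Set (Fin s → ℂ)) (c : Fin s → ℂ) (a : ℂ × (Fin s → ℂ) → 𝔸)
    (ω : Fin s → ℂ × (Fin s → ℂ) → 𝔸) : Prop where
  isOpen : IsOpen 𝔻
  star : ∀ l ∈ 𝔻, ∀ t ∈ Icc (0 : ℝ) 1, c + (t : ℂ) • (l - c) ∈ 𝔻
  differentiable : ∀ j, DifferentiableOn ℂ (ω j) (univ ×ˢ 𝔻)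
  differentiable_fst : DifferentiableOn ℂ a ({z : ℂ | z ≠ 0} ×ˢ 𝔻)
  integrable : ∀ q ∈ {z : ℂ | z ≠ 0} ×ˢ 𝔻, ∀ u v : ℂ × (Fin s → ℂ),
    fderiv ℂ (fun q' => v.1 • a q' + ∑ j, v.2 j • ω j q') q u
      - fderiv ℂ (fun q' => u.1 • a q' + ∑ j, u.2 j • ω j q') q v
    = (u.1 • a q + ∑ j, u.2 j • ω j q) * (v.1 • a q + ∑ j, v.2 j • ω j q)
      - (v.1 • a q + ∑ j, v.2 j • ω j q) * (u.1 • a q + ∑ j, u.2 j • ω j q)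

namespace TransportHyp

theorem isOpen_dom (H : TransportHyp 𝔻 c a ω) : IsOpen ({z : ℂ | z ≠ 0} ×ˢ 𝔻) :=
  isOpen_ne_zero_prod H.isOpen

theorem subset_dom : ({z : ℂ | z ≠ 0} ×ˢ 𝔻) ⊆ (univ : Set ℂ) ×ˢ 𝔻 :=
  prod_mono (subset_univ _) subset_rfl

theorem differentiableOn_form (H : TransportHyp 𝔻 c a ω) :
    DifferentiableOn ℂ (fun q => formCLM (a q) fun j => ω j q) ({z : ℂ | z ≠ 0} ×ˢ 𝔻) :=
  differentiableOn_formCLM H.differentiable_fst fun j => (H.differentiable j).mono subset_dom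

theorem integrable_form (H : TransportHyp 𝔻 c a ω) {q : ℂ × (Fin s → ℂ)}
    (hq : q ∈ {z : ℂ | z ≠ 0} ×ˢ 𝔻) (u v : ℂ × (Fin s → ℂ)) :
    fderiv ℂ (fun q => formCLM (a q) fun j => ω j q) q u v
      - fderiv ℂ (fun q => formCLM (a q) fun j => ω j q) q v u
    = formCLM (a q) (fun j => ω j q) u * formCLM (a q) (fun j => ω j q) v
      - formCLM (a q) (fun j => ω j q) v * formCLM (a q) (fun j => ω j q) u := by
  have hd := (H.differentiableOn_form.differentiableAt (H.isOpen_dom.mem_nhds hq)).hasFDerivAt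
  have h : ∀ u v : ℂ × (Fin s → ℂ), fderiv ℂ (fun q => formCLM (a q) fun j => ω j q) q u v =
      fderiv ℂ (fun q' => v.1 • a q' + ∑ j, v.2 j • ω j q') q u := by
    intro u v
    have h1 := hd.clm_apply (hasFDerivAt_const v q)
    simp only [formCLM_apply] at h1
    rw [h1.fderiv]
    simp
  rw [h, h, H.integrable q hq u v]
  simp only [formCLM_apply]

variable [CompleteSpace 𝔸]

theorem differentiableOn_transport (H : TransportHyp 𝔻 c a ω) :
    DifferentiableOn ℂ (transport ω c) (univ ×ˢ 𝔻) :=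
  Isomonodromy.differentiableOn_transport H.isOpen H.star H.differentiable

theorem differentiableOn_defect (H : TransportHyp 𝔻 c a ω) (u : ℂ × (Fin s → ℂ)) :
    DifferentiableOn ℂ (fun q => fderiv ℂ (transport ω c) q u
      - formCLM (a q) (fun j => ω j q) u * transport ω c q) ({z : ℂ | z ≠ 0} ×ˢ 𝔻) := by
  have hX := H.differentiableOn_transport.mono subset_dom
  refine (differentiableOn_fderiv_apply H.isOpen_dom hX u).fun_sub (DifferentiableOn.fun_mul ?_ hX)
  exact H.differentiableOn_form.clm_apply (differentiableOn_const u)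

/-- By construction the equation holds only in the radial direction ξ = λ - c. The defect δ in
another λ-direction satisfies dδ(ξ) = ω(ξ) δ - δ, and this forces it to vanish. -/
theorem fderiv_transport_snd (H : TransportHyp 𝔻 c a ω) {q : ℂ × (Fin s → ℂ)}
    (hq : q ∈ {z : ℂ | z ≠ 0} ×ˢ 𝔻) (h : Fin s → ℂ) :
    fderiv ℂ (transport ω c) q (0, h) = lamForm ω q h * transport ω c q := by
  let ξ : ℂ × (Fin s → ℂ) → ℂ × (Fin s → ℂ) := fun q => (0, q.2 - c)
  let P : (ℂ × (Fin s → ℂ)) →L[ℂ] ℂ × (Fin s → ℂ) :=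
    (ContinuousLinearMap.inr ℂ ℂ (Fin s → ℂ)).comp (ContinuousLinearMap.snd ℂ ℂ (Fin s → ℂ))
  have hξ : ∀ q, HasFDerivAt ξ P q := fun q =>
    ((ContinuousLinearMap.inr ℂ ℂ (Fin s → ℂ)).hasFDerivAt).comp q
      ((ContinuousLinearMap.snd ℂ ℂ (Fin s → ℂ)).hasFDerivAt.sub_const c)
  let δ : ℂ × (Fin s → ℂ) → 𝔸 := fun q => fderiv ℂ (transport ω c) q (0, h)
      - formCLM (a q) (fun j => ω j q) (0, h) * transport ω c q
  have hδ : ∀ q ∈ {z : ℂ | z ≠ 0} ×ˢ 𝔻, fderiv ℂ δ q (ξ q) =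
      lamForm ω q (q.2 - c) * δ q - δ q := by
    intro q hq
    have := fderiv_defect H.isOpen_dom (H.differentiableOn_transport.mono subset_dom)
      H.differentiableOn_form (fun q hq => H.integrable_form hq) hξ (fun q hq => by
        rw [formCLM_snd]
        exact fderiv_transport_radial H.isOpen H.star H.differentiable (subset_dom hq)) hq (0, h)
    rw [formCLM_snd] at this
    exact this
  have hmem : ∀ t ∈ Icc (0 : ℝ) 1, rayPoint c t q ∈ {z : ℂ | z ≠ 0} ×ˢ 𝔻 :=
    fun t ht => ⟨hq.1, H.star q.2 hq.2 t ht⟩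
  -- The factor t cancels the extra -δ: t δ solves a homogeneous linear equation along the ray and
  -- vanishes at t = 0.
  have hder : ∀ t ∈ Icc (0 : ℝ) 1, HasDerivAt (fun t : ℝ => t • δ (rayPoint c t q))
      (lamForm ω (rayPoint c t q) (q.2 - c) * (t • δ (rayPoint c t q))
        + (t • δ (rayPoint c t q)) * 0) t := by
    intro t ht
    have h1 : DifferentiableAt ℂ δ (rayPoint c t q) :=
      (H.differentiableOn_defect (0, h)).differentiableAt (H.isOpen_dom.mem_nhds (hmem t ht))
    refine ((hasDerivAt_id t).smul (hasDerivAt_comp_rayPoint h1)).congr_deriv ?_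
    have h2 := hδ _ (hmem t ht)
    have h3 : ξ (rayPoint c t q) = (t : ℂ) • ((0, q.2 - c) : ℂ × (Fin s → ℂ)) := by
      simp [ξ, rayPoint_snd_sub]
    rw [h3, map_smul, rayPoint_snd_sub, lamForm_smul, smul_mul_assoc] at h2
    simp only [id_eq, one_smul, mul_zero, add_zero]
    rw [← Complex.coe_smul t, h2, ← Complex.coe_smul t, mul_smul_comm]
    abel
  have := eq_zero_of_linear_ode (continuousOn_lamForm_ray H.star H.differentiable
    (subset_dom hq) (q.2 - c)) continuousOn_const hder (by simp) 1 (by simp)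
  rw [one_smul, rayPoint_one] at this
  have h4 := sub_eq_zero.1 this
  rwa [formCLM_snd] at h4

/-- The transport intertwines the form with its restriction to `λ = c`. -/
theorem fderiv_transport (H : TransportHyp 𝔻 c a ω) {q : ℂ × (Fin s → ℂ)}
    (hq : q ∈ {z : ℂ | z ≠ 0} ×ˢ 𝔻) (v : ℂ × (Fin s → ℂ)) :
    fderiv ℂ (transport ω c) q v = (v.1 • a q + ∑ j, v.2 j • ω j q) * transport ω c q
      - v.1 • (transport ω c q * a (q.1, c)) := by
  obtain ⟨v₁, v₂⟩ := v
  have hX := H.differentiableOn_transport.mono (subset_dom (𝔻 := 𝔻))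
  let δ : ℂ × (Fin s → ℂ) → 𝔸 := fun q => fderiv ℂ (transport ω c) q (v₁, 0)
      - formCLM (a q) (fun j => ω j q) (v₁, 0) * transport ω c q
  let η : ℂ × (Fin s → ℂ) := (0, q.2 - c)
  -- All λ-directions are now known, so the field may be the constant η, tangent to the ray; its
  -- derivative P is 0 and no extra term appears.
  have hδ : ∀ q' ∈ {z : ℂ | z ≠ 0} ×ˢ 𝔻, fderiv ℂ δ q' η = lamForm ω q' (q.2 - c) * δ q' := by
    intro q' hq'
    have := fderiv_defect H.isOpen_dom hX H.differentiableOn_form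
      (fun q hq => H.integrable_form hq) (ξ := fun _ => η) (P := 0)
      (fun q => hasFDerivAt_const η q) (fun q hq => by
        rw [formCLM_snd]
        exact H.fderiv_transport_snd hq _) hq' (v₁, 0)
    rw [formCLM_snd] at this
    simpa using this
  have hmem : ∀ t ∈ Icc (0 : ℝ) 1, rayPoint c t q ∈ {z : ℂ | z ≠ 0} ×ˢ 𝔻 :=
    fun t ht => ⟨hq.1, H.star q.2 hq.2 t ht⟩
  -- Both summands solve the same linear equation along the ray. At t = 0 the transport is 1 for
  -- every z, so its z-derivative is 0 and the summands cancel.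
  let f : ℝ → 𝔸 := fun t => δ (rayPoint c t q)
    + v₁ • (transport ω c (rayPoint c t q) * a (q.1, c))
  have hder : ∀ t ∈ Icc (0 : ℝ) 1, HasDerivAt f
      (lamForm ω (rayPoint c t q) (q.2 - c) * f t + f t * 0) t := by
    intro t ht
    have h1 : DifferentiableAt ℂ δ (rayPoint c t q) :=
      (H.differentiableOn_defect (v₁, 0)).differentiableAt (H.isOpen_dom.mem_nhds (hmem t ht))
    have h2 := hasDerivAt_transport_ray H.isOpen H.star H.differentiable (subset_dom hq) ht
    refine ((hasDerivAt_comp_rayPoint h1).add ((h2.mul_const _).const_smul v₁)).congr_deriv ?_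
    rw [hδ _ (hmem t ht)]
    simp only [f]
    rw [mul_zero, add_zero, mul_add, mul_smul_comm, mul_assoc]
  have hcz : ((q.1, c) : ℂ × (Fin s → ℂ)) ∈ {z : ℂ | z ≠ 0} ×ˢ 𝔻 := by
    have := hmem 0 (by simp)
    rwa [rayPoint_zero] at this
  have hf0 : f 0 = 0 := by
    simp only [f, δ, rayPoint_zero, transport_center, one_mul, mul_one, formCLM_apply]
    have hd := (hX.differentiableAt (H.isOpen_dom.mem_nhds hcz)).hasFDerivAt
    have h1 := hd.comp_hasDerivAt q.1 ((hasDerivAt_id q.1).prodMk (hasDerivAt_const q.1 c))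
    have h2 : HasDerivAt (fun z : ℂ => transport ω c (z, c)) 0 q.1 := by
      simp only [transport_center]
      exact hasDerivAt_const _ _
    have h3 : fderiv ℂ (transport ω c) (q.1, c) (1, 0) = 0 := h1.unique h2
    have h4 : ((v₁, 0) : ℂ × (Fin s → ℂ)) = v₁ • (1, 0) := by simp
    rw [h4, map_smul, h3]
    simp
  have h5 := eq_zero_of_linear_ode (continuousOn_lamForm_ray H.star H.differentiable
    (subset_dom hq) (q.2 - c)) continuousOn_const hder hf0 1 (by simp)
  simp only [f, δ, rayPoint_one, formCLM_apply] at h5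
  have h6 := H.fderiv_transport_snd hq v₂
  have h7 : ((v₁, v₂) : ℂ × (Fin s → ℂ)) = (v₁, 0) + (0, v₂) := by simp
  rw [h7, map_add, h6]
  simp only [Pi.zero_apply, zero_smul, Finset.sum_const_zero, add_zero, Prod.fst_add,
    Prod.snd_add, zero_add] at h5 ⊢
  have h8 := eq_neg_of_add_eq_zero_left h5
  rw [sub_eq_iff_eq_add] at h8
  rw [h8, lamForm, add_mul]
  abel

end TransportHyp

end TransportForm

theorem star_polydisc {s : ℕ} (c : Fin s → ℂ) (r : Fin s → ℝ) :
    ∀ l ∈ polydisc c r, ∀ t ∈ Icc (0 : ℝ) 1, c + (t : ℂ) • (l - c) ∈ polydisc c r := by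
  intro l hl t ht j
  have h1 : (c + (t : ℂ) • (l - c)) j - c j = t * (l j - c j) := by simp
  rw [h1, norm_mul, Complex.norm_real, Real.norm_of_nonneg ht.1]
  exact (mul_le_of_le_one_left (norm_nonneg _) ht.2).trans_lt (hl j)

theorem exists_hasSum_of_entire {n : ℕ} {f : ℂ → Mat n} (hf : Differentiable ℂ f) :
    ∃ F : ℕ → Mat n, F 0 = f 0 ∧ ∀ z : ℂ, HasSum (fun k : ℕ => z ^ k • F k) (f z) := by
  refine ⟨fun k => (k.factorial : ℂ)⁻¹ • iteratedDeriv k f 0, by simp, fun z => ?_⟩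
  have h := Complex.hasSum_taylorSeries_of_entire hf 0 z
  simp only [sub_zero] at h
  have e : ∀ k : ℕ, z ^ k • (k.factorial : ℂ)⁻¹ • iteratedDeriv k f 0 =
      (k.factorial : ℂ)⁻¹ • z ^ k • iteratedDeriv k f 0 := fun k => by
    rw [smul_smul, smul_smul, mul_comm]
  simp only [e]
  exact h

theorem fderiv_mul_comp_exp {s : ℕ} {𝔸 : Type*} [NormedRing 𝔸] [NormedAlgebra ℂ 𝔸]
    {U : ℂ × (Fin s → ℂ) → 𝔸} {Z : ℂ → 𝔸} {Z' : 𝔸} {w : ℂ} {l : Fin s → ℂ}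
    (hU : DifferentiableAt ℂ U (Complex.exp w, l)) (hZ : HasDerivAt Z Z' w)
    (v : ℂ × (Fin s → ℂ)) :
    fderiv ℂ (fun q : ℂ × (Fin s → ℂ) => U (Complex.exp q.1, q.2) * Z q.1) (w, l) v =
      fderiv ℂ U (Complex.exp w, l) (Complex.exp w * v.1, v.2) * Z w
        + U (Complex.exp w, l) * v.1 • Z' := by
  have h1 : HasFDerivAt (fun q : ℂ × (Fin s → ℂ) => q.1)
      (ContinuousLinearMap.fst ℂ ℂ (Fin s → ℂ)) (w, l) := hasFDerivAt_fst
  have h2 : HasFDerivAt (fun q : ℂ × (Fin s → ℂ) => q.2)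
      (ContinuousLinearMap.snd ℂ ℂ (Fin s → ℂ)) (w, l) := hasFDerivAt_snd
  have h := (HasFDerivAt.comp (g := U) (w, l) hU.hasFDerivAt (h1.cexp.prodMk h2)).mul'
    (HasFDerivAt.comp (g := Z) (w, l) hZ.hasFDerivAt h1)
  refine (congrArg (fun L => L v) h.fderiv).trans ?_
  simp [add_comm]

/-! ### From an integrable system holomorphic at z = 0 to a Levelt solution. -/

section Construction

variable {s : ℕ} {p : Fin s → ℕ} {c : Fin s → ℂ} {r : Fin s → ℝ}
  {A : (Fin s → ℂ) → Mat (∑ j, p j)} {ω : Fin s → ℂ × (Fin s → ℂ) → Mat (∑ j, p j)}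

theorem transportHyp (hA : HolomorphicMatOn A (polydisc c r))
    (hω : IsIntegrablePfaffian (polydisc c r) A ω) (hω0 : HolomorphicAtZero (polydisc c r) ω) :
    TransportHyp (polydisc c r) c (fun q => coeff A q.1 q.2) ω where
  isOpen := isOpen_polydisc c r
  star := star_polydisc c r
  differentiable := fun j => holomorphicMatOn_iff.1 (hω0 j)
  differentiable_fst := differentiableOn_coeff hA
  integrable := (integrable_iff (isOpen_polydisc c r) hA hω.holomorphic).1 hω

/-- The ray is run backwards, so that the end point of the equation is the centre, where the
transport is 1. -/
theorem isUnit_transport {n : ℕ} {𝔻 : Set (Fin s → ℂ)} {a : ℂ × (Fin s → ℂ) → Mat n}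
    {ω : Fin s → ℂ × (Fin s → ℂ) → Mat n}
    (H : TransportHyp 𝔻 c a ω) {q : ℂ × (Fin s → ℂ)} (hq : q ∈ (univ : Set ℂ) ×ˢ 𝔻) :
    IsUnit (transport ω c q) := by
  have hm : ∀ t ∈ Icc (0 : ℝ) 1, 1 - t ∈ Icc (0 : ℝ) 1 := fun t ht =>
    ⟨sub_nonneg.2 ht.2, sub_le_self _ ht.1⟩
  have hc := continuousOn_lamForm_ray H.star H.differentiable hq (q.2 - c)
  have h := isUnit_of_linear_ode (X := fun t => transport ω c (rayPoint c (1 - t) q))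
    (B := fun t => -lamForm ω (rayPoint c (1 - t) q) (q.2 - c))
    (ContinuousOn.neg (ContinuousOn.comp (f := fun t : ℝ => 1 - t) hc (by fun_prop) hm))
    (fun t ht => by
      have h1 := hasDerivAt_transport_ray H.isOpen H.star H.differentiable hq (hm t ht)
      refine (h1.scomp t ((hasDerivAt_id t).const_sub 1)).congr_deriv ?_
      rw [neg_smul, one_smul, neg_mul])
    (by rw [sub_self, rayPoint_zero, transport_center]; exact isUnit_one)
  rwa [sub_zero, rayPoint_one] at h

theorem smul_coeff {z : ℂ} (hz : z ≠ 0) (l : Fin s → ℂ) :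
    z • coeff A z l = z • Lam p l + A l := by
  rw [coeff, smul_add, smul_smul, mul_inv_cancel₀ hz, one_smul]

/-- At `z = 0` the transport intertwines the residue matrices. -/
theorem residue_transport (hA : HolomorphicMatOn A (polydisc c r))
    (hω : IsIntegrablePfaffian (polydisc c r) A ω) (hω0 : HolomorphicAtZero (polydisc c r) ω)
    {l : Fin s → ℂ} (hl : l ∈ polydisc c r) :
    A l * transport ω c (0, l) = transport ω c (0, l) * A c := by
  have H := transportHyp hA hω hω0
  have hU := H.differentiableOn_transport
  have hO : IsOpen ((univ : Set ℂ) ×ˢ polydisc c r) := isOpen_univ.prod (isOpen_polydisc c r)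
  have hLam := fun (g : ℂ × (Fin s → ℂ) → Fin s → ℂ) (hg : Differentiable ℂ g) =>
    (DifferentiableOn.fun_smul differentiableOn_fst
      ((differentiable_Lam p).comp hg).differentiableOn :
      DifferentiableOn ℂ (fun q : ℂ × (Fin s → ℂ) => q.1 • Lam p (g q)) (univ ×ˢ polydisc c r))
  -- The z-equation of the transport is multiplied by z to clear the pole and then evaluated at z =
  -- 0, where its left side vanishes.
  have h := eq_at_zero_of_eq (isOpen_polydisc c r)
    (f := fun q => q.1 • fderiv ℂ (transport ω c) q (1, 0))
    (g := fun q => (q.1 • Lam p q.2 + A q.2) * transport ω c q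
      - transport ω c q * (q.1 • Lam p c + A c))
    (DifferentiableOn.fun_smul differentiableOn_fst (differentiableOn_fderiv_apply hO hU _))
    (DifferentiableOn.fun_sub
      (DifferentiableOn.fun_mul (DifferentiableOn.fun_add (hLam _ differentiable_snd)
        ((holomorphicMatOn_iff.1 hA).comp differentiableOn_snd fun q hq => hq.2)) hU)
      (DifferentiableOn.fun_mul hU (DifferentiableOn.fun_add
        (hLam _ (differentiable_const c)) (differentiableOn_const _)))) hl
    (fun z hz => by
      have h1 := H.fderiv_transport (q := (z, l)) ⟨hz, hl⟩ (1, 0)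
      simp only [Pi.zero_apply, zero_smul, Finset.sum_const_zero, add_zero, one_smul] at h1
      refine (congrArg (fun M => z • M) h1).trans ?_
      rw [← smul_coeff hz l, ← smul_coeff hz c, smul_sub, smul_mul_assoc, mul_smul_comm])
  simp only [zero_smul, zero_add] at h
  exact (sub_eq_zero.1 h.symm)

/-- An integrable Pfaffian system with coefficients holomorphic at `z = 0` has an
isomonodromic solution in Levelt form. -/
theorem exists_isomonodromic_levelt (hA : HolomorphicMatOn A (polydisc c r))
    (hω : IsIntegrablePfaffian (polydisc c r) A ω) (hω0 : HolomorphicAtZero (polydisc c r) ω) :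
    ∃ Y T, IsIsomonodromicSolution (polydisc c r) A Y ∧ SolvesPfaffian (polydisc c r) A ω Y ∧
      IsLeveltFamily (polydisc c r) A T Y := by
  have H := transportHyp hA hω hω0
  have hU := H.differentiableOn_transport
  have hD := isOpen_polydisc c r
  have hO : IsOpen ((univ : Set ℂ) ×ˢ polydisc c r) := isOpen_univ.prod hD
  obtain ⟨T, Z, hT, hZ, hZu⟩ := exists_leveltForm (A c) (Lam p c)
  have hZd : Differentiable ℂ Z := fun w => (hZ w).differentiableAt
  let π : ℂ × (Fin s → ℂ) → ℂ × (Fin s → ℂ) := fun q => (Complex.exp q.1, q.2)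
  have hπ : Differentiable ℂ π := by fun_prop
  let Y : ℂ × (Fin s → ℂ) → Mat (∑ j, p j) := fun q => transport ω c (π q) * Z q.1
  have hYd : DifferentiableOn ℂ Y (univ ×ˢ polydisc c r) :=
    DifferentiableOn.fun_mul (hU.comp hπ.differentiableOn fun q hq => ⟨mem_univ _, hq.2⟩)
      (hZd.comp differentiable_fst).differentiableOn
  have hYhol : HolomorphicMatOn Y (univ ×ˢ polydisc c r) := holomorphicMatOn_iff.2 hYd
  have hYu : ∀ l ∈ polydisc c r, ∀ w, IsUnit (Y (w, l)) := fun l hl w =>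
    (isUnit_transport H (q := (Complex.exp w, l)) ⟨mem_univ _, hl⟩).mul (hZu w)
  have hsol' : ∀ w, ∀ l ∈ polydisc c r, ∀ v : ℂ × (Fin s → ℂ), fderiv ℂ Y (w, l) v =
      pfaffianForm A ω (Complex.exp w, l) (Complex.exp w * v.1, v.2) * Y (w, l) := by
    intro w l hl v
    refine (fderiv_mul_comp_exp (hU.differentiableAt (hO.mem_nhds ⟨mem_univ _, hl⟩)) (hZ w)
      v).trans ?_
    -- The correction term -U (Λ(c) + A(c)/z) cancels the contribution U Z' of the second factor.
    have h2 := H.fderiv_transport (q := (Complex.exp w, l)) ⟨Complex.exp_ne_zero w, hl⟩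
      (Complex.exp w * v.1, v.2)
    rw [h2, ← smul_coeff (Complex.exp_ne_zero w) c]
    simp only [Y, π, pfaffianForm, sub_mul, mul_smul_comm, smul_mul_assoc, smul_smul, mul_assoc]
    rw [mul_comm v.1, sub_add_cancel]
  have hsol : SolvesPfaffian (polydisc c r) A ω Y := (solvesPfaffian_iff hD hYhol).2 hsol'
  have hfund : IsFundamentalSolution (polydisc c r) A Y := by
    refine ⟨fun l hl w => hasDerivAt_matrix_iff.1 (?_ : HasDerivAt (fun w' => Y (w', l))
      (Complex.exp w • (coeff A (Complex.exp w) l * Y (w, l))) w), hYu⟩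
    refine ((differentiableAt_solution hD hYhol hl).hasFDerivAt.comp_hasDerivAt w
      ((hasDerivAt_id w).prodMk (hasDerivAt_const w l))).congr_deriv ?_
    refine (hsol' w l hl (1, 0)).trans ?_
    simp [pfaffianForm]
  have hUl : ∀ l ∈ polydisc c r, Differentiable ℂ fun z => transport ω c (z, l) := fun l hl z =>
    DifferentiableAt.comp (f := fun z : ℂ => (z, l)) z
      (hU.differentiableAt (hO.mem_nhds ⟨mem_univ _, hl⟩)) (by fun_prop)
  have hYhat : ∀ l ∈ polydisc c r, ∃ F : ℕ → Mat (∑ j, p j), F 0 = 1 ∧ ∀ z : ℂ,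
      HasSum (fun k : ℕ => z ^ k • F k)
        ((transport ω c (0, l) * T.G)⁻¹ * (transport ω c (z, l) * (T.G * T.Yhat z))) := by
    intro l hl
    have hd : Differentiable ℂ fun z =>
        (transport ω c (0, l) * T.G)⁻¹ * (transport ω c (z, l) * (T.G * T.Yhat z)) :=
      Differentiable.const_mul (Differentiable.fun_mul (hUl l hl)
        (hT.differentiable_Yhat.const_mul T.G)) _
    obtain ⟨F, hF0, hF⟩ := exists_hasSum_of_entire hd
    refine ⟨F, hF0.trans ?_, hF⟩
    rw [hT.Yhat_zero, mul_one]
    exact Matrix.nonsing_inv_mul _ ((Matrix.isUnit_iff_isUnit_det _).1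
      ((isUnit_transport H ⟨mem_univ _, hl⟩).mul hT.invertible))
  choose! F hF0 hF using hYhat
  -- G = U(0, λ) G_c, and Ŷ = G⁻¹ U G_c Ŷ_c is entire in z with value 1 at 0. The exponents are
  -- those at the centre.
  refine ⟨Y, fun l => ⟨transport ω c (0, l) * T.G, F l, fun z =>
    (transport ω c (0, l) * T.G)⁻¹ * (transport ω c (z, l) * (T.G * T.Yhat z)), T.d, T.S, T.R⟩,
    ⟨hfund, hYhol, NormedSpace.exp ((2 * Real.pi * Complex.I : ℂ) • T.L), fun l hl w => ?_⟩, hsol,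
    fun l hl => ?_⟩
  · simp only [Y, π]
    rw [hT.monodromy, exp_add_two_pi_I, ← mul_assoc]
  · have hG := (isUnit_transport H (q := (0, l)) ⟨mem_univ _, hl⟩).mul hT.invertible
    have hGdet := (Matrix.isUnit_iff_isUnit_det _).1 hG
    refine ⟨hT.jordan, hG, ?_, hT.re_nonneg, hT.re_lt_one, hT.nilpotent, hT.resonant, hF0 l hl,
      hF l hl, fun w => ?_⟩
    · refine Eq.trans ?_ hT.similar
      have e : A l * (transport ω c (0, l) * T.G) = transport ω c (0, l) * T.G *
          (T.G⁻¹ * A c * T.G) := by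
        rw [← mul_assoc, residue_transport hA hω hω0 hl, mul_assoc T.G⁻¹, ← mul_assoc _ T.G⁻¹,
          Matrix.mul_nonsing_inv_cancel_right _ _
            ((Matrix.isUnit_iff_isUnit_det _).1 hT.invertible), mul_assoc]
      rw [mul_assoc]
      simp only [e]
      exact Matrix.nonsing_inv_mul_cancel_left _ _ hGdet
    · simp only [Y, π]
      rw [hT.form, Matrix.mul_nonsing_inv_cancel_left _ _ hGdet]
      simp only [mul_assoc]
      rfl

end Construction

/-- The values of ω_j at z = 0 are arbitrary, so a holomorphic extension may differ from ω there;
integrability does not see this, being a condition on the open set z ≠ 0. -/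
theorem IsIntegrablePfaffian.congr {s : ℕ} {p : Fin s → ℕ} {𝔻 : Set (Fin s → ℂ)}
    {A : (Fin s → ℂ) → Mat (∑ j, p j)} {ω ω' : Fin s → ℂ × (Fin s → ℂ) → Mat (∑ j, p j)}
    (hO : IsOpen 𝔻) (hA : HolomorphicMatOn A 𝔻) (hω : IsIntegrablePfaffian 𝔻 A ω)
    (h : ∀ j, ∀ z : ℂ, z ≠ 0 → ∀ l ∈ 𝔻, ω' j (z, l) = ω j (z, l)) :
    IsIntegrablePfaffian 𝔻 A ω' := by
  have hω' : ∀ j, HolomorphicMatOn (ω' j) ({z : ℂ | z ≠ 0} ×ˢ 𝔻) := fun j a b =>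
    (hω.holomorphic j a b).congr fun q hq => by rw [h j q.1 hq.1 q.2 hq.2]
  have hp : ∀ q ∈ {z : ℂ | z ≠ 0} ×ˢ 𝔻, ∀ v, pfaffianForm A ω' q v = pfaffianForm A ω q v :=
    fun q hq v => by
      simp only [pfaffianForm]
      congr 1
      exact Finset.sum_congr rfl fun j _ => by rw [h j q.1 hq.1 q.2 hq.2]
  have hf : ∀ q ∈ {z : ℂ | z ≠ 0} ×ˢ 𝔻, ∀ u v, fderiv ℂ (fun q' => pfaffianForm A ω' q' v) q u =
      fderiv ℂ (fun q' => pfaffianForm A ω q' v) q u := fun q hq u v => by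
    have : (fun q' => pfaffianForm A ω' q' v) =ᶠ[𝓝 q] fun q' => pfaffianForm A ω q' v := by
      filter_upwards [(isOpen_ne_zero_prod hO).mem_nhds hq] with y hy using hp y hy v
    exact congrArg (fun L => L u) (this.fderiv_eq (𝕜 := ℂ))
  rw [integrable_iff hO hA hω']
  intro q hq u v
  rw [hf q hq, hf q hq, hp q hq, hp q hq]
  exact (integrable_iff hO hA hω.holomorphic).1 hω q hq u v

theorem SolvesPfaffian.congr {s : ℕ} {p : Fin s → ℕ} {𝔻 : Set (Fin s → ℂ)}
    {A : (Fin s → ℂ) → Mat (∑ j, p j)} {ω ω' : Fin s → ℂ × (Fin s → ℂ) → Mat (∑ j, p j)}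
    {Y : ℂ × (Fin s → ℂ) → Mat (∑ j, p j)} (hY : SolvesPfaffian 𝔻 A ω' Y)
    (h : ∀ j, ∀ z : ℂ, z ≠ 0 → ∀ l ∈ 𝔻, ω' j (z, l) = ω j (z, l)) : SolvesPfaffian 𝔻 A ω Y := by
  intro w l hl v a b
  have := hY w l hl v a b
  simp only [pfaffianForm, h _ _ (Complex.exp_ne_zero w) l hl] at this
  exact this

theorem isIntegrablePfaffian_leveltPfaffian {s : ℕ} {p : Fin s → ℕ} {𝔻 : Set (Fin s → ℂ)}
    {A : (Fin s → ℂ) → Mat (∑ j, p j)} {Y : ℂ × (Fin s → ℂ) → Mat (∑ j, p j)}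
    {T : (Fin s → ℂ) → LeveltData (∑ j, p j)} (hO : IsOpen 𝔻) (hC : IsPreconnected 𝔻)
    (hA : HolomorphicMatOn A 𝔻) (hY : IsIsomonodromicSolution 𝔻 A Y)
    (hT : IsLeveltFamily 𝔻 A T Y) : IsIntegrablePfaffian 𝔻 A (leveltPfaffian T) :=
  isIntegrablePfaffian_of_solution hO hA
    (fun j a b => (holomorphicAtZero_leveltPfaffian hO hC hA hY hT j a b).mono
      (prod_mono (subset_univ _) subset_rfl))
    hY.holomorphic hY.fundamental.invertible (solvesPfaffian_leveltPfaffian hO hC hA hY hT)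

end Isomonodromy

theorem mainTheorem3 {s : ℕ} (p : Fin s → ℕ) (c : Fin s → ℂ) (r : Fin s → ℝ)
    (hr : ∀ j, 0 < r j) (A : (Fin s → ℂ) → Mat (∑ j, p j))
    (hA : HolomorphicMatOn A (polydisc c r)) :
    -- a holomorphic isomonodromic solution in Levelt form exists iff the system is the
    -- `z`-component of an integrable Pfaffian system with `ω_j` holomorphic on `ℂ × 𝔻`
    ((∃ Y T, IsIsomonodromicSolution (polydisc c r) A Y ∧
        IsLeveltFamily (polydisc c r) A T Y) ↔
      ∃ ω, IsIntegrablePfaffian (polydisc c r) A ω ∧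
        HolomorphicAtZero (polydisc c r) ω) ∧
    -- the same for a given integrable Pfaffian system on `(ℂ ∖ {0}) × 𝔻`
    (∀ ω, IsIntegrablePfaffian (polydisc c r) A ω →
      ((∃ Y T, IsIsomonodromicSolution (polydisc c r) A Y ∧
          SolvesPfaffian (polydisc c r) A ω Y ∧
          IsLeveltFamily (polydisc c r) A T Y) ↔
        ∃ ω', HolomorphicAtZero (polydisc c r) ω' ∧
          ∀ j, ∀ z : ℂ, z ≠ 0 → ∀ l ∈ polydisc c r, ω' j (z, l) = ω j (z, l))) ∧
    -- in this case:
    (∀ Y T, IsIsomonodromicSolution (polydisc c r) A Y →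
      IsLeveltFamily (polydisc c r) A T Y →
      -- the exponents are constant
      (∀ l ∈ polydisc c r, ∀ l' ∈ polydisc c r,
        (T l).D = (T l').D ∧ (T l).L = (T l').L ∧ (T l).J = (T l').J ∧ (T l).R = (T l').R) ∧
      -- `Y` solves an integrable Pfaffian system with `ω_j` holomorphic on `ℂ × 𝔻`
      (∃ ω, IsIntegrablePfaffian (polydisc c r) A ω ∧
        HolomorphicAtZero (polydisc c r) ω ∧
        SolvesPfaffian (polydisc c r) A ω Y) ∧
      -- and for this system `A` is holomorphically similar to `J` through a fundamental
      -- matrix solution `G` of `dG = ∑ ω_j(0, λ) dλ_j G`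
      (∀ ω, IsIntegrablePfaffian (polydisc c r) A ω →
        HolomorphicAtZero (polydisc c r) ω →
        SolvesPfaffian (polydisc c r) A ω Y →
        IsFundamentalSolutionAtZero (polydisc c r) ω
          (fun l => (T l).G) ∧
        ∀ l ∈ polydisc c r, (T l).G⁻¹ * A l * (T l).G = (T l).J)) := by
  have hO := isOpen_polydisc c r
  have hC := isPreconnected_polydisc c r
  refine ⟨⟨?_, ?_⟩, fun ω hω => ⟨?_, ?_⟩, fun Y T hY hT => ⟨?_, ?_, ?_⟩⟩
  · rintro ⟨Y, T, hY, hT⟩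
    exact ⟨leveltPfaffian T, isIntegrablePfaffian_leveltPfaffian hO hC hA hY hT,
      holomorphicAtZero_leveltPfaffian hO hC hA hY hT⟩
  · rintro ⟨ω, hω, hω0⟩
    obtain ⟨Y, T, hY, -, hT⟩ := exists_isomonodromic_levelt hA hω hω0
    exact ⟨Y, T, hY, hT⟩
  · rintro ⟨Y, T, hY, hsol, hT⟩
    exact ⟨leveltPfaffian T, holomorphicAtZero_leveltPfaffian hO hC hA hY hT,
      fun j z hz l hl => pfaffian_unique hO hY.holomorphic hY.fundamental.invertible
        (solvesPfaffian_leveltPfaffian hO hC hA hY hT) hsol j hz hl⟩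
  · rintro ⟨ω', hω', h⟩
    obtain ⟨Y, T, hY, hsol, hT⟩ := exists_isomonodromic_levelt hA (hω.congr hO hA h) hω'
    exact ⟨Y, T, hY, hsol.congr h, hT⟩
  · exact fun l hl l' hl' => levelt_const hO hC hA hY hT hl hl'
  · exact ⟨leveltPfaffian T, isIntegrablePfaffian_leveltPfaffian hO hC hA hY hT,
      holomorphicAtZero_leveltPfaffian hO hC hA hY hT,
      solvesPfaffian_leveltPfaffian hO hC hA hY hT⟩
  · exact fun ω _ hω0 hsol => ⟨isFundamentalSolutionAtZero_G hO hC hA hY hT hω0 hsol,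
      fun l hl => (hT l hl).similar⟩
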